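/- Let $n\ge 3$ and let $\Omega\subset\mathbb R^n$ be a bounded domain with smooth boundary $\Gamma$ and outward unit normal $\nu$. For a vector field $u$ on $\Omega$ let $\omega=\nabla\times u$ be its vorticity, i.e. the form $\omega=\star du$ of degree $n-2$ (for $n=3$ the usual curl), let $u^\perp=\langle u,\nu\rangle$ be the normal component of $u$ on $\Gamma$, and let $\omega^{\Vert}$ be the tangential part of $\omega$ on $\Gamma$, i.e. the restriction of $\omega$ to vectors tangent to $\Gamma$ (for $n=3$ the tangential component of the vector $\omega$). Boundary values are taken in the sense of traces. Let $T^*>0$ and $\mu_0>0$, and let $a\in L^2([0,T^*];L^2(\Gamma))$ be a time-dependent smooth tangential field on $\Gamma$ (for $n=3$ a tangential vector field, in general a tangential form of degree $n-2$). Let $u_0$ be an initial velocity. Suppose that for every $\mu\in(0,\mu_0]$ there is on $[0,T^*]$ a strong solution $u_\mu$ of the Navier–Stokes problem $$\partial_t u_\mu+u_\mu\cdot\nabla u_\mu+\nabla p_\mu=\mu\Delta u_\mu,\quad \nabla\cdot u_\mu=0\ \text{ in }\Omega,\qquad u_\mu|_{t=0}=u_0,\qquad u_\mu^\perp|_\Gamma=0,\quad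 (\nabla\times u_\mu)^{\Vert}|_\Gamma=a,$$ and that there is on $[0,T^*]$ a strong solution $u\in L^\infty(0,T^*;H^2(\Omega)\cap W^{1,\infty}(\Omega))$ of the Euler problem $$\partial_t u+u\cdot\nabla u+\nabla p=0,\quad \nabla\cdot u=0\ \text{ in }\Omega,\qquad u|_{t=0}=u_0,\qquad u^\perp|_\Gamma=0 .$$ Here a strong solution is a field in $L^2(0,T^*;H^2(\Omega))\cap H^1(0,T^*;L^2(\Omega))$, with pressure in $L^2(0,T^*;H^1(\Omega))$, that satisfies the equations almost everywhere. Then for every $T\in[0,T^*]$ there is a constant $C>0$, depending only on $\Omega$, $\mu_0$, $T$ and upper bounds for $\|a\|_{L^2([0,T];L^2(\Gamma))}$ and $\|u\|_{L^\infty(0,T;H^2(\Omega)\cap W^{1,\infty}(\Omega))}$, and in particular independent of $\mu$, such that for all $\mu\in(0,\mu_0]$ $$\sup_{0\le t\le T}\|u_\mu(t,\cdot)-u(t,\cdot)\|_{L^2(\Omega)}^2\le C\mu,\qquad \int_0^T\|\nabla(u_\mu-u)(s,\cdot)\|_{L^2(\Omega)}^2\,ds\le C .$$ Consequently $u_\mu\to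 u$ in $L^\infty([0,T];L^2(\Omega))$ as $\mu\downarrow0$. -/

import Mathlib

open MeasureTheory Set Filter Topology
open scoped ENNReal ContDiff

noncomputable section

namespace InviscidLimit

/-- Euclidean space of dimension `d + 2`. -/
abbrev Space (d : ℕ) : Type := EuclideanSpace ℝ (Fin (d + 2))

/-- The standard unit vector `e_i`. -/
def basisVec {d : ℕ} (i : Fin (d + 2)) : Space d := EuclideanSpace.single i 1

/-! ### Smooth bounded domains, the outward normal and the surface measure -/

/-- `ρ` is a smooth local defining function of `Ω` near the point `x`: near `x` the set `Ω` is
`{ρ < 0}`, and `∇ρ(x) ≠ 0`. -/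
def IsDefiningFunction {d : ℕ} (Ω : Set (Space d)) (x : Space d) (ρ : Space d → ℝ) : Prop :=
  ContDiff ℝ ∞ ρ ∧ gradient ρ x ≠ 0 ∧ ∀ᶠ y in 𝓝 x, (y ∈ Ω ↔ ρ y < 0)

/-- A bounded domain (open connected nonempty set) whose boundary is smooth. -/
structure IsSmoothBoundedDomain {d : ℕ} (Ω : Set (Space d)) : Prop where
  isOpen : IsOpen Ω
  isConnected : IsConnected Ω
  isBounded : Bornology.IsBounded Ω
  smooth_boundary : ∀ x ∈ frontier Ω, ∃ ρ : Space d → ℝ, IsDefiningFunction Ω x ρ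

/-- `ν` is the outward unit normal of `Ω` at the boundary point `x`: the normalised gradient of
a local defining function. -/
def IsOutwardNormal {d : ℕ} (Ω : Set (Space d)) (x ν : Space d) : Prop :=
  ∃ ρ : Space d → ℝ, IsDefiningFunction Ω x ρ ∧ ν = ‖gradient ρ x‖⁻¹ • gradient ρ x

/-- The surface measure on `Γ = ∂Ω`: the Hausdorff measure of codimension one. -/
def surfaceMeasure {d : ℕ} (Ω : Set (Space d)) : Measure (Space d) :=
  (Measure.euclideanHausdorffMeasure (d + 1)).restrict (frontier Ω)

/-! ### Weak derivatives, traces, Sobolev norms -/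

/-- `g` is the weak partial derivative `∂_i f` on the open set `Ω`. -/
def HasWeakPartial {d : ℕ} (Ω : Set (Space d)) (i : Fin (d + 2)) (f g : Space d → ℝ) : Prop :=
  LocallyIntegrableOn f Ω ∧ LocallyIntegrableOn g Ω ∧
    ∀ φ : Space d → ℝ, ContDiff ℝ ∞ φ → HasCompactSupport φ → tsupport φ ⊆ Ω →
      ∫ x in Ω, f x * fderiv ℝ φ x (basisVec i) = - ∫ x in Ω, g x * φ x

/-- `G x i j` is the weak derivative `∂_i u^j` of the vector field `u` on `Ω`. -/
def HasWeakGradient {d : ℕ} (Ω : Set (Space d)) (u : Space d → Space d)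
    (G : Space d → Fin (d + 2) → Fin (d + 2) → ℝ) : Prop :=
  ∀ i j, HasWeakPartial Ω i (fun x => u x j) (fun x => G x i j)

/-- `H x k i j` is the weak derivative `∂_k G_{ij}`; so if `G` is the weak gradient of `u`, it is
the second weak derivative `∂_k ∂_i u^j`. -/
def HasWeakHessian {d : ℕ} (Ω : Set (Space d))
    (G : Space d → Fin (d + 2) → Fin (d + 2) → ℝ)
    (H : Space d → Fin (d + 2) → Fin (d + 2) → Fin (d + 2) → ℝ) : Prop :=
  ∀ k i j, HasWeakPartial Ω k (fun x => G x i j) (fun x => H x k i j)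

/-- `g ∈ L²(Γ)` is the boundary trace of `f ∈ H¹(Ω)`: there are smooth functions on the whole space
that converge to `f` in `H¹(Ω)` and whose restrictions to `Γ` converge to `g` in `L²(Γ)`. -/
def HasTrace {d : ℕ} (Ω : Set (Space d)) (f g : Space d → ℝ) : Prop :=
  MemLp f 2 (volume.restrict Ω) ∧ MemLp g 2 (surfaceMeasure Ω) ∧
  ∃ Df : Fin (d + 2) → Space d → ℝ,
    (∀ i, HasWeakPartial Ω i f (Df i) ∧ MemLp (Df i) 2 (volume.restrict Ω)) ∧
    ∃ φ : ℕ → Space d → ℝ, (∀ k, ContDiff ℝ ∞ (φ k)) ∧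
      Tendsto (fun k => eLpNorm (φ k - f) 2 (volume.restrict Ω)) atTop (𝓝 0) ∧
      (∀ i, Tendsto (fun k => eLpNorm (fun x => fderiv ℝ (φ k) x (basisVec i) - Df i x) 2
        (volume.restrict Ω)) atTop (𝓝 0)) ∧
      Tendsto (fun k => eLpNorm (φ k - g) 2 (surfaceMeasure Ω)) atTop (𝓝 0)

/-- `‖∇u‖²` in `L²(Ω)`, with value `∞` if `u` has no weak gradient in `L²`. (The weak gradient is
unique almost everywhere, so the infimum runs over copies of a single value.) -/
def gradNormSq {d : ℕ} (Ω : Set (Space d)) (u : Space d → Space d) : ℝ≥0∞ :=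
  ⨅ (G : Space d → Fin (d + 2) → Fin (d + 2) → ℝ) (_ : HasWeakGradient Ω u G),
    ∫⁻ x in Ω, ∑ i, ∑ j, ‖G x i j‖ₑ ^ 2

/-- The squared norm of `u` in `H²(Ω)`, with value `∞` if `u` is not in `H²(Ω)`. -/
def h2NormSq {d : ℕ} (Ω : Set (Space d)) (u : Space d → Space d) : ℝ≥0∞ :=
  ⨅ (G : Space d → Fin (d + 2) → Fin (d + 2) → ℝ)
    (H : Space d → Fin (d + 2) → Fin (d + 2) → Fin (d + 2) → ℝ)
    (_ : HasWeakGradient Ω u G) (_ : HasWeakHessian Ω G H),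
    ∫⁻ x in Ω, (∑ j, ‖u x j‖ₑ ^ 2 + ∑ i, ∑ j, ‖G x i j‖ₑ ^ 2
      + ∑ k, ∑ i, ∑ j, ‖H x k i j‖ₑ ^ 2)

/-- The norm of `u` in `W^{1,∞}(Ω)`, with value `∞` if `u` is not in `W^{1,∞}(Ω)`. -/
def w1InftyNorm {d : ℕ} (Ω : Set (Space d)) (u : Space d → Space d) : ℝ≥0∞ :=
  ⨅ (G : Space d → Fin (d + 2) → Fin (d + 2) → ℝ) (_ : HasWeakGradient Ω u G),
    max (eLpNorm u ∞ (volume.restrict Ω)) (eLpNorm G ∞ (volume.restrict Ω))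

/-- The norm of the time-dependent field `u` in `L^∞(0, T; H²(Ω) ∩ W^{1,∞}(Ω))` is at most `M`. -/
def NormLE {d : ℕ} (Ω : Set (Space d)) (T M : ℝ) (u : ℝ → Space d → Space d) : Prop :=
  ∀ᵐ t ∂(volume.restrict (Icc 0 T)),
    h2NormSq Ω (u t) ≤ ENNReal.ofReal M ^ 2 ∧ w1InftyNorm Ω (u t) ≤ ENNReal.ofReal M

/-! ### Vorticity -/

/-- The vorticity `∇ × u = ⋆du` as a form of degree `d = n - 2`, evaluated at the vectors
`v 0, …, v (d - 1)`; here `G i j = ∂_i u^j`. It equals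
`∑_{i,j} ∂_i u^j det (e_i, e_j, v 0, …, v (d - 1))`. -/
def vorticity {d : ℕ} (G : Fin (d + 2) → Fin (d + 2) → ℝ) (v : Fin d → Space d) : ℝ :=
  ∑ i, ∑ j, G i j * Matrix.det (Matrix.of fun r c =>
    (Fin.cons (basisVec i) (Fin.cons (basisVec j) v) : Fin (d + 2) → Space d) r c)

/-- In dimension three the vorticity form is `v ↦ ⟨curl u, v⟩`. -/
theorem vorticity_dim_three (G : Fin 3 → Fin 3 → ℝ) (v : Fin 1 → Space 1) :
    vorticity (d := 1) G v =
      (G 1 2 - G 2 1) * v 0 0 + (G 2 0 - G 0 2) * v 0 1 + (G 0 1 - G 1 0) * v 0 2 := by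
  have hdet : ∀ a b : Space 1, Matrix.det (Matrix.of fun r c : Fin 3 =>
      (Fin.cons a (Fin.cons b v) : Fin 3 → Space 1) r c) =
      a 0 * b 1 * v 0 2 - a 0 * b 2 * v 0 1 - a 1 * b 0 * v 0 2 + a 1 * b 2 * v 0 0
        + a 2 * b 0 * v 0 1 - a 2 * b 1 * v 0 0 :=
    fun a b => Matrix.det_fin_three _
  have hsum : vorticity (d := 1) G v = ∑ i : Fin 3, ∑ j : Fin 3, G i j *
      Matrix.det (Matrix.of fun r c : Fin 3 => (Fin.cons (basisVec (d := 1) i)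
        (Fin.cons (basisVec (d := 1) j) v) : Fin 3 → Space 1) r c) := rfl
  have hb : ∀ i c : Fin 3, basisVec (d := 1) i c = if c = i then 1 else 0 := fun i c => by
    simp [basisVec]
  rw [hsum]
  simp only [hdet, hb, Fin.sum_univ_three]
  simp
  ring

/-- Boundary data: for each time, a smooth tangential form `a(t, ·)` of degree `d = n - 2` on `Γ`
(in dimension three: a smooth tangential vector field), square integrable on `[0, T] × Γ`. -/
structure IsBoundaryField {d : ℕ} (Ω : Set (Space d)) (T : ℝ)
    (a : ℝ → Space d → (Space d) [⋀^Fin d]→L[ℝ] ℝ) : Prop where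
  smooth : ∀ t ∈ Icc 0 T, ContDiffOn ℝ ∞ (a t) (frontier Ω)
  tangential : ∀ t ∈ Icc 0 T, ∀ x ∈ frontier Ω, ∀ ν, IsOutwardNormal Ω x ν →
    ∀ v : Fin d → Space d, (∃ k, v k = ν) → a t x v = 0
  memLp : MemLp (fun z : ℝ × Space d => a z.1 z.2) 2
    ((volume.restrict (Icc 0 T)).prod (surfaceMeasure Ω))

/-- The norm of `a` in `L²([0, T]; L²(Γ))`. -/
def boundaryNorm {d : ℕ} (Ω : Set (Space d)) (T : ℝ)
    (a : ℝ → Space d → (Space d) [⋀^Fin d]→L[ℝ] ℝ) : ℝ≥0∞ :=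
  eLpNorm (fun z : ℝ × Space d => a z.1 z.2) 2
    ((volume.restrict (Icc 0 T)).prod (surfaceMeasure Ω))

/-- The kinematic condition `u^⊥ = 0` on `Γ`, in the sense of traces. -/
def KinematicCondition {d : ℕ} (Ω : Set (Space d)) (u : Space d → Space d) : Prop :=
  ∃ g : Space d → Space d, (∀ j, HasTrace Ω (fun x => u x j) (fun x => g x j)) ∧
    ∀ᵐ x ∂(surfaceMeasure Ω), ∀ ν, IsOutwardNormal Ω x ν → inner ℝ (g x) ν = 0

/-- The vorticity condition `ω^∥ = a` on `Γ`, in the sense of traces: the vorticity form and `a`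
agree on tangent vectors. Here `G` is the weak gradient of the velocity. -/
def VorticityCondition {d : ℕ} (Ω : Set (Space d))
    (G : Space d → Fin (d + 2) → Fin (d + 2) → ℝ)
    (a : Space d → (Space d) [⋀^Fin d]→L[ℝ] ℝ) : Prop :=
  ∃ g : Space d → Fin (d + 2) → Fin (d + 2) → ℝ,
    (∀ i j, HasTrace Ω (fun x => G x i j) (fun x => g x i j)) ∧
    ∀ᵐ x ∂(surfaceMeasure Ω), ∀ ν, IsOutwardNormal Ω x ν →
      ∀ v : Fin d → Space d, (∀ k, inner ℝ (v k) ν = 0) → vorticity (g x) v = a x v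

/-! ### Strong solutions -/

/-- Lebesgue measure on `[0, T] × Ω`. -/
def spaceTime {d : ℕ} (Ω : Set (Space d)) (T : ℝ) : Measure (ℝ × Space d) :=
  (volume.restrict (Icc 0 T)).prod (volume.restrict Ω)

/-- `u` with pressure `p` is a strong solution on `[0, T]` of
`∂_t u + u·∇u + ∇p = μ Δu`, `div u = 0`, `u(0) = u₀`, `u^⊥ = 0` on `Γ`:
`u ∈ L²(0, T; H²) ∩ H¹(0, T; L²)`, `p ∈ L²(0, T; H¹)`, and the equations hold almost everywhere.
The functions `ut`, `G`, `H`, `q` are `∂_t u`, `∇u`, `∇²u`, `∇p`; the field `time_deriv` says that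
`u` is absolutely continuous in time with values in `L²(Ω)`, has the derivative `ut`, and starts
at `u₀`. For `μ = 0` these are the Euler equations. -/
structure IsStrongSolution {d : ℕ} (Ω : Set (Space d)) (μ T : ℝ) (u₀ : Space d → Space d)
    (u : ℝ → Space d → Space d) (p : ℝ → Space d → ℝ) (ut : ℝ → Space d → Space d)
    (G : ℝ → Space d → Fin (d + 2) → Fin (d + 2) → ℝ)
    (H : ℝ → Space d → Fin (d + 2) → Fin (d + 2) → Fin (d + 2) → ℝ)
    (q : ℝ → Space d → Space d) : Prop where
  memLp_u : MemLp (fun z : ℝ × Space d => u z.1 z.2) 2 (spaceTime Ω T)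
  memLp_ut : MemLp (fun z : ℝ × Space d => ut z.1 z.2) 2 (spaceTime Ω T)
  memLp_grad : MemLp (fun z : ℝ × Space d => G z.1 z.2) 2 (spaceTime Ω T)
  memLp_hess : MemLp (fun z : ℝ × Space d => H z.1 z.2) 2 (spaceTime Ω T)
  memLp_p : MemLp (fun z : ℝ × Space d => p z.1 z.2) 2 (spaceTime Ω T)
  memLp_gradp : MemLp (fun z : ℝ × Space d => q z.1 z.2) 2 (spaceTime Ω T)
  time_deriv : ∀ t ∈ Icc 0 T, ∀ᵐ x ∂(volume.restrict Ω),
    u t x = u₀ x + ∫ s in (0 : ℝ)..t, ut s x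
  grad : ∀ᵐ t ∂(volume.restrict (Icc 0 T)), HasWeakGradient Ω (u t) (G t)
  hess : ∀ᵐ t ∂(volume.restrict (Icc 0 T)), HasWeakHessian Ω (G t) (H t)
  gradp : ∀ᵐ t ∂(volume.restrict (Icc 0 T)), ∀ i, HasWeakPartial Ω i (p t) (fun x => q t x i)
  momentum : ∀ᵐ z ∂(spaceTime Ω T), ∀ j,
    ut z.1 z.2 j + ∑ i, u z.1 z.2 i * G z.1 z.2 i j + q z.1 z.2 j = μ * ∑ i, H z.1 z.2 i i j
  incompressible : ∀ᵐ z ∂(spaceTime Ω T), ∑ i, G z.1 z.2 i i = 0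
  kinematic : ∀ᵐ t ∂(volume.restrict (Icc 0 T)), KinematicCondition Ω (u t)

/-- `u` is a strong solution on `[0, T]` of the Navier–Stokes equations with viscosity `μ`, initial
value `u₀`, the kinematic condition and the vorticity condition `ω^∥ = a`. -/
def IsStrongNavierStokesSolution {d : ℕ} (Ω : Set (Space d)) (μ T : ℝ)
    (a : ℝ → Space d → (Space d) [⋀^Fin d]→L[ℝ] ℝ) (u₀ : Space d → Space d)
    (u : ℝ → Space d → Space d) : Prop :=
  ∃ p ut G H q, IsStrongSolution Ω μ T u₀ u p ut G H q ∧
    ∀ᵐ t ∂(volume.restrict (Icc 0 T)), VorticityCondition Ω (G t) (a t)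

/-- `u` is a strong solution on `[0, T]` of the Euler equations with initial value `u₀` and the
kinematic condition, and `u ∈ L^∞(0, T; H²(Ω) ∩ W^{1,∞}(Ω))`. -/
def IsStrongEulerSolution {d : ℕ} (Ω : Set (Space d)) (T : ℝ) (u₀ : Space d → Space d)
    (u : ℝ → Space d → Space d) : Prop :=
  (∃ p ut G H q, IsStrongSolution Ω 0 T u₀ u p ut G H q) ∧ ∃ M : ℝ, NormLE Ω T M u

end InviscidLimit

end

open InviscidLimit

open MeasureTheory Set Filter Topology
open scoped ENNReal ContDiff

noncomputable section

namespace InviscidLimit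

variable {d : ℕ}

/-! The proof is an energy estimate for w = v − u, where v = u_μ. After subtracting the two
equations and testing with w, the pressures drop out, and so does ∫ (v·∇w)·w, because v and w are
solenoidal and tangent to Γ. There remain the stretching term −∫ (w·∇u)·w, which is at most a
multiple of ‖∇u‖_∞ ‖w‖², and the viscous term μ ∫ Δv·w. The point is to bound the latter by
−(μ/2)‖∇w‖² + Cμ(‖w‖² + ‖u‖²_{H¹} + ‖a‖²_{L²(Γ)}): the forcing is then of order μ, and since w
vanishes at time 0, Gronwall's inequality gives ‖w‖² ≤ Cμ. The dissipation carries the factor μ as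
well, so dividing by μ leaves ∫ ‖∇w‖² ≤ C.

For the viscous term, div v = 0 gives Δv_j = ∑_i ∂_i(∂_i v_j − ∂_j v_i), and Gauss' theorem yields ∫
Δv·w = −∫ ∇v:∇w + ∫ ∑ ∂_j v_i ∂_i w_j + ∫_Γ ∑ ν_i (∂_i v_j − ∂_j v_i) w_j
(`PatchCover.integral_laplacian`). The boundary term pairs the vorticity with ν and the tangent
vector w, so the vorticity condition bounds it by |a||w| (`abs_vorticity_pairing_le`). The middle
term is a null Lagrangian: for tangential solenoidal fields it equals −∫_Γ ∑ v_i (∂_i ν_j) w_j, a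
curvature term without derivatives of v and w (`IsPatch.nullForm_tangential`). A trace inequality
with a small coefficient in front of the gradient (`PatchCover.bndSq_le`) absorbs the boundary norm
of w into the dissipation. Together this is `PatchCover.laplacian_le`, and `PatchCover.energy_le`
adds the other terms.

The dimension is arbitrary and the fields are merely of class H² in space, so three steps need care.
The pressure comes without a trace; it is mollified by kernels that look only into Ω
(`PatchCover.integral_weak_grad_eq_zero`). The cubic convection integral makes sense because the
equation itself shows v·∇w ∈ L², and it vanishes by truncation of w
(`PatchCover.integral_convection_eq_zero`). The energy balance in time is obtained pointwise in x
and then integrated (`energy_identity`).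

Gauss' theorem is derived in boundary charts by Fubini along lines transversal to Γ and transferred
to H¹ fields by smooth approximation. The boundary measure that arises is only compared with the
surface measure, not identified with it: domination is enough to carry over traces in L²(Γ) and
boundary conditions that hold almost everywhere. -/

/-! ### Splitting of space along a direction -/

/-- A rotation that takes the first standard basis vector to a given unit vector. -/
theorem exists_rotation (e : Space d) (he : ‖e‖ = 1) :
    ∃ R : Space d ≃ₗᵢ[ℝ] Space d, R (basisVec 0) = e := by
  have hv : Orthonormal ℝ (({0} : Set (Fin (d + 2))).domRestrict (fun _ => e)) := by
    refine ⟨fun i => he, fun i j hij => (hij (Subsingleton.elim i j)).elim⟩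
  obtain ⟨b, hb⟩ := hv.exists_orthonormalBasis_extension_of_card_eq (by simp)
  refine ⟨b.repr.symm, ?_⟩
  have : b.repr.symm (basisVec 0) = b 0 := by
    rw [basisVec, OrthonormalBasis.repr_symm_single]
  rw [this, hb 0 rfl]

/-- The point with rotated coordinates `(t, y)`. -/
def slice (R : Space d ≃ₗᵢ[ℝ] Space d) (t : ℝ) (y : EuclideanSpace ℝ (Fin (d + 1))) : Space d :=
  R (WithLp.toLp 2 (Fin.cons t (WithLp.ofLp y) : Fin (d + 2) → ℝ))

/-- The last `d + 1` rotated coordinates. -/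
def proj (R : Space d ≃ₗᵢ[ℝ] Space d) (x : Space d) : EuclideanSpace ℝ (Fin (d + 1)) :=
  WithLp.toLp 2 (fun k => R.symm x k.succ)

theorem slice_proj (R : Space d ≃ₗᵢ[ℝ] Space d) (x : Space d) :
    slice R (R.symm x 0) (proj R x) = x := by
  have : (WithLp.toLp 2 (Fin.cons (R.symm x 0) (WithLp.ofLp (proj R x)) : Fin (d + 2) → ℝ) : Space d)
      = R.symm x := by
    ext i
    refine Fin.cases ?_ (fun k => ?_) i <;> simp [proj]
  rw [slice, this, R.apply_symm_apply]

theorem proj_slice (R : Space d ≃ₗᵢ[ℝ] Space d) (t : ℝ) (y : EuclideanSpace ℝ (Fin (d + 1))) :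
    proj R (slice R t y) = y := by
  ext k
  simp [proj, slice]

theorem slice_add (R : Space d ≃ₗᵢ[ℝ] Space d) (t s : ℝ) (y z : EuclideanSpace ℝ (Fin (d + 1))) :
    slice R (t + s) (y + z) = slice R t y + slice R s z := by
  rw [slice, slice, slice, ← map_add]
  congr 1
  ext i
  refine Fin.cases ?_ (fun k => ?_) i <;> simp

theorem slice_eq_smul (R : Space d ≃ₗᵢ[ℝ] Space d) (t : ℝ) :
    slice R t 0 = t • R (basisVec 0) := by
  rw [slice, ← map_smul]
  congr 1
  ext i
  refine Fin.cases ?_ (fun k => ?_) i <;> simp [basisVec]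

theorem slice_eq_add (R : Space d ≃ₗᵢ[ℝ] Space d) (t : ℝ) (y : EuclideanSpace ℝ (Fin (d + 1))) :
    slice R t y = slice R 0 y + t • R (basisVec 0) := by
  rw [← slice_eq_smul, ← slice_add]; simp

theorem norm_slice_zero (R : Space d ≃ₗᵢ[ℝ] Space d) (y : EuclideanSpace ℝ (Fin (d + 1))) :
    ‖slice R 0 y‖ = ‖y‖ := by
  rw [slice, R.norm_map, EuclideanSpace.norm_eq, EuclideanSpace.norm_eq, Fin.sum_univ_succ]
  simp

theorem proj_sub (R : Space d ≃ₗᵢ[ℝ] Space d) (x y : Space d) :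
    proj R (x - y) = proj R x - proj R y := by
  ext k
  simp [proj]

theorem norm_proj_le (R : Space d ≃ₗᵢ[ℝ] Space d) (x : Space d) : ‖proj R x‖ ≤ ‖x‖ := by
  rw [← R.symm.norm_map x, EuclideanSpace.norm_eq, EuclideanSpace.norm_eq,
    Fin.sum_univ_succ (fun i => ‖(R.symm x) i‖ ^ 2)]
  apply Real.sqrt_le_sqrt
  simp only [proj]
  nlinarith [sq_nonneg ‖(R.symm x) 0‖]

theorem lipschitzWith_proj (R : Space d ≃ₗᵢ[ℝ] Space d) : LipschitzWith 1 (proj R) := by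
  refine LipschitzWith.of_dist_le_mul fun x y => ?_
  rw [dist_eq_norm, dist_eq_norm, ← proj_sub]
  simpa using norm_proj_le R (x - y)

/-- The map is a composition of measure preserving ones: the passages between Euclidean and product
coordinates, the insertion of the zeroth coordinate, and the rotation. It permits Fubini along lines
in an arbitrary direction. -/
theorem measurePreserving_slice (R : Space d ≃ₗᵢ[ℝ] Space d) :
    MeasurePreserving (fun p : ℝ × EuclideanSpace ℝ (Fin (d + 1)) => slice R p.1 p.2)
      (volume.prod volume) volume := by
  have h0 : MeasurePreserving (fun y : EuclideanSpace ℝ (Fin (d + 1)) => WithLp.ofLp y)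
      volume volume := PiLp.volume_preserving_ofLp (Fin (d + 1))
  have h1 : MeasurePreserving (Prod.map (id : ℝ → ℝ)
      (fun y : EuclideanSpace ℝ (Fin (d + 1)) => WithLp.ofLp y))
      (volume.prod volume) (volume.prod volume) := (MeasurePreserving.id volume).prod h0
  have h2 := (volume_preserving_piFinSuccAbove (fun _ : Fin (d + 2) => ℝ) 0).symm
  have h3 : MeasurePreserving (fun y : Fin (d + 2) → ℝ => (WithLp.toLp 2 y : Space d))
      volume volume := PiLp.volume_preserving_toLp (Fin (d + 2))
  have h4 : MeasurePreserving R volume volume := R.measurePreserving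
  have h5 := h4.comp (h3.comp (h2.comp h1))
  have h6 : (fun p : ℝ × EuclideanSpace ℝ (Fin (d + 1)) => slice R p.1 p.2) =
      R ∘ ((fun y : Fin (d + 2) → ℝ => (WithLp.toLp 2 y : Space d)) ∘
        ((MeasurableEquiv.piFinSuccAbove (fun _ : Fin (d + 2) => ℝ) 0).symm ∘
        Prod.map (id : ℝ → ℝ) (fun y : EuclideanSpace ℝ (Fin (d + 1)) => WithLp.ofLp y))) := by
    funext p
    simp only [slice, Function.comp, MeasurableEquiv.piFinSuccAbove]
    congr 2
    simp [Fin.insertNthEquiv, Fin.insertNth_zero']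
  rw [h6]
  exact h5

/-! ### Boundary charts -/

/-- A chart of the boundary of `Ω` in a ball: there `Ω` is the sublevel set of a smooth function
whose derivative in the direction `e` is bounded below. -/
structure IsChart (Ω : Set (Space d)) (x₀ : Space d) (r : ℝ) (ρ : Space d → ℝ) (e : Space d)
    (c C : ℝ) : Prop where
  smooth : ContDiff ℝ ∞ ρ
  norm_dir : ‖e‖ = 1
  pos : 0 < c
  mem_iff : ∀ x ∈ Metric.ball x₀ r, (x ∈ Ω ↔ ρ x < 0)
  le_deriv : ∀ x ∈ Metric.ball x₀ r, c ≤ fderiv ℝ ρ x e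
  deriv_le : ∀ x ∈ Metric.ball x₀ r, ‖fderiv ℝ ρ x‖ ≤ C

theorem gradient_apply_coord (ρ : Space d → ℝ) (x : Space d) (i : Fin (d + 2)) :
    gradient ρ x i = fderiv ℝ ρ x (basisVec i) := by
  have h : inner ℝ (gradient ρ x) (basisVec i) = fderiv ℝ ρ x (basisVec i) := by
    rw [gradient, InnerProductSpace.toDual_symm_apply]
  rw [← h, basisVec, EuclideanSpace.inner_single_right]
  simp

theorem inner_gradient (ρ : Space d → ℝ) (x v : Space d) :
    inner ℝ (gradient ρ x) v = fderiv ℝ ρ x v := by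
  rw [gradient, InnerProductSpace.toDual_symm_apply]

/-- The direction is the normalised gradient at the centre, along which the derivative there is
|∇ρ(x₀)|. By continuity of the derivative, half of this is a lower bound in a small ball, and the
operator norm exceeds its value at the centre by at most one. -/
theorem exists_isChart {Ω : Set (Space d)} {x₀ : Space d} {ρ : Space d → ℝ}
    (hρ : IsDefiningFunction Ω x₀ ρ) : ∃ r > 0, ∃ e c C, IsChart Ω x₀ r ρ e c C := by
  obtain ⟨hs, hg, hm⟩ := hρ
  set e := ‖gradient ρ x₀‖⁻¹ • gradient ρ x₀ with he
  have hg' : 0 < ‖gradient ρ x₀‖ := norm_pos_iff.2 hg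
  have hc : Continuous (fderiv ℝ ρ) := hs.continuous_fderiv (by simp)
  have h1 : fderiv ℝ ρ x₀ e = ‖gradient ρ x₀‖ := by
    rw [← inner_gradient, he, inner_smul_right, real_inner_self_eq_norm_sq]
    field_simp
  have e1 : ∀ᶠ x in 𝓝 x₀, ‖gradient ρ x₀‖ / 2 < fderiv ℝ ρ x e := by
    have h2 : ‖gradient ρ x₀‖ / 2 < fderiv ℝ ρ x₀ e := by rw [h1]; linarith
    exact (hc.clm_apply continuous_const).continuousAt.eventually_const_lt h2
  have e2 : ∀ᶠ x in 𝓝 x₀, ‖fderiv ℝ ρ x‖ < ‖fderiv ℝ ρ x₀‖ + 1 :=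
    hc.norm.continuousAt.eventually_lt_const (by linarith)
  obtain ⟨r, hr, h⟩ := Metric.eventually_nhds_iff_ball.1 (hm.and (e1.and e2))
  exact ⟨r, hr, e, _, _, hs, by rw [he, norm_smul, norm_inv, norm_norm, inv_mul_cancel₀ hg'.ne'],
    half_pos hg', fun x hx => (h x hx).1, fun x hx => (h x hx).2.1.le, fun x hx => (h x hx).2.2.le⟩

namespace IsChart

variable {Ω : Set (Space d)} {x₀ : Space d} {r : ℝ} {ρ : Space d → ℝ} {e : Space d} {c C : ℝ}

theorem gradient_ne_zero (h : IsChart Ω x₀ r ρ e c C) {x : Space d} (hx : x ∈ Metric.ball x₀ r) :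
    gradient ρ x ≠ 0 := by
  intro h0
  have := h.le_deriv x hx
  rw [← inner_gradient, h0, inner_zero_left] at this
  linarith [h.pos]

theorem isDefiningFunction (h : IsChart Ω x₀ r ρ e c C) {x : Space d} (hx : x ∈ Metric.ball x₀ r) :
    IsDefiningFunction Ω x ρ :=
  ⟨h.smooth, h.gradient_ne_zero hx,
    eventually_of_mem (Metric.isOpen_ball.mem_nhds hx) fun y hy => h.mem_iff y hy⟩

theorem hasDerivAt_line (h : IsChart Ω x₀ r ρ e c C) (x v : Space d) (t : ℝ) :
    HasDerivAt (fun s : ℝ => ρ (x + s • v)) (fderiv ℝ ρ (x + t • v) v) t := by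
  have h1 : HasFDerivAt ρ (fderiv ℝ ρ (x + t • v)) (x + t • v) :=
    (h.smooth.differentiable (by simp)).differentiableAt.hasFDerivAt
  have h2 : HasDerivAt (fun s : ℝ => x + s • v) v t := by
    simpa using ((hasDerivAt_id t).smul_const v).const_add x
  exact h1.comp_hasDerivAt t h2

/-- Moving from a point of the closure of `Ω` against the direction `e` enters `Ω`. -/
theorem lt_of_line (h : IsChart Ω x₀ r ρ e c C) {x v : Space d} (hx : x ∈ Metric.ball x₀ r)
    (hxv : x + v ∈ Metric.ball x₀ r) (hv : ∀ y ∈ Metric.ball x₀ r, fderiv ℝ ρ y v < 0) :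
    ρ (x + v) < ρ x := by
  have hmem : ∀ t ∈ Icc (0 : ℝ) 1, x + t • v ∈ Metric.ball x₀ r := fun t ht =>
    (convex_ball x₀ r).add_smul_mem hx hxv ht
  have := strictAntiOn_of_deriv_neg (convex_Icc (0 : ℝ) 1)
    (f := fun s : ℝ => ρ (x + s • v))
    (fun t _ => (h.hasDerivAt_line x v t).continuousAt.continuousWithinAt)
    (fun t ht => by
      rw [(h.hasDerivAt_line x v t).deriv]
      exact hv _ (hmem t (interior_subset ht)))
  simpa using this (left_mem_Icc.2 zero_le_one) (right_mem_Icc.2 zero_le_one) zero_lt_one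

/-- The sign condition alone describes only Ω. The transversal derivative prevents zeros of ρ from
being away from the closure: moving from a zero against e makes ρ negative at once. -/
theorem frontier_eq (h : IsChart Ω x₀ r ρ e c C) (hΩ : IsOpen Ω) :
    frontier Ω ∩ Metric.ball x₀ r = {x | ρ x = 0} ∩ Metric.ball x₀ r := by
  ext x
  refine and_congr_left fun hx => ?_
  rw [hΩ.frontier_eq, Set.mem_sdiff, mem_ofPred_eq, h.mem_iff x hx, not_lt]
  constructor
  · rintro ⟨h1, h2⟩
    refine le_antisymm ?_ h2
    by_contra! hpos
    obtain ⟨y, hy, hyΩ⟩ := mem_closure_iff.1 h1 ({z | 0 < ρ z} ∩ Metric.ball x₀ r)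
      ((isOpen_lt continuous_const h.smooth.continuous).inter Metric.isOpen_ball) ⟨hpos, hx⟩
    have := (h.mem_iff y hy.2).1 hyΩ
    have := hy.1
    simp only [mem_ofPred_eq] at this
    linarith
  · intro h0
    refine ⟨?_, h0.ge⟩
    have hcont : Tendsto (fun s : ℝ => x + s • (-e)) (𝓝[>] 0) (𝓝 x) := by
      have : Continuous (fun s : ℝ => x + s • (-e)) := by fun_prop
      have h := this.tendsto 0
      simp only [zero_smul, add_zero] at h
      exact h.mono_left nhdsWithin_le_nhds
    refine mem_closure_of_tendsto hcont ?_
    filter_upwards [hcont (Metric.isOpen_ball.mem_nhds hx), self_mem_nhdsWithin] with s hs hs0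
    rw [h.mem_iff _ hs]
    rw [← h0]
    apply h.lt_of_line hx hs
    intro y hy
    have h1 := h.le_deriv y hy
    have h2 := h.pos
    have hs0' : 0 < s := hs0
    rw [map_smul, map_neg, smul_eq_mul]
    nlinarith

/-- The zero set of the chart is a Lipschitz graph over the hyperplane orthogonal to `e`. -/
theorem dist_le (h : IsChart Ω x₀ r ρ e c C) (R : Space d ≃ₗᵢ[ℝ] Space d) (hR : R (basisVec 0) = e)
    {x y : Space d} (hx : x ∈ {x | ρ x = 0} ∩ Metric.ball x₀ r)
    (hy : y ∈ {x | ρ x = 0} ∩ Metric.ball x₀ r) :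
    dist x y ≤ (1 + C / c) * dist (proj R x) (proj R y) := by
  have hmem : ∀ t ∈ Icc (0 : ℝ) 1, x + t • (y - x) ∈ Metric.ball x₀ r := fun t ht =>
    (convex_ball x₀ r).add_smul_mem hx.2 (by simpa using hy.2) ht
  -- By Rolle, the derivative of ρ along y − x vanishes somewhere on the segment. With y − x = z + s
  -- e and z orthogonal to e, the bounds c and C at that point force |s| ≤ (C/c)|z|.
  obtain ⟨t, ht, ht0⟩ := exists_hasDerivAt_eq_zero (f := fun s : ℝ => ρ (x + s • (y - x)))
    zero_lt_one
    (fun t _ => (h.hasDerivAt_line x (y - x) t).continuousAt.continuousWithinAt)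
    (by
      have h1 : ρ x = 0 := hx.1
      have h2 : ρ y = 0 := hy.1
      simp [h1, h2])
    (fun t _ => h.hasDerivAt_line x (y - x) t)
  set ξ := x + t • (y - x)
  have hξ : ξ ∈ Metric.ball x₀ r := hmem t (Ioo_subset_Icc_self ht)
  have hdec : y - x = slice R 0 (proj R (y - x)) + (R.symm (y - x) 0) • e := by
    conv_lhs => rw [← slice_proj R (y - x)]
    rw [slice_eq_add, hR]
  set s := R.symm (y - x) 0
  set z := slice R 0 (proj R (y - x))
  have hz : ‖z‖ = dist (proj R x) (proj R y) := by
    rw [norm_slice_zero, proj_sub, dist_comm, dist_eq_norm]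
  have h1 : s * fderiv ℝ ρ ξ e = - fderiv ℝ ρ ξ z := by
    rw [hdec, map_add, map_smul, smul_eq_mul] at ht0
    linarith
  have h2 : |s| * c ≤ C * ‖z‖ := by
    calc |s| * c ≤ |s| * fderiv ℝ ρ ξ e := by gcongr; exact h.le_deriv ξ hξ
      _ = |s * fderiv ℝ ρ ξ e| := by
          rw [abs_mul, abs_of_nonneg (h.pos.le.trans (h.le_deriv ξ hξ))]
      _ = ‖fderiv ℝ ρ ξ z‖ := by rw [h1, abs_neg]; rfl
      _ ≤ ‖fderiv ℝ ρ ξ‖ * ‖z‖ := ContinuousLinearMap.le_opNorm _ _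
      _ ≤ C * ‖z‖ := by gcongr; exact h.deriv_le ξ hξ
  have h3 : |s| ≤ C / c * ‖z‖ := by
    rw [div_mul_eq_mul_div, le_div_iff₀ h.pos]; exact h2
  calc dist x y = ‖y - x‖ := by rw [dist_comm, dist_eq_norm]
    _ = ‖z + s • e‖ := by rw [hdec]
    _ ≤ ‖z‖ + |s| := by
        refine (norm_add_le _ _).trans ?_
        rw [norm_smul, h.norm_dir, mul_one, Real.norm_eq_abs]
    _ ≤ (1 + C / c) * ‖z‖ := by linarith
    _ = _ := by rw [hz]

end IsChart

/-! ### Graph parametrisation of the boundary and Fubini in a chart -/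

namespace IsChart

variable {Ω : Set (Space d)} {x₀ : Space d} {r : ℝ} {ρ : Space d → ℝ} {e : Space d} {c C : ℝ}

/-- The zero set of the chart function in the ball. -/
def zeroSet (x₀ : Space d) (r : ℝ) (ρ : Space d → ℝ) : Set (Space d) :=
  {x | ρ x = 0} ∩ Metric.ball x₀ r

/-- The inverse of the projection of the zero set to the hyperplane. -/
def graphMap (x₀ : Space d) (r : ℝ) (ρ : Space d → ℝ) (R : Space d ≃ₗᵢ[ℝ] Space d) :
    EuclideanSpace ℝ (Fin (d + 1)) → Space d :=
  Function.invFunOn (proj R) (zeroSet x₀ r ρ)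

/-- The Lebesgue measure of the hyperplane, carried to the zero set. -/
def graphMeasure (x₀ : Space d) (r : ℝ) (ρ : Space d → ℝ) (R : Space d ≃ₗᵢ[ℝ] Space d) :
    Measure (Space d) :=
  Measure.map (graphMap x₀ r ρ R) (volume.restrict (proj R '' zeroSet x₀ r ρ))

theorem const_nonneg (h : IsChart Ω x₀ r ρ e c C) (hr : 0 < r) : 0 ≤ C :=
  (norm_nonneg _).trans (h.deriv_le x₀ (Metric.mem_ball_self hr))

theorem injOn_proj (h : IsChart Ω x₀ r ρ e c C) (R : Space d ≃ₗᵢ[ℝ] Space d)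
    (hR : R (basisVec 0) = e) : InjOn (proj R) (zeroSet x₀ r ρ) := by
  intro x hx y hy hxy
  have := h.dist_le R hR hx hy
  rw [hxy, dist_self, mul_zero] at this
  exact dist_le_zero.1 this

theorem graphMap_mem (R : Space d ≃ₗᵢ[ℝ] Space d) {y : EuclideanSpace ℝ (Fin (d + 1))}
    (hy : y ∈ proj R '' zeroSet x₀ r ρ) : graphMap x₀ r ρ R y ∈ zeroSet x₀ r ρ :=
  Function.invFunOn_mem hy

theorem proj_graphMap (R : Space d ≃ₗᵢ[ℝ] Space d) {y : EuclideanSpace ℝ (Fin (d + 1))}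
    (hy : y ∈ proj R '' zeroSet x₀ r ρ) : proj R (graphMap x₀ r ρ R y) = y :=
  Function.invFunOn_eq hy

theorem lipschitzOnWith_graphMap (h : IsChart Ω x₀ r ρ e c C) (R : Space d ≃ₗᵢ[ℝ] Space d)
    (hR : R (basisVec 0) = e) :
    LipschitzOnWith (Real.toNNReal (1 + C / c)) (graphMap x₀ r ρ R) (proj R '' zeroSet x₀ r ρ) := by
  refine LipschitzOnWith.of_dist_le_mul fun x hx y hy => ?_
  have h1 := h.dist_le R hR (graphMap_mem R hx) (graphMap_mem R hy)
  rw [proj_graphMap R hx, proj_graphMap R hy] at h1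
  refine h1.trans ?_
  gcongr
  exact Real.le_coe_toNNReal _

theorem measurableSet_zeroSet (h : IsChart Ω x₀ r ρ e c C) : MeasurableSet (zeroSet x₀ r ρ) :=
  (isClosed_eq h.smooth.continuous continuous_const).measurableSet.inter Metric.isOpen_ball.measurableSet

/-- The projection is continuous and injective on the measurable zero set, so the Lusin–Souslin
theorem applies and no description of the image is needed. -/
theorem measurableSet_image (h : IsChart Ω x₀ r ρ e c C) (R : Space d ≃ₗᵢ[ℝ] Space d)
    (hR : R (basisVec 0) = e) : MeasurableSet (proj R '' zeroSet x₀ r ρ) :=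
  h.measurableSet_zeroSet.image_of_continuousOn_injOn (lipschitzWith_proj R).continuous.continuousOn
    (h.injOn_proj R hR)

theorem aemeasurable_graphMap (h : IsChart Ω x₀ r ρ e c C) (R : Space d ≃ₗᵢ[ℝ] Space d)
    (hR : R (basisVec 0) = e) :
    AEMeasurable (graphMap x₀ r ρ R) (volume.restrict (proj R '' zeroSet x₀ r ρ)) :=
  (h.lipschitzOnWith_graphMap R hR).continuousOn.aemeasurable (h.measurableSet_image R hR)

/-- The projection is 1-Lipschitz and hence does not increase Hausdorff measure; in the hyperplane
the normalised Hausdorff measure is Lebesgue measure. -/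
theorem volume_image_proj_le (R : Space d ≃ₗᵢ[ℝ] Space d) (A : Set (Space d)) :
    volume (proj R '' A) ≤ Measure.euclideanHausdorffMeasure (d + 1) A := by
  rw [← EuclideanSpace.euclideanHausdorffMeasure_eq_volume, Measure.euclideanHausdorffMeasure_def,
    Measure.euclideanHausdorffMeasure_def, Measure.smul_apply, Measure.smul_apply]
  have h1 := (lipschitzWith_proj R).hausdorffMeasure_image_le (d := ((d + 1 : ℕ) : ℝ))
    (by positivity) A
  rw [ENNReal.coe_one, ENNReal.one_rpow, one_mul] at h1
  simp only [ENNReal.smul_def, smul_eq_mul]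
  gcongr

/-- This one-sided comparison takes the place of the area formula: traces and boundary conditions
are given with respect to the surface measure and must be available for the measure that Gauss'
theorem produces. -/
theorem graphMeasure_le (h : IsChart Ω x₀ r ρ e c C) (hΩ : IsOpen Ω) (R : Space d ≃ₗᵢ[ℝ] Space d)
    (hR : R (basisVec 0) = e) : graphMeasure x₀ r ρ R ≤ surfaceMeasure Ω := by
  refine Measure.le_iff.2 fun A hA => ?_
  rw [graphMeasure, Measure.map_apply_of_aemeasurable (h.aemeasurable_graphMap R hR) hA,
    Measure.restrict_apply₀' (h.measurableSet_image R hR).nullMeasurableSet, surfaceMeasure,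
    Measure.restrict_apply hA]
  calc volume (graphMap x₀ r ρ R ⁻¹' A ∩ proj R '' zeroSet x₀ r ρ)
      ≤ volume (proj R '' (A ∩ zeroSet x₀ r ρ)) := by
        apply measure_mono
        rintro y ⟨hyA, hy⟩
        exact ⟨_, ⟨hyA, graphMap_mem R hy⟩, proj_graphMap R hy⟩
    _ ≤ Measure.euclideanHausdorffMeasure (d + 1) (A ∩ zeroSet x₀ r ρ) := volume_image_proj_le R _
    _ ≤ _ := by
        apply measure_mono
        rw [zeroSet, ← h.frontier_eq hΩ]
        exact inter_subset_inter_right _ inter_subset_left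

theorem isBounded_image (R : Space d ≃ₗᵢ[ℝ] Space d) :
    Bornology.IsBounded (proj R '' zeroSet x₀ r ρ) :=
  (lipschitzWith_proj R).isBounded_image (Metric.isBounded_ball.subset inter_subset_right)

theorem isFiniteMeasure_graphMeasure (R : Space d ≃ₗᵢ[ℝ] Space d) :
    IsFiniteMeasure (graphMeasure x₀ r ρ R) := by
  have : IsFiniteMeasure (volume.restrict (proj R '' zeroSet x₀ r ρ)) :=
    ⟨by simpa using (isBounded_image R).measure_lt_top⟩
  rw [graphMeasure]
  infer_instance

/-- The boundary piece is a Lipschitz image of a bounded subset of the hyperplane. -/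
theorem surfaceMeasure_ball_lt_top (h : IsChart Ω x₀ r ρ e c C) (hΩ : IsOpen Ω)
    (R : Space d ≃ₗᵢ[ℝ] Space d) (hR : R (basisVec 0) = e) :
    Measure.euclideanHausdorffMeasure (d + 1) (frontier Ω ∩ Metric.ball x₀ r) < ⊤ := by
  have h1 : graphMap x₀ r ρ R '' (proj R '' zeroSet x₀ r ρ) = frontier Ω ∩ Metric.ball x₀ r := by
    rw [h.frontier_eq hΩ]
    apply Subset.antisymm
    · rintro _ ⟨y, hy, rfl⟩
      exact graphMap_mem R hy
    · intro x hx
      exact ⟨proj R x, mem_image_of_mem _ hx, h.injOn_proj R hR (graphMap_mem R (mem_image_of_mem _ hx))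
        hx (proj_graphMap R (mem_image_of_mem _ hx))⟩
  have h2 := (h.lipschitzOnWith_graphMap R hR).hausdorffMeasure_image_le
    (d := ((d + 1 : ℕ) : ℝ)) (by positivity)
  have h3 : Measure.euclideanHausdorffMeasure (d + 1) (proj R '' zeroSet x₀ r ρ) < ⊤ := by
    rw [EuclideanSpace.euclideanHausdorffMeasure_eq_volume]
    exact (isBounded_image R).measure_lt_top
  rw [← h1, Measure.euclideanHausdorffMeasure_def, Measure.smul_apply, ENNReal.smul_def, smul_eq_mul]
  rw [Measure.euclideanHausdorffMeasure_def, Measure.smul_apply, ENNReal.smul_def, smul_eq_mul] at h3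
  refine ENNReal.mul_lt_top ENNReal.coe_lt_top (h2.trans_lt (ENNReal.mul_lt_top ?_ ?_))
  · exact ENNReal.rpow_lt_top_of_nonneg (by positivity) ENNReal.coe_ne_top
  -- Finiteness is known for the normalised measure; it passes to the unnormalised one because the
  -- normalising factor is not zero.
  · by_contra! htop
    rw [top_le_iff.1 htop, ENNReal.mul_top] at h3
    · exact h3.ne rfl
    · simpa using Measure.addHaarScalarFactor_volume_hausdorffMeasure_ne_zero (d + 1)

/-- On a line in the direction e, ρ increases strictly inside the ball, so Ω meets that part of the
line in an initial piece that ends at the graph point. As F vanishes outside the ball, the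
fundamental theorem of calculus leaves the value of F at the end point. A line that misses the graph
contributes the full integral of a compactly supported derivative, or nothing at all. -/
theorem integral_line (h : IsChart Ω x₀ r ρ e c C) (R : Space d ≃ₗᵢ[ℝ] Space d)
    (hR : R (basisVec 0) = e) {F : Space d → ℝ} (hF : ContDiff ℝ ∞ F) (hFc : HasCompactSupport F)
    (hFs : tsupport F ⊆ Metric.ball x₀ r) (y : EuclideanSpace ℝ (Fin (d + 1))) :
    ∫ t, Ω.indicator (fun x => fderiv ℝ F x e) (slice R t y) =
      (proj R '' zeroSet x₀ r ρ).indicator (fun y => F (graphMap x₀ r ρ R y)) y := by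
  set b := slice R 0 y with hb
  have hsl : ∀ t, slice R t y = b + t • e := fun t => by rw [slice_eq_add, hR]
  set f : ℝ → ℝ := fun t => F (b + t • e) with hf
  set J : Set ℝ := {t | b + t • e ∈ Metric.ball x₀ r} with hJ
  have hderiv : ∀ t, HasDerivAt f (fderiv ℝ F (b + t • e) e) t := fun t => by
    have h1 : HasFDerivAt F (fderiv ℝ F (b + t • e)) (b + t • e) :=
      (hF.differentiable (by simp)).differentiableAt.hasFDerivAt
    have h2 : HasDerivAt (fun s : ℝ => b + s • e) e t := by
      simpa using ((hasDerivAt_id t).smul_const e).const_add b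
    exact h1.comp_hasDerivAt t h2
  have hfd : deriv f = fun t => fderiv ℝ F (b + t • e) e := funext fun t => (hderiv t).deriv
  have hfC : ContDiff ℝ 1 f := by
    have : ContDiff ℝ ∞ f := hF.comp (by fun_prop)
    exact this.of_le (by exact_mod_cast le_top)
  have hiso : Isometry (fun t : ℝ => b + t • e) := by
    refine Isometry.of_dist_eq fun s t => ?_
    rw [dist_add_left, dist_eq_norm, ← sub_smul, norm_smul, h.norm_dir, mul_one, dist_eq_norm]
  have hfc : HasCompactSupport f := hFc.comp_isClosedEmbedding hiso.isClosedEmbedding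
  have hout : ∀ t, t ∉ J → fderiv ℝ F (b + t • e) e = 0 := fun t ht => by
    have : b + t • e ∉ tsupport (fderiv ℝ F) := fun h' => ht (hFs (tsupport_fderiv_subset ℝ h'))
    rw [image_eq_zero_of_notMem_tsupport this]; rfl
  have hJc : Convex ℝ J := by
    intro s hs t ht p q hp hq hpq
    have := convex_ball x₀ r hs ht hp hq hpq
    simp only [hJ, mem_ofPred_eq]
    convert this using 1
    calc b + (p • s + q • t) • e = (p + q) • b + (p • s + q • t) • e := by rw [hpq, one_smul]
      _ = _ := by module
  have hind : ∀ t, t ∉ J → Ω.indicator (fun x => fderiv ℝ F x e) (b + t • e) = 0 := fun t ht => by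
    by_cases hm : b + t • e ∈ Ω <;> simp [hm, hout t ht]
  have hcont : Continuous (fun t : ℝ => ρ (b + t • e)) := h.smooth.continuous.comp (by fun_prop)
  have hmono : StrictMonoOn (fun t : ℝ => ρ (b + t • e)) J := by
    refine strictMonoOn_of_deriv_pos hJc hcont.continuousOn fun t ht => ?_
    rw [(h.hasDerivAt_line b e t).deriv]
    exact h.pos.trans_le (h.le_deriv _ (interior_subset (s := J) ht))
  by_cases hy : y ∈ proj R '' zeroSet x₀ r ρ
  · rw [indicator_of_mem hy]
    set g := R.symm (graphMap x₀ r ρ R y) 0 with hg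
    have hgy : b + g • e = graphMap x₀ r ρ R y := by
      rw [← hsl, hg]
      nth_rw 2 [← proj_graphMap R hy]
      exact slice_proj R _
    have hz := graphMap_mem R hy
    rw [← hgy] at hz
    have hgJ : g ∈ J := hz.2
    have hg0 : ρ (b + g • e) = 0 := hz.1
    have heq : ∀ t, Ω.indicator (fun x => fderiv ℝ F x e) (slice R t y) =
        (Iio g).indicator (deriv f) t := fun t => by
      rw [hsl, hfd]
      by_cases ht : t ∈ J
      · have : b + t • e ∈ Ω ↔ t < g := by
          rw [h.mem_iff _ ht, ← hg0]
          exact hmono.lt_iff_lt ht hgJ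
        by_cases htg : t < g
        · rw [indicator_of_mem (this.2 htg), indicator_of_mem (show t ∈ Iio g from htg)]
        · rw [indicator_of_notMem (fun h => htg (this.1 h)),
            indicator_of_notMem (show t ∉ Iio g from htg)]
      · rw [hind t ht]
        by_cases htg : t ∈ Iio g <;> simp [htg, hout t ht]
    simp_rw [heq]
    rw [integral_indicator measurableSet_Iio, ← integral_Iic_eq_integral_Iio,
      hfc.integral_Iic_deriv_eq hfC, hf]
    simp only [hgy]
  · rw [indicator_of_notMem hy]
    have hne : ∀ t ∈ J, ρ (b + t • e) ≠ 0 := fun t ht h0 => by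
      apply hy
      refine ⟨b + t • e, ⟨h0, ht⟩, ?_⟩
      rw [← hsl, proj_slice]
    -- J is convex and ρ has no zero on it, so by the intermediate value theorem ρ keeps one sign.
    have hall : (∀ t ∈ J, ρ (b + t • e) < 0) ∨ (∀ t ∈ J, 0 < ρ (b + t • e)) := by
      by_contra! hcon
      obtain ⟨⟨t, ht, ht0⟩, ⟨s, hs, hs0⟩⟩ := hcon
      obtain ⟨z, hz, hz0⟩ := hJc.isPreconnected.intermediate_value hs ht hcont.continuousOn ⟨hs0, ht0⟩
      exact hne z hz hz0
    rcases hall with hneg | hpos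
    · have heq : ∀ t, Ω.indicator (fun x => fderiv ℝ F x e) (slice R t y) = deriv f t := fun t => by
        rw [hsl, hfd]
        by_cases ht : t ∈ J
        · rw [indicator_of_mem ((h.mem_iff _ ht).2 (hneg t ht))]
        · rw [hind t ht]
          exact (hout t ht).symm
      simp_rw [heq]
      refine integral_eq_zero_of_hasDerivAt_of_integrable (f := f)
        (fun t => (hfC.differentiable (by simp)).differentiableAt.hasDerivAt) ?_ ?_
      · exact (hfC.continuous_deriv le_rfl).integrable_of_hasCompactSupport hfc.deriv
      · exact hfC.continuous.integrable_of_hasCompactSupport hfc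
    · have heq : ∀ t, Ω.indicator (fun x => fderiv ℝ F x e) (slice R t y) = 0 := fun t => by
        rw [hsl]
        by_cases ht : t ∈ J
        · rw [indicator_of_notMem]
          rw [h.mem_iff _ ht]
          exact (hpos t ht).le.not_gt
        · exact hind t ht
      simp_rw [heq]
      simp

/-- This is Gauss' theorem for the one direction e, in which it is Fubini together with
`integral_line`. Other directions are reduced to it by `integral_tangential`. -/
theorem integral_deriv_dir (h : IsChart Ω x₀ r ρ e c C) (hΩ : IsOpen Ω)
    (R : Space d ≃ₗᵢ[ℝ] Space d)
    (hR : R (basisVec 0) = e) {F : Space d → ℝ} (hF : ContDiff ℝ ∞ F) (hFc : HasCompactSupport F)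
    (hFs : tsupport F ⊆ Metric.ball x₀ r) :
    ∫ x in Ω, fderiv ℝ F x e = ∫ x, F x ∂(graphMeasure x₀ r ρ R) := by
  rw [← integral_indicator hΩ.measurableSet]
  have hint : Integrable (Ω.indicator (fun x => fderiv ℝ F x e)) := by
    refine Integrable.indicator ?_ hΩ.measurableSet
    exact ((hF.continuous_fderiv (by simp)).clm_apply continuous_const).integrable_of_hasCompactSupport
      ((hFc.fderiv ℝ).comp_left (g := fun L : Space d →L[ℝ] ℝ => L e) rfl)
  have hmp := measurePreserving_slice R
  have h1 : ∫ x, Ω.indicator (fun x => fderiv ℝ F x e) x =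
      ∫ p : ℝ × EuclideanSpace ℝ (Fin (d + 1)),
        Ω.indicator (fun x => fderiv ℝ F x e) (slice R p.1 p.2) ∂(volume.prod volume) := by
    conv_lhs => rw [← hmp.map_eq]
    rw [integral_map hmp.measurable.aemeasurable]
    rw [hmp.map_eq]
    exact hint.aestronglyMeasurable
  have h2 : Integrable (fun p : ℝ × EuclideanSpace ℝ (Fin (d + 1)) =>
      Ω.indicator (fun x => fderiv ℝ F x e) (slice R p.1 p.2)) (volume.prod volume) :=
    hmp.integrable_comp_of_integrable hint
  rw [h1, integral_prod_symm _ h2]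
  simp_rw [h.integral_line R hR hF hFc hFs]
  rw [integral_indicator (h.measurableSet_image R hR), graphMeasure,
    integral_map (h.aemeasurable_graphMap R hR) hF.continuous.aestronglyMeasurable]

end IsChart

/-! ### Calculus helpers -/

theorem fderiv_fderiv_apply {f : Space d → ℝ} (hf : ContDiff ℝ ∞ f) (x v w : Space d) :
    fderiv ℝ (fun y => fderiv ℝ f y v) x w = fderiv ℝ (fderiv ℝ f) x w v := by
  have h1 : DifferentiableAt ℝ (fderiv ℝ f) x :=
    ((hf.fderiv_right (m := ∞) le_rfl).differentiable (by simp)).differentiableAt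
  rw [fderiv_clm_apply h1 (differentiableAt_const v)]
  simp

theorem fderiv_fderiv_comm {f : Space d → ℝ} (hf : ContDiff ℝ ∞ f) (x v w : Space d) :
    fderiv ℝ (fun y => fderiv ℝ f y v) x w = fderiv ℝ (fun y => fderiv ℝ f y w) x v := by
  rw [fderiv_fderiv_apply hf, fderiv_fderiv_apply hf]
  have : IsSymmSndFDerivAt ℝ f x := (contDiff_infty.1 hf 2).contDiffAt.isSymmSndFDerivAt (by simp)
  exact this w v

theorem contDiff_fderiv_apply {f : Space d → ℝ} (hf : ContDiff ℝ ∞ f) (v : Space d) :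
    ContDiff ℝ ∞ (fun y => fderiv ℝ f y v) :=
  (hf.fderiv_right (m := ∞) le_rfl).clm_apply contDiff_const

theorem hasCompactSupport_fderiv_apply {f : Space d → ℝ} (hf : HasCompactSupport f) (v : Space d) :
    HasCompactSupport (fun y => fderiv ℝ f y v) :=
  (hf.fderiv ℝ).comp_left (g := fun L : Space d →L[ℝ] ℝ => L v) rfl

theorem fderiv_apply_eq_zero {f : Space d → ℝ} {x : Space d} (hx : x ∉ tsupport f) (v : Space d) :
    fderiv ℝ f x v = 0 := by
  have : x ∉ tsupport (fderiv ℝ f) := fun h' => hx (tsupport_fderiv_subset ℝ h')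
  rw [image_eq_zero_of_notMem_tsupport this]; rfl

theorem fderiv_mul_apply' {f g : Space d → ℝ} {x : Space d} (hf : DifferentiableAt ℝ f x)
    (hg : DifferentiableAt ℝ g x) (v : Space d) :
    fderiv ℝ (fun y => f y * g y) x v = fderiv ℝ f x v * g x + f x * fderiv ℝ g x v := by
  rw [fderiv_fun_mul hf hg]
  simp only [_root_.add_apply, _root_.smul_apply, smul_eq_mul]
  ring

/-- Mixed integration by parts against a test function. -/
theorem integral_fderiv_mul_fderiv_comm {K ψ : Space d → ℝ} (hK : ContDiff ℝ 1 K)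
    (hψ : ContDiff ℝ ∞ ψ) (hψc : HasCompactSupport ψ) (v w : Space d) :
    ∫ x, fderiv ℝ K x v * fderiv ℝ ψ x w = ∫ x, fderiv ℝ K x w * fderiv ℝ ψ x v := by
  -- K is only of class C¹, so its derivative is moved onto ψ, where second derivatives commute.
  have key : ∀ v w : Space d, ∫ x, fderiv ℝ K x v * fderiv ℝ ψ x w =
      - ∫ x, K x * fderiv ℝ (fun y => fderiv ℝ ψ y w) x v := fun v w => by
    have hψw := contDiff_fderiv_apply hψ w
    have hψwc := hasCompactSupport_fderiv_apply hψc w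
    have hKv : Continuous (fun x => fderiv ℝ K x v) :=
      (hK.continuous_fderiv (by simp)).clm_apply continuous_const
    have h1 := integral_mul_fderiv_eq_neg_fderiv_mul_of_integrable (μ := volume)
      (f := K) (g := fun y => fderiv ℝ ψ y w) (v := v)
      ((hKv.mul hψw.continuous).integrable_of_hasCompactSupport hψwc.mul_left)
      ((hK.continuous.mul (contDiff_fderiv_apply hψw v).continuous).integrable_of_hasCompactSupport
        (hasCompactSupport_fderiv_apply hψwc v).mul_left)
      ((hK.continuous.mul hψw.continuous).integrable_of_hasCompactSupport hψwc.mul_left)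
      (fun x _ => (hK.differentiable (by simp)).differentiableAt)
      (fun x _ => (hψw.differentiable (by simp)).differentiableAt)
    rw [h1, neg_neg]
  rw [key, key]
  simp_rw [fderiv_fderiv_comm hψ _ w v]

theorem integral_fderiv_eq_zero {ψ : Space d → ℝ} (hψ : ContDiff ℝ ∞ ψ)
    (hψc : HasCompactSupport ψ) (v : Space d) : ∫ x, fderiv ℝ ψ x v = 0 := by
  have h1 := integral_mul_fderiv_eq_neg_fderiv_mul_of_integrable (μ := volume)
      (f := fun _ : Space d => (1 : ℝ)) (g := ψ) (v := v)
      (by simp) (by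
        simpa using (contDiff_fderiv_apply hψ v).continuous.integrable_of_hasCompactSupport
          (hasCompactSupport_fderiv_apply hψc v))
      (by simpa using hψ.continuous.integrable_of_hasCompactSupport hψc)
      (fun x _ => differentiableAt_const _)
      (fun x _ => (hψ.differentiable (by simp)).differentiableAt)
  simpa using h1

/-- A smooth function of the value, with slope one to the left of `-1/(n+1)` and constant for
nonnegative values. -/
def ramp (n : ℕ) (r : ℝ) : ℝ := ∫ s in (0 : ℝ)..r, Real.smoothTransition (-(n + 1) * s)

theorem hasDerivAt_ramp (n : ℕ) (r : ℝ) :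
    HasDerivAt (ramp n) (Real.smoothTransition (-(n + 1) * r)) r := by
  have hc : Continuous (fun s : ℝ => Real.smoothTransition (-((n : ℝ) + 1) * s)) :=
    Real.smoothTransition.continuous.comp (by fun_prop)
  exact intervalIntegral.integral_hasDerivAt_right (hc.intervalIntegrable 0 r)
    (hc.stronglyMeasurableAtFilter _ _) hc.continuousAt

theorem contDiff_ramp (n : ℕ) : ContDiff ℝ 1 (ramp n) := by
  rw [contDiff_one_iff_deriv]
  refine ⟨fun r => (hasDerivAt_ramp n r).differentiableAt, ?_⟩
  have : deriv (ramp n) = fun r => Real.smoothTransition (-((n : ℝ) + 1) * r) :=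
    funext fun r => (hasDerivAt_ramp n r).deriv
  rw [this]
  exact Real.smoothTransition.continuous.comp (by fun_prop)

/-- The transition function is 1 as soon as (n + 1)|r| ≥ 1 for negative r, and 0 for r ≥ 0 whatever
n is. Composed with ρ, the slopes thus converge pointwise to the indicator of Ω inside the chart,
also at the boundary points. -/
theorem tendsto_ramp_slope (r : ℝ) :
    Tendsto (fun n : ℕ => Real.smoothTransition (-(n + 1) * r)) atTop
      (𝓝 ((Iio (0 : ℝ)).indicator 1 r)) := by
  by_cases hr : r < 0
  · rw [indicator_of_mem (show r ∈ Iio 0 from hr)]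
    refine tendsto_const_nhds.congr' ?_
    obtain ⟨N, hN⟩ := exists_nat_gt (1 / (-r))
    filter_upwards [eventually_ge_atTop N] with n hn
    symm
    apply Real.smoothTransition.one_of_one_le
    have h1 : (N : ℝ) ≤ n := by exact_mod_cast hn
    rw [div_lt_iff₀ (by linarith)] at hN
    nlinarith
  · rw [indicator_of_notMem (show r ∉ Iio 0 from hr)]
    refine tendsto_const_nhds.congr fun n => ?_
    symm
    apply Real.smoothTransition.zero_of_nonpos
    have : 0 ≤ ((n : ℝ) + 1) * r := by have := not_lt.1 hr; positivity
    linarith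

/-! ### Gauss' theorem in a boundary chart -/

namespace IsChart

variable {Ω : Set (Space d)} {x₀ : Space d} {r : ℝ} {ρ : Space d → ℝ} {e : Space d} {c C : ℝ}

/-- The integral of a derivative along a field tangent to the boundary vanishes. -/
theorem integral_tangential (h : IsChart Ω x₀ r ρ e c C) (hΩ : IsOpen Ω) {ψ : Space d → ℝ}
    (hψ : ContDiff ℝ ∞ ψ) (hψc : HasCompactSupport ψ) (hψs : tsupport ψ ⊆ Metric.ball x₀ r)
    (v : Space d) :
    ∫ x in Ω, (fderiv ℝ ρ x e * fderiv ℝ ψ x v - fderiv ℝ ρ x v * fderiv ℝ ψ x e) = 0 := by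
  set f : Space d → ℝ := fun x => fderiv ℝ ρ x e * fderiv ℝ ψ x v - fderiv ℝ ρ x v * fderiv ℝ ψ x e
    with hf
  have hint : ∀ v w : Space d, Integrable (fun x => fderiv ℝ ρ x v * fderiv ℝ ψ x w) := fun v w =>
    ((contDiff_fderiv_apply h.smooth v).continuous.mul
      (contDiff_fderiv_apply hψ w).continuous).integrable_of_hasCompactSupport
        (hasCompactSupport_fderiv_apply hψc w).mul_left
  have hfi : Integrable f := (hint e v).sub (hint v e)
  have hd : ∀ (n : ℕ) (x w : Space d), fderiv ℝ (fun y => ramp n (ρ y)) x w =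
      Real.smoothTransition (-(n + 1) * ρ x) * fderiv ℝ ρ x w := fun n x w => by
    have h1 : HasFDerivAt ρ (fderiv ℝ ρ x) x :=
      (h.smooth.differentiable (by simp)).differentiableAt.hasFDerivAt
    have := (hasDerivAt_ramp n (ρ x)).comp_hasFDerivAt x h1
    have h2 : fderiv ℝ (fun y => ramp n (ρ y)) x = _ := this.fderiv
    rw [h2]
    rfl
  have hcont : ∀ n : ℕ, Continuous (fun x => Real.smoothTransition (-((n : ℝ) + 1) * ρ x)) :=
    fun n => Real.smoothTransition.continuous.comp (continuous_const.mul h.smooth.continuous)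
  have hbd : ∀ (n : ℕ) x, ‖Real.smoothTransition (-((n : ℝ) + 1) * ρ x)‖ ≤ 1 := fun n x => by
    rw [Real.norm_of_nonneg (Real.smoothTransition.nonneg _)]
    exact Real.smoothTransition.le_one _
  have hint' : ∀ (n : ℕ) (v w : Space d), Integrable (fun x =>
      Real.smoothTransition (-((n : ℝ) + 1) * ρ x) * (fderiv ℝ ρ x v * fderiv ℝ ψ x w)) :=
    fun n v w => (hint v w).bdd_mul (hcont n).aestronglyMeasurable (Eventually.of_forall (hbd n))
  -- The weighted gradient of ρ is the gradient of `ramp n ∘ ρ`, so the mixed integration by parts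
  -- over the whole space makes these integrals vanish exactly. The limit in n turns the weight into
  -- the indicator of Ω.
  have hzero : ∀ n : ℕ, ∫ x, Real.smoothTransition (-((n : ℝ) + 1) * ρ x) * f x = 0 := fun n => by
    have h1 := integral_fderiv_mul_fderiv_comm (K := fun y => ramp n (ρ y))
      ((contDiff_ramp n).comp (h.smooth.of_le (by exact_mod_cast le_top))) hψ hψc e v
    simp_rw [hd, mul_assoc] at h1
    simp_rw [hf, mul_sub]
    rw [integral_sub (hint' n e v) (hint' n v e), h1, sub_self]
  have hlim : Tendsto (fun n : ℕ => ∫ x, Real.smoothTransition (-((n : ℝ) + 1) * ρ x) * f x) atTop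
      (𝓝 (∫ x, Ω.indicator f x)) := by
    refine tendsto_integral_of_dominated_convergence (fun x => ‖f x‖)
      (fun n => ((hcont n).aestronglyMeasurable.mul hfi.aestronglyMeasurable)) hfi.norm
      (fun n => Eventually.of_forall fun x => ?_) (Eventually.of_forall fun x => ?_)
    · rw [norm_mul]
      exact mul_le_of_le_one_left (norm_nonneg _) (hbd n x)
    · by_cases hx : x ∈ tsupport ψ
      · have h1 := (tendsto_ramp_slope (ρ x)).mul_const (f x)
        convert h1 using 2
        by_cases hxΩ : x ∈ Ω
        · rw [indicator_of_mem hxΩ, indicator_of_mem (show ρ x ∈ Iio 0 from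
            (h.mem_iff x (hψs hx)).1 hxΩ)]
          simp
        · rw [indicator_of_notMem hxΩ, indicator_of_notMem (show ρ x ∉ Iio 0 from
            fun h' => hxΩ ((h.mem_iff x (hψs hx)).2 h'))]
          simp
      · have hfx : f x = 0 := by
          simp only [hf]
          rw [fderiv_apply_eq_zero hx, fderiv_apply_eq_zero hx]
          simp
        have : Ω.indicator f x = 0 := by by_cases hm : x ∈ Ω <;> simp [hm, hfx]
        rw [this, hfx]
        simp
  rw [← integral_indicator hΩ.measurableSet]
  simp_rw [hzero] at hlim
  exact (tendsto_nhds_unique hlim tendsto_const_nhds)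

/-- Gauss' theorem in a boundary chart. -/
theorem integral_fderiv (h : IsChart Ω x₀ r ρ e c C) (hΩ : IsOpen Ω)
    (R : Space d ≃ₗᵢ[ℝ] Space d) (hR : R (basisVec 0) = e) {φ : Space d → ℝ}
    (hφ : ContDiff ℝ ∞ φ) (hφc : HasCompactSupport φ) (hφs : tsupport φ ⊆ Metric.ball x₀ r)
    (v : Space d) :
    ∫ x in Ω, fderiv ℝ φ x v =
      ∫ x, φ x * (fderiv ℝ ρ x v / fderiv ℝ ρ x e) ∂(graphMeasure x₀ r ρ R) := by
  -- With φ = (∂_e ρ) ψ, the derivative ∂_v φ is the tangential expression in ψ, whose integral is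
  -- zero, plus ∂_e((∂_v ρ) ψ), which is integrated along lines.
  set ψ : Space d → ℝ := fun x => φ x / fderiv ℝ ρ x e with hψdef
  have hne : ∀ x ∈ tsupport φ, fderiv ℝ ρ x e ≠ 0 := fun x hx =>
    (h.pos.trans_le (h.le_deriv x (hφs hx))).ne'
  have hψ : ContDiff ℝ ∞ ψ := by
    rw [contDiff_iff_contDiffAt]
    intro x
    by_cases hx : x ∈ tsupport φ
    · exact hφ.contDiffAt.div (contDiff_fderiv_apply h.smooth e).contDiffAt (hne x hx)
    · have : ψ =ᶠ[𝓝 x] fun _ => 0 := by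
        filter_upwards [notMem_tsupport_iff_eventuallyEq.1 hx] with y hy
        rw [hψdef]; simp only; rw [hy]; simp
      exact contDiffAt_const.congr_of_eventuallyEq this
  have hψc : HasCompactSupport ψ := by
    have : ψ = fun x => φ x * (fderiv ℝ ρ x e)⁻¹ := by funext x; rw [hψdef]; simp [div_eq_mul_inv]
    rw [this]
    exact hφc.mul_right
  have hψs : tsupport ψ ⊆ tsupport φ := by
    apply closure_mono
    intro x hx hx'
    apply hx
    simp [hψdef, hx']
  have hφψ : φ = fun x => fderiv ℝ ρ x e * ψ x := by
    funext x
    by_cases hx : x ∈ tsupport φ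
    · rw [hψdef]; field_simp [hne x hx]
    · simp [hψdef, image_eq_zero_of_notMem_tsupport hx]
  have hρe := contDiff_fderiv_apply h.smooth e
  have hρv := contDiff_fderiv_apply h.smooth v
  have hdiff : ∀ {f : Space d → ℝ}, ContDiff ℝ ∞ f → ∀ x, DifferentiableAt ℝ f x :=
    fun hf x => (hf.differentiable (by simp)).differentiableAt
  -- The second derivatives of ρ cancel because ∂_v ∂_e ρ = ∂_e ∂_v ρ.
  have hpt : ∀ x, fderiv ℝ φ x v =
      (fderiv ℝ ρ x e * fderiv ℝ ψ x v - fderiv ℝ ρ x v * fderiv ℝ ψ x e)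
        + fderiv ℝ (fun y => fderiv ℝ ρ y v * ψ y) x e := fun x => by
    conv_lhs => rw [hφψ]
    rw [fderiv_mul_apply' (hdiff hρe x) (hdiff hψ x), fderiv_mul_apply' (hdiff hρv x) (hdiff hψ x),
      fderiv_fderiv_comm h.smooth x e v]
    ring
  have hFc : HasCompactSupport (fun y => fderiv ℝ ρ y v * ψ y) := hψc.mul_left
  have hF : ContDiff ℝ ∞ (fun y => fderiv ℝ ρ y v * ψ y) := hρv.mul hψ
  have hint : ∀ v w : Space d, Integrable (fun x => fderiv ℝ ρ x v * fderiv ℝ ψ x w) := fun v w =>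
    ((contDiff_fderiv_apply h.smooth v).continuous.mul
      (contDiff_fderiv_apply hψ w).continuous).integrable_of_hasCompactSupport
        (hasCompactSupport_fderiv_apply hψc w).mul_left
  have hint2 : Integrable (fun x => fderiv ℝ ρ x e * fderiv ℝ ψ x v
      - fderiv ℝ ρ x v * fderiv ℝ ψ x e) := (hint e v).sub (hint v e)
  simp_rw [hpt]
  rw [integral_add hint2.integrableOn
    ((contDiff_fderiv_apply hF e).continuous.integrable_of_hasCompactSupport
      (hasCompactSupport_fderiv_apply hFc e)).integrableOn,
    h.integral_tangential hΩ hψ hψc (hψs.trans hφs), zero_add,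
    h.integral_deriv_dir hΩ R hR hF hFc]
  · congr 1
    funext x
    simp only [hψdef]
    ring
  · refine Subset.trans ?_ (hψs.trans hφs)
    apply closure_mono
    intro x hx hx'
    exact hx (by simp [hx'])

end IsChart

/-! ### Patches of the closure of a domain -/

/-- A patch of a domain: an open bounded set `U` on which Gauss' theorem holds, with a measure `σ`
that is dominated by the surface measure and a smooth extension `n` of the outward normal, and from
which a cone of directions leads into the domain. -/
structure IsPatch (Ω U : Set (Space d)) (σ : Measure (Space d)) (n : Space d → Space d) :
    Prop where
  isOpen : IsOpen U
  isBounded : Bornology.IsBounded U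
  finite : IsFiniteMeasure σ
  le_surface : ∃ K : NNReal, σ ≤ K • surfaceMeasure Ω
  smooth : ContDiff ℝ ∞ n
  compact : HasCompactSupport n
  norm_one : ∀ x ∈ U, ‖n x‖ = 1
  normal : ∀ᵐ x ∂σ, x ∈ U ∧ IsOutwardNormal Ω x (n x)
  gauss : ∀ φ : Space d → ℝ, ContDiff ℝ ∞ φ → HasCompactSupport φ → tsupport φ ⊆ U →
    ∀ i, ∫ x in Ω, fderiv ℝ φ x (basisVec i) = ∫ x, φ x * n x i ∂σ
  cone : ∃ (e : Space d) (δ : ℝ), 0 < δ ∧ ∀ K ⊆ U, IsCompact K →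
    ∀ᶠ ε in 𝓝[>] (0 : ℝ), ∀ x ∈ K ∩ closure Ω, ∀ y ∈ Metric.closedBall e δ, x + ε • y ∈ Ω

/-- An interior ball has no boundary part, so σ = 0. The unit field has no geometric meaning there:
a constant vector cut off outside the ball serves. The cone is the full unit ball around 0, since
every small displacement stays in Ω. -/
theorem exists_isPatch_of_mem {Ω : Set (Space d)} (hΩ : IsOpen Ω) {x₀ : Space d} (hx : x₀ ∈ Ω) :
    ∃ U σ n, x₀ ∈ U ∧ IsPatch Ω U σ n := by
  obtain ⟨r, hr, hball⟩ := Metric.isOpen_iff.1 hΩ x₀ hx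
  let b : ContDiffBump x₀ := ⟨r, r + 1, hr, by linarith⟩
  refine ⟨Metric.ball x₀ r, 0, fun x => b x • basisVec 0, Metric.mem_ball_self hr,
    Metric.isOpen_ball, Metric.isBounded_ball, inferInstance, ⟨0, Measure.zero_le _⟩,
    b.contDiff.smul contDiff_const, b.hasCompactSupport.smul_right, fun x hx => ?_, by simp,
    fun φ hφ hφc hφs i => ?_, 0, 1, one_pos, fun K hK hKc => ?_⟩
  · rw [b.one_of_mem_closedBall (Metric.ball_subset_closedBall hx), one_smul]
    simp [basisVec]
  · rw [integral_zero_measure, setIntegral_eq_integral_of_forall_compl_eq_zero,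
      integral_fderiv_eq_zero hφ hφc]
    intro x hx
    exact fderiv_apply_eq_zero (fun h => hx (hball (hφs h))) _
  · obtain ⟨δ, hδ, hKδ⟩ := hKc.exists_cthickening_subset_open hΩ (hK.trans hball)
    filter_upwards [Ioo_mem_nhdsGT hδ] with ε hε x hx y hy
    apply hKδ
    refine Metric.mem_cthickening_of_dist_le _ x _ _ hx.1 ?_
    rw [mem_closedBall_zero_iff] at hy
    rw [dist_eq_norm, add_sub_cancel_left, norm_smul, Real.norm_of_nonneg hε.1.le]
    nlinarith [hε.1, hε.2, norm_nonneg y]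

/-- The patch is the ball of half the chart radius. The remaining room is used twice: for the
cut-off of the normalised gradient, and for displacements along the cone, which must not leave the
chart. -/
theorem exists_isPatch_of_mem_frontier {Ω : Set (Space d)} (hΩ : IsSmoothBoundedDomain Ω)
    {x₀ : Space d} (hx : x₀ ∈ frontier Ω) : ∃ U σ n, x₀ ∈ U ∧ IsPatch Ω U σ n := by
  obtain ⟨ρ, hρ⟩ := hΩ.smooth_boundary x₀ hx
  obtain ⟨r, hr, e, c, C, h⟩ := exists_isChart hρ
  obtain ⟨R, hR⟩ := exists_rotation e h.norm_dir
  have hC := h.const_nonneg hr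
  let b : ContDiffBump x₀ := ⟨r / 2, 3 * r / 4, by linarith, by linarith⟩
  have hbs : tsupport b ⊆ Metric.ball x₀ r := by
    rw [b.tsupport_eq]
    exact Metric.closedBall_subset_ball (by simp only [b]; linarith)
  have hUr : Metric.ball x₀ (r / 2) ⊆ Metric.ball x₀ r := Metric.ball_subset_ball (by linarith)
  have hb1 : ∀ x ∈ Metric.ball x₀ (r / 2), b x = 1 := fun x hx =>
    b.one_of_mem_closedBall (Metric.ball_subset_closedBall hx)
  set n : Space d → Space d := fun x => (b x * ‖gradient ρ x‖⁻¹) • gradient ρ x with hn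
  have hgrad : ContDiff ℝ ∞ (gradient ρ) :=
    (InnerProductSpace.toDual ℝ (Space d)).symm.contDiff.comp (h.smooth.fderiv_right (m := ∞) le_rfl)
  have hnU : ∀ x ∈ Metric.ball x₀ (r / 2), n x = ‖gradient ρ x‖⁻¹ • gradient ρ x := fun x hx => by
    rw [hn]; simp only; rw [hb1 x hx, one_mul]
  -- This density converts the factor ∂_i ρ / ∂_e ρ of the chart formula into the i-th component of
  -- the unit normal. It is at most C/c, which gives the domination by the surface measure.
  set w : Space d → NNReal := fun x => Real.toNNReal (‖gradient ρ x‖ / fderiv ℝ ρ x e) with hw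
  have hwm : Measurable w := by
    refine Measurable.real_toNNReal ?_
    exact (hgrad.continuous.norm.measurable).div (contDiff_fderiv_apply h.smooth e).continuous.measurable
  set σ₀ := IsChart.graphMeasure x₀ r ρ R with hσ₀
  have : IsFiniteMeasure σ₀ := IsChart.isFiniteMeasure_graphMeasure R
  have hσ₀z : ∀ᵐ x ∂σ₀, x ∈ IsChart.zeroSet x₀ r ρ := by
    have hm : MeasurableSet {x | x ∈ IsChart.zeroSet x₀ r ρ} := h.measurableSet_zeroSet
    rw [hσ₀, IsChart.graphMeasure, ae_map_iff (h.aemeasurable_graphMap R hR) hm]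
    filter_upwards [ae_restrict_mem (h.measurableSet_image R hR)] with y hy
    exact IsChart.graphMap_mem R hy
  have hgn : ∀ x, ‖gradient ρ x‖ = ‖fderiv ℝ ρ x‖ := fun x => by
    rw [gradient, LinearIsometryEquiv.norm_map]
  have hwb : ∀ᵐ x ∂σ₀, (w x : ℝ≥0∞) ≤ (Real.toNNReal (C / c) : ℝ≥0∞) := by
    filter_upwards [hσ₀z] with x hx
    rw [ENNReal.coe_le_coe]
    apply Real.toNNReal_le_toNNReal
    rw [hgn]
    exact div_le_div₀ hC (h.deriv_le x hx.2) h.pos (h.le_deriv x hx.2)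
  have hσle : σ₀.withDensity (fun x => (w x : ℝ≥0∞)) ≤ Real.toNNReal (C / c) • σ₀ := by
    calc σ₀.withDensity (fun x => (w x : ℝ≥0∞))
        ≤ σ₀.withDensity (fun _ => (Real.toNNReal (C / c) : ℝ≥0∞)) := withDensity_mono hwb
      _ = _ := by rw [withDensity_const]; rfl
  refine ⟨Metric.ball x₀ (r / 2),
    (σ₀.withDensity (fun x => (w x : ℝ≥0∞))).restrict (Metric.ball x₀ (r / 2)), n,
    Metric.mem_ball_self (by linarith), Metric.isOpen_ball, Metric.isBounded_ball,
    ⟨?_⟩, ⟨Real.toNNReal (C / c), ?_⟩, ?_, ?_, fun x hx => ?_, ?_, fun φ hφ hφc hφs i => ?_,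
    -e, c / (2 * (C + 1)), by have := h.pos; positivity, fun K hK hKc => ?_⟩
  · refine ((Measure.restrict_le_self.trans hσle) univ).trans_lt ?_
    rw [Measure.smul_apply, ENNReal.smul_def]
    exact ENNReal.mul_lt_top ENNReal.coe_lt_top (measure_lt_top _ _)
  · refine (Measure.restrict_le_self.trans hσle).trans ?_
    intro A
    rw [Measure.smul_apply, Measure.smul_apply, ENNReal.smul_def, ENNReal.smul_def, smul_eq_mul,
      smul_eq_mul]
    gcongr
    exact h.graphMeasure_le hΩ.isOpen R hR
  · rw [contDiff_iff_contDiffAt]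
    intro x
    by_cases hx : x ∈ tsupport b
    · have hne := h.gradient_ne_zero (hbs hx)
      exact (b.contDiff.contDiffAt.mul ((hgrad.contDiffAt.norm ℝ hne).inv (norm_ne_zero_iff.2 hne))).smul
        hgrad.contDiffAt
    · have : n =ᶠ[𝓝 x] fun _ => 0 := by
        filter_upwards [notMem_tsupport_iff_eventuallyEq.1 hx] with y hy
        rw [hn]; simp only; rw [hy]; simp
      exact contDiffAt_const.congr_of_eventuallyEq this
  · exact (b.hasCompactSupport.mul_right (f' := fun x => ‖gradient ρ x‖⁻¹)).smul_right
  · rw [hnU x hx, norm_smul, norm_inv, norm_norm,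
      inv_mul_cancel₀ (norm_ne_zero_iff.2 (h.gradient_ne_zero (hUr hx)))]
  · filter_upwards [ae_restrict_mem Metric.isOpen_ball.measurableSet] with x hx
    exact ⟨hx, ρ, h.isDefiningFunction (hUr hx), hnU x hx⟩
  · rw [h.integral_fderiv hΩ.isOpen R hR hφ hφc (hφs.trans hUr),
      setIntegral_eq_integral_of_forall_compl_eq_zero (fun x hx => by
        rw [image_eq_zero_of_notMem_tsupport (fun h => hx (hφs h)), zero_mul]),
      integral_withDensity_eq_integral_smul hwm]
    congr 1
    funext x
    by_cases hx : x ∈ tsupport φ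
    · have hxU := hφs hx
      have h1 := h.pos.trans_le (h.le_deriv x (hUr hxU))
      have h2 := norm_ne_zero_iff.2 (h.gradient_ne_zero (hUr hxU))
      rw [hnU x hxU, NNReal.smul_def, hw]
      simp only
      rw [Real.coe_toNNReal _ (div_nonneg (norm_nonneg _) h1.le)]
      simp only [PiLp.smul_apply, smul_eq_mul, gradient_apply_coord]
      field_simp
    · rw [image_eq_zero_of_notMem_tsupport hx]; simp
  · have hcpos := h.pos
    have hδ : 0 < c / (2 * (C + 1)) := by positivity
    set δ := c / (2 * (C + 1))
    -- Along −e the derivative is at most −c, and a perturbation of size δ = c/(2(C + 1)) changes it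
    -- by at most Cδ < c.
    have hcone : ∀ y ∈ Metric.closedBall (-e) δ, ∀ x ∈ Metric.ball x₀ r, fderiv ℝ ρ x y < 0 := by
      intro y hy x hx
      have h1 := h.le_deriv x hx
      have h2 : ‖fderiv ℝ ρ x (y + e)‖ ≤ C * δ := by
        refine (ContinuousLinearMap.le_opNorm _ _).trans ?_
        rw [mem_closedBall_iff_norm, sub_neg_eq_add] at hy
        gcongr
        exact h.deriv_le x hx
      have h3 : C * δ < c := by
        have : C * δ = c * (C / (2 * (C + 1))) := by simp only [δ]; ring
        rw [this]
        apply mul_lt_of_lt_one_right hcpos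
        rw [div_lt_one (by positivity)]
        linarith
      have h4 : fderiv ℝ ρ x y = fderiv ℝ ρ x (y + e) - fderiv ℝ ρ x e := by rw [map_add]; ring
      have h5 := (abs_le.1 h2).2
      rw [h4]; linarith
    -- Directions in the cone have length at most 1 + δ, so for smaller ε the displacement is
    -- shorter than r/2 and points of the half ball stay in the chart.
    have hpos : 0 < r / 2 / (1 + δ) := by positivity
    filter_upwards [Ioo_mem_nhdsGT hpos] with ε hε x hx y hy
    have hxU := hK hx.1
    have hy1 : ‖y‖ ≤ 1 + δ := by
      rw [mem_closedBall_iff_norm] at hy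
      calc ‖y‖ = ‖-e + (y - -e)‖ := by congr 1; abel
        _ ≤ ‖-e‖ + ‖y - -e‖ := norm_add_le _ _
        _ ≤ 1 + δ := by rw [norm_neg, h.norm_dir]; linarith
    have hmem : x + ε • y ∈ Metric.ball x₀ r := by
      rw [mem_ball_iff_norm] at hxU ⊢
      have h1 : ‖ε • y‖ < r / 2 := by
        rw [norm_smul, Real.norm_of_nonneg hε.1.le]
        have := hε.2
        rw [lt_div_iff₀ (by positivity)] at this
        nlinarith [hε.1]
      calc ‖x + ε • y - x₀‖ = ‖(x - x₀) + ε • y‖ := by congr 1; abel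
        _ ≤ ‖x - x₀‖ + ‖ε • y‖ := norm_add_le _ _
        _ < r := by linarith
    have hρx : ρ x ≤ 0 := by
      by_cases hxΩ : x ∈ Ω
      · exact ((h.mem_iff x (hUr hxU)).1 hxΩ).le
      · have : x ∈ frontier Ω ∩ Metric.ball x₀ r := by
          rw [hΩ.isOpen.frontier_eq]
          exact ⟨⟨hx.2, hxΩ⟩, hUr hxU⟩
        rw [h.frontier_eq hΩ.isOpen] at this
        exact le_of_eq this.1
    rw [h.mem_iff _ hmem]
    refine (h.lt_of_line (hUr hxU) hmem fun z hz => ?_).trans_le hρx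
    rw [map_smul, smul_eq_mul]
    exact mul_neg_of_pos_of_neg hε.1 (hcone y hy z hz)

theorem exists_isPatch {Ω : Set (Space d)} (hΩ : IsSmoothBoundedDomain Ω) {x₀ : Space d}
    (hx : x₀ ∈ closure Ω) : ∃ U σ n, x₀ ∈ U ∧ IsPatch Ω U σ n := by
  by_cases h : x₀ ∈ Ω
  · exact exists_isPatch_of_mem hΩ.isOpen h
  · refine exists_isPatch_of_mem_frontier hΩ ?_
    rw [hΩ.isOpen.frontier_eq]
    exact ⟨hx, h⟩

/-- The boundary is compact and the measure is finite near each of its points by the chart bound. -/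
theorem isFiniteMeasure_surfaceMeasure {Ω : Set (Space d)} (hΩ : IsSmoothBoundedDomain Ω) :
    IsFiniteMeasure (surfaceMeasure Ω) := by
  have hcomp : IsCompact (frontier Ω) :=
    Metric.isCompact_of_isClosed_isBounded isClosed_frontier
      (hΩ.isBounded.closure.subset frontier_subset_closure)
  refine ⟨?_⟩
  rw [surfaceMeasure, Measure.restrict_apply_univ]
  refine hcomp.measure_lt_top_of_nhdsWithin fun x hx => ?_
  obtain ⟨ρ, hρ⟩ := hΩ.smooth_boundary x hx
  obtain ⟨r, hr, e, c, C, h⟩ := exists_isChart hρ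
  obtain ⟨R, hR⟩ := exists_rotation e h.norm_dir
  exact ⟨frontier Ω ∩ Metric.ball x r, inter_mem self_mem_nhdsWithin
    (mem_nhdsWithin_of_mem_nhds (Metric.ball_mem_nhds x hr)),
    h.surfaceMeasure_ball_lt_top hΩ.isOpen R hR⟩

/-- A finite smooth partition of unity subordinate to patches. -/
structure PatchCover (Ω : Set (Space d)) where
  N : ℕ
  U : Fin N → Set (Space d)
  σ : Fin N → Measure (Space d)
  n : Fin N → Space d → Space d
  χ : Fin N → Space d → ℝ
  isPatch : ∀ k, IsPatch Ω (U k) (σ k) (n k)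
  smooth : ∀ k, ContDiff ℝ ∞ (χ k)
  compact : ∀ k, HasCompactSupport (χ k)
  tsupport_subset : ∀ k, tsupport (χ k) ⊆ U k
  nonneg : ∀ k x, 0 ≤ χ k x
  le_one : ∀ k x, χ k x ≤ 1
  sum_eq_one : ∀ x ∈ Ω, ∑ k, χ k x = 1

theorem nonempty_patchCover {Ω : Set (Space d)} (hΩ : IsSmoothBoundedDomain Ω) :
    Nonempty (PatchCover Ω) := by
  have hcomp : IsCompact (closure Ω) := hΩ.isBounded.isCompact_closure
  choose! U σ n hmem hpatch using fun x (hx : x ∈ closure Ω) => exists_isPatch hΩ hx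
  obtain ⟨t, ht, hcov⟩ := hcomp.elim_nhds_subcover U
    fun x hx => (hpatch x hx).isOpen.mem_nhds (hmem x hx)
  let eq := t.equivFin.symm
  have hp : ∀ k, IsPatch Ω (U (eq k)) (σ (eq k)) (n (eq k)) := fun k => hpatch _ (ht _ (eq k).2)
  obtain ⟨f, hf⟩ := SmoothPartitionOfUnity.exists_isSubordinate (modelWithCornersSelf ℝ (Space d))
    hcomp.isClosed (fun k => U (eq k)) (fun k => (hp k).isOpen) (by
      intro x hx
      obtain ⟨y, hy, hxy⟩ := mem_iUnion₂.1 (hcov hx)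
      refine mem_iUnion.2 ⟨eq.symm ⟨y, hy⟩, ?_⟩
      simpa using hxy)
  refine ⟨⟨t.card, fun k => U (eq k), fun k => σ (eq k), fun k => n (eq k), fun k => f k, hp,
    fun k => (f k).contMDiff.contDiff, fun k => ?_, hf, fun k x => f.nonneg k x,
    fun k x => f.le_one k x, fun x hx => ?_⟩⟩
  · exact Metric.isCompact_of_isClosed_isBounded (isClosed_tsupport _)
      ((hp k).isBounded.subset (hf k))
  · have := f.sum_eq_one (subset_closure hx)
    rwa [finsum_eq_sum_of_fintype] at this

/-! ### Convergence in `L²` -/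

section L2Lim

variable {α : Type*} [MeasurableSpace α] {μ : Measure α}

/-- The sequence `φ` of square integrable functions converges to `f` in `L²`. -/
structure L2Lim (μ : Measure α) (φ : ℕ → α → ℝ) (f : α → ℝ) : Prop where
  memLp : MemLp f 2 μ
  memLp_seq : ∀ k, MemLp (φ k) 2 μ
  tendsto : Tendsto (fun k => eLpNorm (φ k - f) 2 μ) atTop (𝓝 0)

namespace L2Lim

variable {φ ψ : ℕ → α → ℝ} {f g : α → ℝ}

theorem const (hf : MemLp f 2 μ) : L2Lim μ (fun _ => f) f :=
  ⟨hf, fun _ => hf, by simp⟩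

theorem congr (h : L2Lim μ φ f) (hφ : ∀ k, φ k =ᵐ[μ] ψ k) (hf : f =ᵐ[μ] g) : L2Lim μ ψ g := by
  refine ⟨h.memLp.ae_eq hf, fun k => (h.memLp_seq k).ae_eq (hφ k), h.tendsto.congr fun k => ?_⟩
  exact eLpNorm_congr_ae ((hφ k).sub hf)

theorem add (h : L2Lim μ φ f) (h' : L2Lim μ ψ g) :
    L2Lim μ (fun k x => φ k x + ψ k x) (fun x => f x + g x) := by
  refine ⟨h.memLp.add h'.memLp, fun k => (h.memLp_seq k).add (h'.memLp_seq k), ?_⟩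
  refine tendsto_of_tendsto_of_tendsto_of_le_of_le tendsto_const_nhds
    (by simpa using h.tendsto.add h'.tendsto) (fun _ => zero_le) fun k => ?_
  have : (fun x => φ k x + ψ k x) - (fun x => f x + g x) = (φ k - f) + (ψ k - g) := by
    funext x; simp only [Pi.sub_apply, Pi.add_apply]; ring
  rw [this]
  exact eLpNorm_add_le ((h.memLp_seq k).sub h.memLp).1 ((h'.memLp_seq k).sub h'.memLp).1 (by simp)

theorem mul_bdd (h : L2Lim μ φ f) {c : α → ℝ} (hc : AEStronglyMeasurable c μ) {C : ℝ}
    (hC : ∀ x, |c x| ≤ C) : L2Lim μ (fun k x => c x * φ k x) (fun x => c x * f x) := by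
  have key : ∀ {u : α → ℝ}, MemLp u 2 μ → MemLp (fun x => c x * u x) 2 μ := fun {u} hu =>
    hu.of_le_mul (c := C) (hc.mul hu.1) (Eventually.of_forall fun x => by
      rw [norm_mul]; exact mul_le_mul_of_nonneg_right (hC x) (norm_nonneg _))
  refine ⟨key h.memLp, fun k => key (h.memLp_seq k), ?_⟩
  have h0 : Tendsto (fun k => ENNReal.ofReal C * eLpNorm (φ k - f) 2 μ) atTop (𝓝 0) := by
    simpa using ENNReal.Tendsto.const_mul h.tendsto (Or.inr ENNReal.ofReal_ne_top)
  refine tendsto_of_tendsto_of_tendsto_of_le_of_le tendsto_const_nhds h0 (fun _ => zero_le) fun k => ?_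
  refine eLpNorm_le_mul_eLpNorm_of_ae_le_mul (Eventually.of_forall fun x => ?_) 2
  simp only [Pi.sub_apply]
  rw [← mul_sub, norm_mul]
  exact mul_le_mul_of_nonneg_right (hC x) (norm_nonneg _)

theorem neg (h : L2Lim μ φ f) : L2Lim μ (fun k x => -φ k x) (fun x => -f x) := by
  have := h.mul_bdd (c := fun _ => -1) aestronglyMeasurable_const (C := 1) (by simp)
  simpa using this

theorem sub (h : L2Lim μ φ f) (h' : L2Lim μ ψ g) :
    L2Lim μ (fun k x => φ k x - ψ k x) (fun x => f x - g x) := by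
  simpa [sub_eq_add_neg] using h.add h'.neg

theorem sum {ι : Type*} (s : Finset ι) {φ : ι → ℕ → α → ℝ} {f : ι → α → ℝ}
    (h : ∀ i, L2Lim μ (φ i) (f i)) :
    L2Lim μ (fun k x => ∑ i ∈ s, φ i k x) (fun x => ∑ i ∈ s, f i x) := by
  classical
  induction s using Finset.induction_on with
  | empty => simpa using const (μ := μ) (f := fun _ => (0 : ℝ)) MemLp.zero'
  | insert a s ha ih =>
    simp only [Finset.sum_insert ha]
    exact (h a).add ih

/-- Used to pass from traces in L²(Γ) to traces with respect to the measure of a patch. -/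
theorem mono {ν : Measure α} (h : L2Lim μ φ f) {c : NNReal} (hν : ν ≤ c • μ) : L2Lim ν φ f := by
  have hν' : ν ≤ (c : ℝ≥0∞) • μ := hν
  refine ⟨h.memLp.of_measure_le_smul ENNReal.coe_ne_top hν',
    fun k => (h.memLp_seq k).of_measure_le_smul ENNReal.coe_ne_top hν', ?_⟩
  have h0 : Tendsto (fun k => (c : ℝ≥0∞) ^ (1 / (2 : ℝ)) * eLpNorm (φ k - f) 2 μ) atTop (𝓝 0) := by
    simpa using ENNReal.Tendsto.const_mul h.tendsto
      (Or.inr (ENNReal.rpow_ne_top_of_nonneg (by norm_num) ENNReal.coe_ne_top))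
  refine tendsto_of_tendsto_of_tendsto_of_le_of_le tendsto_const_nhds h0 (fun _ => zero_le) fun k => ?_
  refine (eLpNorm_mono_measure _ hν').trans ?_
  rw [eLpNorm_smul_measure_of_ne_top (by simp)]
  simp

/-- Continuity of the inner product of L². Every bilinear integral identity for smooth functions is
carried to Sobolev functions through it. -/
theorem integral_mul (h : L2Lim μ φ f) (h' : L2Lim μ ψ g) :
    Tendsto (fun k => ∫ x, φ k x * ψ k x ∂μ) atTop (𝓝 (∫ x, f x * g x ∂μ)) := by
  have key : ∀ {u v : α → ℝ} (hu : MemLp u 2 μ) (hv : MemLp v 2 μ),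
      inner ℝ (hv.toLp v) (hu.toLp u) = ∫ x, u x * v x ∂μ := fun {u v} hu hv => by
    rw [L2.inner_def]
    refine integral_congr_ae ?_
    filter_upwards [hu.coeFn_toLp, hv.coeFn_toLp] with x hx hx'
    rw [hx, hx']
    rfl
  have h1 : Tendsto (fun k => (h.memLp_seq k).toLp (φ k)) atTop (𝓝 (h.memLp.toLp f)) := by
    rw [Lp.tendsto_Lp_iff_tendsto_eLpNorm'' φ h.memLp_seq f h.memLp]
    exact h.tendsto
  have h2 : Tendsto (fun k => (h'.memLp_seq k).toLp (ψ k)) atTop (𝓝 (h'.memLp.toLp g)) := by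
    rw [Lp.tendsto_Lp_iff_tendsto_eLpNorm'' ψ h'.memLp_seq g h'.memLp]
    exact h'.tendsto
  have h3 := h2.inner h1 (𝕜 := ℝ)
  rw [key] at h3
  refine h3.congr fun k => key _ _

end L2Lim

end L2Lim

theorem continuous_bdd {c : Space d → ℝ} (hc : Continuous c) (hcc : HasCompactSupport c) :
    ∃ C, ∀ x, |c x| ≤ C := by
  obtain ⟨C, hC⟩ := hcc.exists_bound_of_continuous hc
  exact ⟨C, hC⟩

theorem memLp_of_continuous {c : Space d → ℝ} (hc : Continuous c) (hcc : HasCompactSupport c)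
    (μ : Measure (Space d)) [IsFiniteMeasureOnCompacts μ] : MemLp c 2 μ :=
  hc.memLp_of_hasCompactSupport hcc

/-! ### Functions of class `H¹` with a trace -/

/-- `f ∈ H¹(Ω)` with derivatives `Df i = ∂_i f` and trace `g` in `L²(σ)`. -/
def H1Trace (Ω : Set (Space d)) (σ : Measure (Space d)) (f : Space d → ℝ)
    (Df : Fin (d + 2) → Space d → ℝ) (g : Space d → ℝ) : Prop :=
  ∃ φ : ℕ → Space d → ℝ, (∀ k, ContDiff ℝ ∞ (φ k)) ∧ (∀ k, HasCompactSupport (φ k)) ∧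
    L2Lim (volume.restrict Ω) φ f ∧
    (∀ i, L2Lim (volume.restrict Ω) (fun k x => fderiv ℝ (φ k) x (basisVec i)) (Df i)) ∧
    L2Lim σ φ g

namespace H1Trace

variable {Ω : Set (Space d)} {σ : Measure (Space d)} {f f' g g' : Space d → ℝ}
  {Df Df' : Fin (d + 2) → Space d → ℝ}

theorem memLp (h : H1Trace Ω σ f Df g) : MemLp f 2 (volume.restrict Ω) := h.choose_spec.2.2.1.memLp

theorem memLp_deriv (h : H1Trace Ω σ f Df g) (i : Fin (d + 2)) :
    MemLp (Df i) 2 (volume.restrict Ω) := (h.choose_spec.2.2.2.1 i).memLp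

theorem memLp_trace (h : H1Trace Ω σ f Df g) : MemLp g 2 σ := h.choose_spec.2.2.2.2.memLp

theorem congr (h : H1Trace Ω σ f Df g) (hf : f =ᵐ[volume.restrict Ω] f')
    (hD : ∀ i, Df i =ᵐ[volume.restrict Ω] Df' i) (hg : g =ᵐ[σ] g') : H1Trace Ω σ f' Df' g' := by
  obtain ⟨φ, h1, h2, h3, h4, h5⟩ := h
  exact ⟨φ, h1, h2, h3.congr (fun _ => ae_eq_rfl) hf,
    fun i => (h4 i).congr (fun _ => ae_eq_rfl) (hD i), h5.congr (fun _ => ae_eq_rfl) hg⟩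

theorem of_smooth [IsFiniteMeasure σ] (hf : ContDiff ℝ ∞ f) (hfc : HasCompactSupport f) :
    H1Trace Ω σ f (fun i x => fderiv ℝ f x (basisVec i)) f :=
  ⟨fun _ => f, fun _ => hf, fun _ => hfc, L2Lim.const (memLp_of_continuous hf.continuous hfc _),
    fun _ => L2Lim.const (memLp_of_continuous (contDiff_fderiv_apply hf _).continuous
      (hasCompactSupport_fderiv_apply hfc _) _),
    L2Lim.const (memLp_of_continuous hf.continuous hfc _)⟩

theorem add (h : H1Trace Ω σ f Df g) (h' : H1Trace Ω σ f' Df' g') :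
    H1Trace Ω σ (fun x => f x + f' x) (fun i x => Df i x + Df' i x) (fun x => g x + g' x) := by
  obtain ⟨φ, h1, h2, h3, h4, h5⟩ := h
  obtain ⟨ψ, k1, k2, k3, k4, k5⟩ := h'
  refine ⟨fun k x => φ k x + ψ k x, fun k => (h1 k).add (k1 k), fun k => (h2 k).add (k2 k),
    h3.add k3, fun i => ?_, h5.add k5⟩
  refine ((h4 i).add (k4 i)).congr (fun k => Eventually.of_forall fun x => ?_) ae_eq_rfl
  have hφ := ((h1 k).differentiable (by simp)).differentiableAt (x := x)
  have hψ := ((k1 k).differentiable (by simp)).differentiableAt (x := x)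
  simp only
  rw [fderiv_fun_add hφ hψ]
  rfl

/-- Multiplication by a smooth function of compact support. -/
theorem smul [IsFiniteMeasure σ] (h : H1Trace Ω σ f Df g) {c : Space d → ℝ} (hc : ContDiff ℝ ∞ c)
    (hcc : HasCompactSupport c) :
    H1Trace Ω σ (fun x => c x * f x) (fun i x => fderiv ℝ c x (basisVec i) * f x + c x * Df i x)
      (fun x => c x * g x) := by
  obtain ⟨φ, h1, h2, h3, h4, h5⟩ := h
  obtain ⟨C, hC⟩ := continuous_bdd hc.continuous hcc
  refine ⟨fun k x => c x * φ k x, fun k => hc.mul (h1 k), fun k => hcc.mul_right,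
    h3.mul_bdd hc.continuous.aestronglyMeasurable hC, fun i => ?_,
    h5.mul_bdd hc.continuous.aestronglyMeasurable hC⟩
  have hdc := (contDiff_fderiv_apply hc (basisVec i)).continuous
  obtain ⟨C', hC'⟩ := continuous_bdd hdc (hasCompactSupport_fderiv_apply hcc (basisVec i))
  refine ((h3.mul_bdd hdc.aestronglyMeasurable hC').add
    ((h4 i).mul_bdd hc.continuous.aestronglyMeasurable hC)).congr
    (fun k => Eventually.of_forall fun x => ?_) ae_eq_rfl
  simp only
  rw [fderiv_mul_apply' ((hc.differentiable (by simp)).differentiableAt)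
    (((h1 k).differentiable (by simp)).differentiableAt)]

theorem zero [IsFiniteMeasure σ] : H1Trace Ω σ (fun _ => 0) (fun _ _ => 0) (fun _ => 0) := by
  have := of_smooth (Ω := Ω) (σ := σ) (f := fun _ => 0) contDiff_const HasCompactSupport.zero
  simpa using this

theorem neg (h : H1Trace Ω σ f Df g) :
    H1Trace Ω σ (fun x => -f x) (fun i x => -Df i x) (fun x => -g x) := by
  obtain ⟨φ, h1, h2, h3, h4, h5⟩ := h
  refine ⟨fun k x => -φ k x, fun k => (h1 k).neg, fun k => (h2 k).comp_left (g := fun t : ℝ => -t) neg_zero, h3.neg, fun i => ?_, h5.neg⟩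
  refine (h4 i).neg.congr (fun k => Eventually.of_forall fun x => ?_) ae_eq_rfl
  simp only
  rw [fderiv_fun_neg]
  rfl

theorem sub (h : H1Trace Ω σ f Df g) (h' : H1Trace Ω σ f' Df' g') :
    H1Trace Ω σ (fun x => f x - f' x) (fun i x => Df i x - Df' i x) (fun x => g x - g' x) := by
  simpa [sub_eq_add_neg] using h.add h'.neg

theorem sum [IsFiniteMeasure σ] {ι : Type*} (s : Finset ι) {f : ι → Space d → ℝ}
    {Df : ι → Fin (d + 2) → Space d → ℝ} {g : ι → Space d → ℝ}
    (h : ∀ a, H1Trace Ω σ (f a) (Df a) (g a)) :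
    H1Trace Ω σ (fun x => ∑ a ∈ s, f a x) (fun i x => ∑ a ∈ s, Df a i x)
      (fun x => ∑ a ∈ s, g a x) := by
  classical
  induction s using Finset.induction_on with
  | empty => simpa using zero (Ω := Ω) (σ := σ)
  | insert a s ha ih =>
    simp only [Finset.sum_insert ha]
    exact (h a).add ih

end H1Trace

/-! ### Weak derivatives -/

/-- Weak derivatives are unique. -/
theorem HasWeakPartial.ae_eq {Ω : Set (Space d)} (hΩ : IsOpen Ω) {i : Fin (d + 2)}
    {f g g' : Space d → ℝ} (h : HasWeakPartial Ω i f g) (h' : HasWeakPartial Ω i f g') :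
    g =ᵐ[volume.restrict Ω] g' := by
  have key := hΩ.ae_eq_zero_of_integral_contDiff_smul_eq_zero (μ := volume)
    (f := fun x => g x - g' x) (h.2.1.sub h'.2.1) ?_
  · rw [EventuallyEq, ae_restrict_iff' hΩ.measurableSet]
    filter_upwards [key] with x hx hxΩ
    linarith [hx hxΩ]
  · intro φ hφ hφc hφs
    have hint : ∀ {u : Space d → ℝ}, LocallyIntegrableOn u Ω volume →
        IntegrableOn (fun x => u x * φ x) Ω := fun {u} hu => by
      have h1 : IntegrableOn u (tsupport φ) := hu.integrableOn_compact_subset hφs hφc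
      have h2 : IntegrableOn (fun x => u x * φ x) (tsupport φ) := by
        obtain ⟨C, hC⟩ := continuous_bdd hφ.continuous hφc
        exact Integrable.mul_bdd (c := C) h1 hφ.continuous.aestronglyMeasurable
          (Eventually.of_forall hC)
      refine IntegrableOn.of_forall_sdiff_eq_zero h2 hΩ.measurableSet fun x hx => ?_
      rw [image_eq_zero_of_notMem_tsupport hx.2, mul_zero]
    have h1 := h.2.2 φ hφ hφc hφs
    have h2 := h'.2.2 φ hφ hφc hφs
    have h3 : ∫ x in Ω, (g x * φ x - g' x * φ x) = 0 := by
      rw [integral_sub (hint h.2.1) (hint h'.2.1)]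
      linarith
    rw [← setIntegral_eq_integral_of_forall_compl_eq_zero (s := Ω)]
    · rw [← h3]
      congr 1
      funext x
      simp only [smul_eq_mul]
      ring
    · intro x hx
      rw [image_eq_zero_of_notMem_tsupport (fun h => hx (hφs h)), zero_smul]

/-- A function with a trace is a limit of smooth functions of compact support. -/
theorem HasTrace.h1Trace {Ω : Set (Space d)} (hΩ : IsSmoothBoundedDomain Ω)
    {f g : Space d → ℝ} (h : HasTrace Ω f g) {Df : Fin (d + 2) → Space d → ℝ}
    (hD : ∀ i, HasWeakPartial Ω i f (Df i)) : H1Trace Ω (surfaceMeasure Ω) f Df g := by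
  obtain ⟨hf, hg, Df', hDf', φ, hφ, h1, h2, h3⟩ := h
  have := isFiniteMeasure_surfaceMeasure hΩ
  obtain ⟨r, hr⟩ := hΩ.isBounded.closure.subset_ball 0
  have hr0 : 0 < r := by
    obtain ⟨x, hx⟩ := hΩ.isConnected.nonempty
    exact Metric.pos_of_mem_ball (hr (subset_closure hx))
  let b : ContDiffBump (0 : Space d) := ⟨r, r + 1, hr0, by linarith⟩
  -- The cut-off is 1 near the closure of Ω, so it gives the approximants compact support without
  -- changing their values on Ω and Γ or their derivatives on Ω.
  have hb : ∀ x ∈ closure Ω, b =ᶠ[𝓝 x] fun _ => 1 := fun x hx => by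
    filter_upwards [Metric.isOpen_ball.mem_nhds (hr hx)] with y hy
    exact b.one_of_mem_closedBall (Metric.ball_subset_closedBall hy)
  have hs : ∀ k, ContDiff ℝ ∞ (fun x => b x * φ k x) := fun k => b.contDiff.mul (hφ k)
  have hc : ∀ k, HasCompactSupport (fun x => b x * φ k x) := fun k => b.hasCompactSupport.mul_right
  have heq : ∀ k, ∀ x ∈ closure Ω, (fun x => b x * φ k x) =ᶠ[𝓝 x] φ k := fun k x hx => by
    filter_upwards [hb x hx] with y hy
    rw [hy, one_mul]
  have hae : ∀ {P : Space d → Prop}, (∀ x ∈ closure Ω, P x) → ∀ᵐ x ∂(volume.restrict Ω), P x :=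
    fun hP => by
      filter_upwards [ae_restrict_mem hΩ.isOpen.measurableSet] with x hx
      exact hP x (subset_closure hx)
  refine ⟨fun k x => b x * φ k x, hs, hc, ⟨hf, fun k => memLp_of_continuous (hs k).continuous (hc k) _,
    ?_⟩, fun i => L2Lim.congr (f := Df' i) (φ := fun k x => fderiv ℝ (fun x => b x * φ k x) x (basisVec i))
      ⟨(hDf' i).2, fun k => memLp_of_continuous (contDiff_fderiv_apply (hs k) _).continuous
      (hasCompactSupport_fderiv_apply (hc k) _) _, ?_⟩ (fun _ => ae_eq_rfl)
      ((hDf' i).1.ae_eq hΩ.isOpen (hD i)), ⟨hg, fun k => memLp_of_continuous (hs k).continuous (hc k) _, ?_⟩⟩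
  · refine h1.congr fun k => eLpNorm_congr_ae (hae fun x hx => ?_)
    simp only [Pi.sub_apply]
    rw [(heq k x hx).eq_of_nhds]
  · refine (h2 i).congr fun k => eLpNorm_congr_ae (hae fun x hx => ?_)
    simp only [Pi.sub_apply]
    rw [(heq k x hx).fderiv_eq]
  · refine h3.congr fun k => eLpNorm_congr_ae ?_
    rw [surfaceMeasure]
    filter_upwards [ae_restrict_mem isClosed_frontier.measurableSet] with x hx
    simp only [Pi.sub_apply]
    rw [(heq k x (frontier_subset_closure hx)).eq_of_nhds]

theorem H1Trace.mono {Ω : Set (Space d)} {σ τ : Measure (Space d)} {f g : Space d → ℝ}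
    {Df : Fin (d + 2) → Space d → ℝ} (h : H1Trace Ω σ f Df g) {c : NNReal} (hτ : τ ≤ c • σ) :
    H1Trace Ω τ f Df g := by
  obtain ⟨φ, h1, h2, h3, h4, h5⟩ := h
  exact ⟨φ, h1, h2, h3, h4, h5.mono hτ⟩

theorem tsupport_mul_subset' {f g : Space d → ℝ} {U : Set (Space d)}
    (h : tsupport f ⊆ U ∨ tsupport g ⊆ U) : tsupport (fun x => f x * g x) ⊆ U := by
  rcases h with h | h
  · exact (closure_mono fun x hx => by
      intro h0; exact hx (by simp [h0])).trans h
  · exact (closure_mono fun x hx => by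
      intro h0; exact hx (by simp [h0])).trans h

theorem tsupport_fderiv_apply_subset {f : Space d → ℝ} {v : Space d} :
    tsupport (fun x => fderiv ℝ f x v) ⊆ tsupport f := by
  refine (closure_mono fun x hx => ?_).trans (tsupport_fderiv_subset ℝ)
  intro h0
  exact hx (by simp [h0])

theorem differentiableAt_of_smooth {f : Space d → ℝ} (hf : ContDiff ℝ ∞ f) {x : Space d} :
    DifferentiableAt ℝ f x := (hf.differentiable (by simp)).differentiableAt

theorem integrable_mul_of_smooth {f g : Space d → ℝ} (hf : Continuous f) (hg : Continuous g)
    (hfc : HasCompactSupport f) (μ : Measure (Space d)) [IsFiniteMeasureOnCompacts μ] :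
    Integrable (fun x => f x * g x) μ :=
  (hf.mul hg).integrable_of_hasCompactSupport hfc.mul_right

/-! ### The form `∑ (∂_j X_i ∂_i Y_j - ∂_i X_i ∂_j Y_j)` -/

/-- The null Lagrangian `∫ ∑ (∂_j X_i ∂_i Y_j - ∂_i X_i ∂_j Y_j)`, for derivatives
`DX i j = ∂_j X_i`. -/
def nullForm (Ω : Set (Space d)) (DX DY : Fin (d + 2) → Fin (d + 2) → Space d → ℝ) : ℝ :=
  ∑ i, ∑ j, ((∫ x in Ω, DX i j x * DY j i x) - ∫ x in Ω, DX i i x * DY j j x)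

theorem tendsto_nullForm {Ω : Set (Space d)}
    {DX DY : Fin (d + 2) → Fin (d + 2) → Space d → ℝ}
    {A B : ℕ → Fin (d + 2) → Fin (d + 2) → Space d → ℝ}
    (hA : ∀ i j, L2Lim (volume.restrict Ω) (fun k => A k i j) (DX i j))
    (hB : ∀ i j, L2Lim (volume.restrict Ω) (fun k => B k i j) (DY i j)) :
    Tendsto (fun k => nullForm Ω (A k) (B k)) atTop (𝓝 (nullForm Ω DX DY)) := by
  refine tendsto_finsetSum _ fun i _ => tendsto_finsetSum _ fun j _ => ?_
  exact ((hA i j).integral_mul (hB j i)).sub ((hA i i).integral_mul (hB j j))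

theorem nullForm_comm (Ω : Set (Space d)) (DX DY : Fin (d + 2) → Fin (d + 2) → Space d → ℝ) :
    nullForm Ω DX DY = nullForm Ω DY DX := by
  rw [nullForm, nullForm, Finset.sum_comm]
  refine Finset.sum_congr rfl fun i _ => Finset.sum_congr rfl fun j _ => ?_
  simp_rw [mul_comm]

namespace IsPatch

variable {Ω U : Set (Space d)} {σ : Measure (Space d)} {n : Space d → Space d}

theorem smooth_coord (P : IsPatch Ω U σ n) (i : Fin (d + 2)) : ContDiff ℝ ∞ (fun x => n x i) :=
  contDiff_piLp_apply (p := 2) |>.comp P.smooth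

theorem compact_coord (P : IsPatch Ω U σ n) (i : Fin (d + 2)) :
    HasCompactSupport (fun x => n x i) :=
  P.compact.comp_left (g := fun v : Space d => v i) rfl

theorem sum_sq_eq_one (P : IsPatch Ω U σ n) {x : Space d} (hx : x ∈ U) :
    ∑ i, n x i * n x i = 1 := by
  have := P.norm_one x hx
  rw [EuclideanSpace.norm_eq, Real.sqrt_eq_one] at this
  simpa [sq] using this

/-- Gauss' theorem for f ∂_i g in the direction j, minus the same with i and j exchanged: the second
derivatives of g cancel, and f enters the boundary integral undifferentiated. -/
theorem gauss_null (P : IsPatch Ω U σ n) {f g : Space d → ℝ} (hf : ContDiff ℝ ∞ f)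
    (hg : ContDiff ℝ ∞ g) (hfc : HasCompactSupport f)
    (hs : tsupport f ⊆ U ∨ tsupport g ⊆ U) (i j : Fin (d + 2)) :
    (∫ x in Ω, fderiv ℝ f x (basisVec j) * fderiv ℝ g x (basisVec i))
      - ∫ x in Ω, fderiv ℝ f x (basisVec i) * fderiv ℝ g x (basisVec j) =
    ∫ x, f x * (n x j * fderiv ℝ g x (basisVec i) - n x i * fderiv ℝ g x (basisVec j)) ∂σ := by
  have := P.finite
  have hg' := fun v => contDiff_fderiv_apply hg v
  have hf' := fun v => contDiff_fderiv_apply hf v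
  have hfc' := fun v => hasCompactSupport_fderiv_apply hfc v
  have key : ∀ i j : Fin (d + 2),
      (∫ x in Ω, fderiv ℝ f x (basisVec j) * fderiv ℝ g x (basisVec i)) +
        ∫ x in Ω, f x * fderiv ℝ (fun y => fderiv ℝ g y (basisVec i)) x (basisVec j) =
      ∫ x, f x * fderiv ℝ g x (basisVec i) * n x j ∂σ := fun i j => by
    rw [← P.gauss (fun x => f x * fderiv ℝ g x (basisVec i)) (hf.mul (hg' _)) hfc.mul_right
      (tsupport_mul_subset' (hs.imp_right fun h => tsupport_fderiv_apply_subset.trans h)) j,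
      ← integral_add]
    · congr 1
      funext x
      rw [fderiv_mul_apply' (differentiableAt_of_smooth hf) (differentiableAt_of_smooth (hg' _))]
    · exact integrable_mul_of_smooth (hf' _).continuous (hg' _).continuous (hfc' _) _
    · exact integrable_mul_of_smooth hf.continuous (contDiff_fderiv_apply (hg' _) _).continuous hfc _
  have h1 := key i j
  have h2 := key j i
  have h3 : ∫ x in Ω, f x * fderiv ℝ (fun y => fderiv ℝ g y (basisVec i)) x (basisVec j) =
      ∫ x in Ω, f x * fderiv ℝ (fun y => fderiv ℝ g y (basisVec j)) x (basisVec i) := by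
    congr 1
    funext x
    rw [fderiv_fderiv_comm hg]
  have hint : ∀ i j : Fin (d + 2), Integrable (fun x => f x * fderiv ℝ g x (basisVec i) * n x j) σ :=
    fun i j => integrable_mul_of_smooth (hf.mul (hg' _)).continuous (P.smooth_coord j).continuous
      hfc.mul_right σ
  have h4 : ∫ x, f x * (n x j * fderiv ℝ g x (basisVec i) - n x i * fderiv ℝ g x (basisVec j)) ∂σ =
      (∫ x, f x * fderiv ℝ g x (basisVec i) * n x j ∂σ)
        - ∫ x, f x * fderiv ℝ g x (basisVec j) * n x i ∂σ := by
    rw [← integral_sub (hint i j) (hint j i)]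
    congr 1
    funext x
    ring
  rw [h4]
  linarith

/-- Partial derivatives of a smooth field. -/
def smoothDeriv (X : Fin (d + 2) → Space d → ℝ) : Fin (d + 2) → Fin (d + 2) → Space d → ℝ :=
  fun i j x => fderiv ℝ (X i) x (basisVec j)

theorem nullForm_smooth (P : IsPatch Ω U σ n) {X Y : Fin (d + 2) → Space d → ℝ}
    (hX : ∀ i, ContDiff ℝ ∞ (X i)) (hY : ∀ i, ContDiff ℝ ∞ (Y i))
    (hXc : ∀ i, HasCompactSupport (X i))
    (hs : (∀ i, tsupport (X i) ⊆ U) ∨ (∀ i, tsupport (Y i) ⊆ U)) :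
    nullForm Ω (smoothDeriv X) (smoothDeriv Y) =
      ∑ i, ∑ j, ∫ x, X i x * (n x j * fderiv ℝ (Y j) x (basisVec i)
        - n x i * fderiv ℝ (Y j) x (basisVec j)) ∂σ := by
  refine Finset.sum_congr rfl fun i _ => Finset.sum_congr rfl fun j _ => ?_
  exact P.gauss_null (hX i) (hY j) (hXc i) (hs.imp (fun h => h i) (fun h => h j)) i j

variable {V W gV gW : Fin (d + 2) → Space d → ℝ} {DV DW : Fin (d + 2) → Fin (d + 2) → Space d → ℝ}

/-- Derivatives of a product with a scalar function. -/
def derivMul (χ : Space d → ℝ) (V : Fin (d + 2) → Space d → ℝ)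
    (DV : Fin (d + 2) → Fin (d + 2) → Space d → ℝ) : Fin (d + 2) → Fin (d + 2) → Space d → ℝ :=
  fun i j x => fderiv ℝ χ x (basisVec j) * V i x + χ x * DV i j x

variable {χ : Space d → ℝ}

/-- The boundary formula contains no derivative of the first field, so that field may be
approximated in H¹ with convergence of traces. The second stays smooth, since its derivatives occur
on the boundary. -/
theorem nullForm_h1_smooth (P : IsPatch Ω U σ n) (hχ : ContDiff ℝ ∞ χ) (hχc : HasCompactSupport χ)
    (hχs : tsupport χ ⊆ U) (hV : ∀ i, H1Trace Ω σ (V i) (DV i) (gV i))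
    {Y : Fin (d + 2) → Space d → ℝ} (hY : ∀ i, ContDiff ℝ ∞ (Y i))
    (hYc : ∀ i, HasCompactSupport (Y i)) :
    nullForm Ω (derivMul χ V DV) (smoothDeriv Y) =
      ∑ i, ∑ j, ∫ x, χ x * gV i x * (n x j * fderiv ℝ (Y j) x (basisVec i)
        - n x i * fderiv ℝ (Y j) x (basisVec j)) ∂σ := by
  have := P.finite
  choose φ h1 h2 h3 h4 h5 using hV
  obtain ⟨C, hC⟩ := continuous_bdd hχ.continuous hχc
  have hYd : ∀ j v, MemLp (fun x => fderiv ℝ (Y j) x v) 2 (volume.restrict Ω) := fun j v =>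
    memLp_of_continuous (contDiff_fderiv_apply (hY j) v).continuous
      (hasCompactSupport_fderiv_apply (hYc j) v) _
  have hX : ∀ i k, ContDiff ℝ ∞ (fun x => χ x * φ i k x) := fun i k => hχ.mul (h1 i k)
  have hXc : ∀ i k, HasCompactSupport (fun x => χ x * φ i k x) := fun i k => hχc.mul_right
  have hl : Tendsto (fun k => nullForm Ω (smoothDeriv fun i x => χ x * φ i k x) (smoothDeriv Y))
      atTop (𝓝 (nullForm Ω (derivMul χ V DV) (smoothDeriv Y))) := by
    refine tendsto_nullForm (fun i j => ?_) (fun i j => L2Lim.const (hYd i _))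
    have hdc := (contDiff_fderiv_apply hχ (basisVec j)).continuous
    obtain ⟨C', hC'⟩ := continuous_bdd hdc (hasCompactSupport_fderiv_apply hχc (basisVec j))
    refine (((h3 i).mul_bdd hdc.aestronglyMeasurable hC').add
      ((h4 i j).mul_bdd hχ.continuous.aestronglyMeasurable hC)).congr
      (fun k => Eventually.of_forall fun x => ?_) ae_eq_rfl
    simp only [smoothDeriv]
    rw [fderiv_mul_apply' (differentiableAt_of_smooth hχ) (differentiableAt_of_smooth (h1 i k))]
  have hr : Tendsto (fun k => ∑ i, ∑ j, ∫ x, χ x * φ i k x * (n x j * fderiv ℝ (Y j) x (basisVec i)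
        - n x i * fderiv ℝ (Y j) x (basisVec j)) ∂σ) atTop
      (𝓝 (∑ i, ∑ j, ∫ x, χ x * gV i x * (n x j * fderiv ℝ (Y j) x (basisVec i)
        - n x i * fderiv ℝ (Y j) x (basisVec j)) ∂σ)) := by
    refine tendsto_finsetSum _ fun i _ => tendsto_finsetSum _ fun j _ => ?_
    refine ((h5 i).mul_bdd hχ.continuous.aestronglyMeasurable hC).integral_mul (L2Lim.const ?_)
    refine memLp_of_continuous ?_ ?_ σ
    · exact ((P.smooth_coord j).continuous.mul (contDiff_fderiv_apply (hY j) _).continuous).sub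
        ((P.smooth_coord i).continuous.mul (contDiff_fderiv_apply (hY j) _).continuous)
    · exact ((P.compact_coord j).mul_right).sub ((P.compact_coord i).mul_right)
  refine tendsto_nhds_unique hl (hr.congr fun k => ?_)
  rw [P.nullForm_smooth (fun i => hX i k) hY (fun i => hXc i k)
    (Or.inl fun i => (tsupport_mul_subset' (Or.inl hχs)))]

/-- The form depends on the second field only through its trace. The two fields have to be
approximated one after the other, because the boundary formula tolerates roughness in one argument
at a time. -/
theorem nullForm_h1_zero (P : IsPatch Ω U σ n) (hχ : ContDiff ℝ ∞ χ) (hχc : HasCompactSupport χ)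
    (hχs : tsupport χ ⊆ U) (hV : ∀ i, H1Trace Ω σ (V i) (DV i) (gV i))
    (hW : ∀ i, H1Trace Ω σ (W i) (DW i) (fun _ => 0)) :
    nullForm Ω (derivMul χ V DV) DW = 0 := by
  have := P.finite
  have hχV := fun i => (hV i).smul hχ hχc
  choose φ h1 h2 h3 h4 h5 using hV
  choose ψ k1 k2 k3 k4 k5 using hW
  obtain ⟨C, hC⟩ := continuous_bdd hχ.continuous hχc
  have hX : ∀ i k, ContDiff ℝ ∞ (fun x => χ x * φ i k x) := fun i k => hχ.mul (h1 i k)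
  have hXc : ∀ i k, HasCompactSupport (fun x => χ x * φ i k x) := fun i k => hχc.mul_right
  have hXd : ∀ i k v, MemLp (fun x => fderiv ℝ (fun x => χ x * φ i k x) x v) 2 (volume.restrict Ω) :=
    fun i k v => memLp_of_continuous (contDiff_fderiv_apply (hX i k) v).continuous
      (hasCompactSupport_fderiv_apply (hXc i k) v) _
  -- By the symmetry of the form, the approximants of W can be placed in the undifferentiated
  -- argument of the boundary integral, where they tend to the trace 0.
  have hzero : ∀ k, nullForm Ω (smoothDeriv fun i x => χ x * φ i k x) DW = 0 := fun k => by
    have hl : Tendsto (fun m => nullForm Ω (smoothDeriv fun i x => χ x * φ i k x)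
        (smoothDeriv fun i x => ψ i m x)) atTop
        (𝓝 (nullForm Ω (smoothDeriv fun i x => χ x * φ i k x) DW)) :=
      tendsto_nullForm (fun i j => L2Lim.const (hXd i k _)) (fun i j => k4 i j)
    have hr : Tendsto (fun m => ∑ i, ∑ j, ∫ x, ψ i m x *
        (n x j * fderiv ℝ (fun x => χ x * φ j k x) x (basisVec i)
        - n x i * fderiv ℝ (fun x => χ x * φ j k x) x (basisVec j)) ∂σ) atTop
        (𝓝 (∑ i, ∑ j, ∫ x, (0 : ℝ) * (n x j * fderiv ℝ (fun x => χ x * φ j k x) x (basisVec i)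
        - n x i * fderiv ℝ (fun x => χ x * φ j k x) x (basisVec j)) ∂σ)) := by
      refine tendsto_finsetSum _ fun i _ => tendsto_finsetSum _ fun j _ => ?_
      refine (k5 i).integral_mul (L2Lim.const ?_)
      refine memLp_of_continuous ?_ ?_ σ
      · exact ((P.smooth_coord j).continuous.mul (contDiff_fderiv_apply (hX j k) _).continuous).sub
          ((P.smooth_coord i).continuous.mul (contDiff_fderiv_apply (hX j k) _).continuous)
      · exact ((P.compact_coord j).mul_right).sub ((P.compact_coord i).mul_right)
    simp only [zero_mul, integral_zero, Finset.sum_const_zero] at hr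
    refine tendsto_nhds_unique hl (hr.congr fun m => ?_)
    rw [nullForm_comm, P.nullForm_smooth (fun i => k1 i m) (fun i => hX i k) (fun i => k2 i m)
      (Or.inr fun i => (tsupport_mul_subset' (Or.inl hχs)))]
  have hl : Tendsto (fun k => nullForm Ω (smoothDeriv fun i x => χ x * φ i k x) DW)
      atTop (𝓝 (nullForm Ω (derivMul χ V DV) DW)) := by
    refine tendsto_nullForm (fun i j => ?_) (fun i j => L2Lim.const (k4 i j).memLp)
    have hdc := (contDiff_fderiv_apply hχ (basisVec j)).continuous
    obtain ⟨C', hC'⟩ := continuous_bdd hdc (hasCompactSupport_fderiv_apply hχc (basisVec j))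
    refine (((h3 i).mul_bdd hdc.aestronglyMeasurable hC').add
      ((h4 i j).mul_bdd hχ.continuous.aestronglyMeasurable hC)).congr
      (fun k => Eventually.of_forall fun x => ?_) ae_eq_rfl
    simp only [smoothDeriv]
    rw [fderiv_mul_apply' (differentiableAt_of_smooth hχ) (differentiableAt_of_smooth (h1 i k))]
  simp_rw [hzero] at hl
  exact tendsto_nhds_unique hl tendsto_const_nhds

end IsPatch

/-! ### Normal parts, tangential fields, and Gauss' theorem for H¹ functions -/

/-- The component of a field along `n`. -/
def normalPart (n : Space d → Space d) (Y : Fin (d + 2) → Space d → ℝ) :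
    Fin (d + 2) → Space d → ℝ :=
  fun j x => ∑ l, (n x j * n x l) * Y l x

/-- Derivatives of the component of a field along `n`. -/
def normalPartDeriv (n : Space d → Space d) (Y : Fin (d + 2) → Space d → ℝ)
    (DY : Fin (d + 2) → Fin (d + 2) → Space d → ℝ) : Fin (d + 2) → Fin (d + 2) → Space d → ℝ :=
  fun j i x => ∑ l, (fderiv ℝ (fun y => n y j * n y l) x (basisVec i) * Y l x
    + (n x j * n x l) * DY l i x)

namespace IsPatch

variable {Ω U : Set (Space d)} {σ : Measure (Space d)} {n : Space d → Space d}
variable {V W gV gW : Fin (d + 2) → Space d → ℝ} {DV DW : Fin (d + 2) → Fin (d + 2) → Space d → ℝ}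
variable {χ : Space d → ℝ}

theorem normalPart_h1Trace (P : IsPatch Ω U σ n) (hW : ∀ i, H1Trace Ω σ (W i) (DW i) (gW i))
    (j : Fin (d + 2)) :
    H1Trace Ω σ (normalPart n W j) (normalPartDeriv n W DW j) (normalPart n gW j) := by
  have := P.finite
  exact H1Trace.sum Finset.univ fun l => (hW l).smul
    ((P.smooth_coord j).mul (P.smooth_coord l)) ((P.compact_coord j).mul_right)

theorem smoothDeriv_normalPart (P : IsPatch Ω U σ n) {Y : Fin (d + 2) → Space d → ℝ}
    (hY : ∀ i, ContDiff ℝ ∞ (Y i)) :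
    smoothDeriv (normalPart n Y) = normalPartDeriv n Y (smoothDeriv Y) := by
  funext j i x
  have hnn := fun l => (P.smooth_coord j).mul (P.smooth_coord l)
  simp only [smoothDeriv, normalPartDeriv]
  change fderiv ℝ (fun y => ∑ l, (n y j * n y l) * Y l y) x _ = _
  rw [fderiv_fun_sum fun l _ => differentiableAt_of_smooth ((hnn l).mul (hY l)),
    _root_.sum_apply]
  refine Finset.sum_congr rfl fun l _ => ?_
  rw [fderiv_mul_apply' (differentiableAt_of_smooth (hnn l)) (differentiableAt_of_smooth (hY l))]

theorem contDiff_normalPart (P : IsPatch Ω U σ n) {Y : Fin (d + 2) → Space d → ℝ}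
    (hY : ∀ i, ContDiff ℝ ∞ (Y i)) (j : Fin (d + 2)) : ContDiff ℝ ∞ (normalPart n Y j) :=
  ContDiff.sum fun l _ => ((P.smooth_coord j).mul (P.smooth_coord l)).mul (hY l)

/-- The derivative of the tangential part in the direction of the normal. -/
theorem sum_normal_mul_deriv (P : IsPatch Ω U σ n) {Y : Fin (d + 2) → Space d → ℝ}
    (hY : ∀ i, ContDiff ℝ ∞ (Y i)) {x : Space d} (hx : x ∈ U) (i : Fin (d + 2)) :
    ∑ j, n x j * fderiv ℝ (fun y => Y j y - normalPart n Y j y) x (basisVec i) =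
      - ∑ j, fderiv ℝ (fun y => n y j) x (basisVec i) * Y j x := by
  have hZ : ∀ j, ContDiff ℝ ∞ (fun y => Y j y - normalPart n Y j y) := fun j =>
    (hY j).sub (P.contDiff_normalPart hY j)
  have hn := P.smooth_coord
  have hUx := P.isOpen.mem_nhds hx
  -- The tangential part Z satisfies n·Z = 0 on the whole patch and not merely on Γ, because n has
  -- unit length there. Differentiating gives n·∂_i Z = −∂_i n·Z, and the normal part of Y
  -- contributes nothing to the right side since n·∂_i n = 0.
  have hzero : (fun y => ∑ j, n y j * (Y j y - normalPart n Y j y)) =ᶠ[𝓝 x] fun _ => 0 := by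
    filter_upwards [hUx] with y hy
    have h1 : ∑ j, n y j * normalPart n Y j y = ∑ l, n y l * Y l y := by
      calc ∑ j, n y j * normalPart n Y j y = ∑ j, ∑ l, (n y j * n y j) * (n y l * Y l y) := by
            refine Finset.sum_congr rfl fun j _ => ?_
            rw [normalPart, Finset.mul_sum]
            refine Finset.sum_congr rfl fun l _ => ?_
            ring
        _ = (∑ j, n y j * n y j) * ∑ l, n y l * Y l y := by rw [Finset.sum_mul_sum]
        _ = _ := by rw [P.sum_sq_eq_one hy, one_mul]
    simp_rw [mul_sub]
    rw [Finset.sum_sub_distrib, h1, sub_self]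
  have hone : (fun y => ∑ j, n y j * n y j) =ᶠ[𝓝 x] fun _ => 1 := by
    filter_upwards [hUx] with y hy using P.sum_sq_eq_one hy
  have d1 := congrArg (fun L : Space d →L[ℝ] ℝ => L (basisVec i)) hzero.fderiv_eq
  have d2 := congrArg (fun L : Space d →L[ℝ] ℝ => L (basisVec i)) hone.fderiv_eq
  simp only at d1 d2
  rw [fderiv_fun_sum fun l _ => differentiableAt_of_smooth ((hn l).mul (hZ l)),
    _root_.sum_apply, fderiv_fun_const] at d1
  rw [fderiv_fun_sum fun l _ => differentiableAt_of_smooth ((hn l).mul (hn l)),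
    _root_.sum_apply, fderiv_fun_const] at d2
  simp_rw [fderiv_mul_apply' (differentiableAt_of_smooth (hn _)) (differentiableAt_of_smooth (hZ _))]
    at d1
  simp_rw [fderiv_mul_apply' (differentiableAt_of_smooth (hn _)) (differentiableAt_of_smooth (hn _))]
    at d2
  have d2' : ∑ j, fderiv ℝ (fun y => n y j) x (basisVec i) * n x j = 0 := by
    have : ∑ j, (fderiv ℝ (fun y => n y j) x (basisVec i) * n x j
        + n x j * fderiv ℝ (fun y => n y j) x (basisVec i)) =
        2 * ∑ j, fderiv ℝ (fun y => n y j) x (basisVec i) * n x j := by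
      rw [Finset.mul_sum]
      refine Finset.sum_congr rfl fun j _ => ?_
      ring
    rw [this] at d2
    simpa using d2
  have d3 : ∑ j, fderiv ℝ (fun y => n y j) x (basisVec i) * normalPart n Y j x = 0 := by
    calc ∑ j, fderiv ℝ (fun y => n y j) x (basisVec i) * normalPart n Y j x
        = (∑ j, fderiv ℝ (fun y => n y j) x (basisVec i) * n x j) * ∑ l, n x l * Y l x := by
          rw [Finset.sum_mul_sum]
          refine Finset.sum_congr rfl fun j _ => ?_
          rw [normalPart, Finset.mul_sum]
          refine Finset.sum_congr rfl fun l _ => ?_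
          ring
      _ = 0 := by rw [d2', zero_mul]
  simp only [Pi.zero_apply, _root_.zero_apply] at d1
  rw [Finset.sum_add_distrib] at d1
  simp_rw [mul_sub] at d1
  rw [Finset.sum_sub_distrib, d3] at d1
  linarith

theorem nullForm_sub {A B C : Fin (d + 2) → Fin (d + 2) → Space d → ℝ}
    (hA : ∀ i j, MemLp (A i j) 2 (volume.restrict Ω)) (hB : ∀ i j, MemLp (B i j) 2 (volume.restrict Ω))
    (hC : ∀ i j, MemLp (C i j) 2 (volume.restrict Ω)) :
    nullForm Ω A (fun i j x => B i j x - C i j x) = nullForm Ω A B - nullForm Ω A C := by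
  have key : ∀ {a b c : Space d → ℝ}, MemLp a 2 (volume.restrict Ω) →
      MemLp b 2 (volume.restrict Ω) → MemLp c 2 (volume.restrict Ω) →
      ∫ x in Ω, a x * (b x - c x) = (∫ x in Ω, a x * b x) - ∫ x in Ω, a x * c x :=
    fun ha hb hc => by
      simp_rw [mul_sub]
      exact integral_sub (ha.integrable_mul hb) (ha.integrable_mul hc)
  simp only [nullForm]
  rw [← Finset.sum_sub_distrib]
  refine Finset.sum_congr rfl fun i _ => ?_
  rw [← Finset.sum_sub_distrib]
  refine Finset.sum_congr rfl fun j _ => ?_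
  rw [key (hA i j) (hB j i) (hC j i), key (hA i i) (hB j j) (hC j j)]
  ring

/-- For tangential fields, the null Lagrangian is a boundary integral without derivatives of the
fields. -/
theorem nullForm_tangential (P : IsPatch Ω U σ n) (hχ : ContDiff ℝ ∞ χ) (hχc : HasCompactSupport χ)
    (hχs : tsupport χ ⊆ U) (hV : ∀ i, H1Trace Ω σ (V i) (DV i) (gV i))
    (hW : ∀ i, H1Trace Ω σ (W i) (DW i) (gW i))
    (hVn : ∀ᵐ x ∂σ, ∑ i, gV i x * n x i = 0) (hWn : ∀ᵐ x ∂σ, ∑ i, gW i x * n x i = 0) :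
    nullForm Ω (derivMul χ V DV) DW =
      - ∑ i, ∑ j, ∫ x, (χ x * gV i x) * (fderiv ℝ (fun y => n y j) x (basisVec i) * gW j x) ∂σ := by
  have := P.finite
  obtain ⟨C, hC⟩ := continuous_bdd hχ.continuous hχc
  have hχV : ∀ i, H1Trace Ω σ _ (derivMul χ V DV i) _ := fun i => (hV i).smul hχ hχc
  have hQ := P.normalPart_h1Trace hW
  -- W is tangential, so its normal part has trace zero and can be subtracted from W without
  -- changing the form.
  have hQ0 : ∀ j, H1Trace Ω σ (normalPart n W j) (normalPartDeriv n W DW j) (fun _ => 0) := fun j =>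
    (hQ j).congr ae_eq_rfl (fun _ => ae_eq_rfl) (by
      filter_upwards [hWn] with x hx
      have : normalPart n gW j x = n x j * ∑ l, gW l x * n x l := by
        rw [normalPart, Finset.mul_sum]
        refine Finset.sum_congr rfl fun l _ => ?_
        ring
      rw [this, hx, mul_zero])
  have hN0 := P.nullForm_h1_zero hχ hχc hχs hV hQ0
  have hsub := nullForm_sub (fun i j => (hχV i).memLp_deriv j) (fun i j => (hW i).memLp_deriv j)
    (fun i j => (hQ i).memLp_deriv j)
  rw [hN0, sub_zero] at hsub
  rw [← hsub]
  choose ψ k1 k2 k3 k4 k5 using hW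
  -- The approximants of W need not be tangential, but their tangential parts are, and these
  -- approximate W minus its normal part. For them the normal derivative term becomes one in which
  -- the derivative falls on n, so that L² convergence of the traces suffices for the limit.
  set Z : ℕ → Fin (d + 2) → Space d → ℝ := fun m j x => ψ j m x - normalPart n (fun l => ψ l m) j x
    with hZdef
  have hZ : ∀ m j, ContDiff ℝ ∞ (Z m j) := fun m j =>
    (k1 j m).sub (P.contDiff_normalPart (fun l => k1 l m) j)
  have hZc : ∀ m j, HasCompactSupport (Z m j) := fun m j => by
    refine (k2 j m).sub ?_
    have : normalPart n (fun l => ψ l m) j = fun x => n x j * ∑ l, n x l * ψ l m x := by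
      funext x
      rw [normalPart, Finset.mul_sum]
      refine Finset.sum_congr rfl fun l _ => ?_
      ring
    rw [this]
    exact (P.compact_coord j).mul_right
  have hZd : ∀ m, smoothDeriv (Z m) = fun j i x => fderiv ℝ (ψ j m) x (basisVec i)
      - normalPartDeriv n (fun l => ψ l m) (smoothDeriv fun l => ψ l m) j i x := fun m => by
    rw [← P.smoothDeriv_normalPart (fun l => k1 l m)]
    funext j i x
    simp only [smoothDeriv, hZdef]
    rw [fderiv_fun_sub (differentiableAt_of_smooth (k1 j m))
      (differentiableAt_of_smooth (P.contDiff_normalPart (fun l => k1 l m) j))]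
    rfl
  have hl : Tendsto (fun m => nullForm Ω (derivMul χ V DV) (smoothDeriv (Z m))) atTop
      (𝓝 (nullForm Ω (derivMul χ V DV) fun i j x => DW i j x - normalPartDeriv n W DW i j x)) := by
    simp_rw [hZd]
    refine tendsto_nullForm (fun i j => L2Lim.const ((hχV i).memLp_deriv j)) fun j i =>
      (k4 j i).sub (L2Lim.sum Finset.univ fun l => ?_)
    have hnn := (P.smooth_coord j).mul (P.smooth_coord l)
    have hnnc : HasCompactSupport (fun y => n y j * n y l) := (P.compact_coord j).mul_right
    obtain ⟨C1, hC1⟩ := continuous_bdd hnn.continuous hnnc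
    obtain ⟨C2, hC2⟩ := continuous_bdd (contDiff_fderiv_apply hnn (basisVec i)).continuous
      (hasCompactSupport_fderiv_apply hnnc (basisVec i))
    exact ((k3 l).mul_bdd (contDiff_fderiv_apply hnn (basisVec i)).continuous.aestronglyMeasurable
      hC2).add ((k4 l i).mul_bdd hnn.continuous.aestronglyMeasurable hC1)
  have hgV : ∀ i, MemLp (fun x => χ x * gV i x) 2 σ := fun i => (hχV i).memLp_trace
  have hdn : ∀ i j : Fin (d + 2), Continuous (fun x => fderiv ℝ (fun y => n y j) x (basisVec i)) :=
    fun i j => (contDiff_fderiv_apply (P.smooth_coord j) _).continuous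
  have hdnc : ∀ i j : Fin (d + 2),
      HasCompactSupport (fun x => fderiv ℝ (fun y => n y j) x (basisVec i)) :=
    fun i j => hasCompactSupport_fderiv_apply (P.compact_coord j) _
  have hr : Tendsto (fun m => ∑ i, ∑ j, ∫ x, (χ x * gV i x) *
        (fderiv ℝ (fun y => n y j) x (basisVec i) * ψ j m x) ∂σ) atTop
      (𝓝 (∑ i, ∑ j, ∫ x, (χ x * gV i x) *
        (fderiv ℝ (fun y => n y j) x (basisVec i) * gW j x) ∂σ)) := by
    refine tendsto_finsetSum _ fun i _ => tendsto_finsetSum _ fun j _ => ?_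
    obtain ⟨C1, hC1⟩ := continuous_bdd (hdn i j) (hdnc i j)
    exact (L2Lim.const (hgV i)).integral_mul ((k5 j).mul_bdd (hdn i j).aestronglyMeasurable hC1)
  refine tendsto_nhds_unique hl (hr.neg.congr fun m => ?_)
  rw [P.nullForm_h1_smooth hχ hχc hχs hV (hZ m) (hZc m)]
  have hint1 : ∀ i j, Integrable (fun x => (χ x * gV i x) *
      (fderiv ℝ (fun y => n y j) x (basisVec i) * ψ j m x)) σ := fun i j =>
    (hgV i).integrable_mul (memLp_of_continuous ((hdn i j).mul (k1 j m).continuous)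
      (hdnc i j).mul_right σ)
  have hint2 : ∀ i j, Integrable (fun x => χ x * gV i x * (n x j * fderiv ℝ (Z m j) x (basisVec i)
        - n x i * fderiv ℝ (Z m j) x (basisVec j))) σ := fun i j =>
    (hgV i).integrable_mul (memLp_of_continuous
      (((P.smooth_coord j).continuous.mul (contDiff_fderiv_apply (hZ m j) _).continuous).sub
        ((P.smooth_coord i).continuous.mul (contDiff_fderiv_apply (hZ m j) _).continuous))
      (((P.compact_coord j).mul_right).sub ((P.compact_coord i).mul_right)) σ)
  simp_rw [← integral_finsetSum _ (fun j _ => hint1 _ j), ← integral_finsetSum _ (fun j _ => hint2 _ j)]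
  rw [← integral_finsetSum _ (fun i _ => integrable_finsetSum _ fun j _ => hint1 i j),
    ← integral_finsetSum _ (fun i _ => integrable_finsetSum _ fun j _ => hint2 i j), ← integral_neg]
  refine integral_congr_ae ?_
  filter_upwards [hVn, P.normal] with x hx hxU
  have h1 : ∀ i, ∑ j, n x j * fderiv ℝ (Z m j) x (basisVec i) =
      - ∑ j, fderiv ℝ (fun y => n y j) x (basisVec i) * ψ j m x := fun i =>
    P.sum_normal_mul_deriv (fun l => k1 l m) hxU.1 i
  -- The divergence term carries the factor n·V, which vanishes on the boundary.
  have h2 : ∑ i, ∑ j, χ x * gV i x * (n x i * fderiv ℝ (Z m j) x (basisVec j)) = 0 := by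
    have : ∑ i, ∑ j, χ x * gV i x * (n x i * fderiv ℝ (Z m j) x (basisVec j)) =
        χ x * (∑ i, gV i x * n x i) * ∑ j, fderiv ℝ (Z m j) x (basisVec j) := by
      rw [mul_assoc, Finset.sum_mul_sum, Finset.mul_sum]
      refine Finset.sum_congr rfl fun i _ => ?_
      rw [Finset.mul_sum]
      refine Finset.sum_congr rfl fun j _ => ?_
      ring
    rw [this, hx]
    ring
  simp_rw [mul_sub, Finset.sum_sub_distrib]
  rw [h2, sub_zero, ← Finset.sum_neg_distrib]
  refine Finset.sum_congr rfl fun i _ => ?_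
  rw [← Finset.mul_sum, ← Finset.mul_sum, h1]
  ring

/-- Gauss' theorem for products of functions of class `H¹`. -/
theorem gauss_h1 (P : IsPatch Ω U σ n) {c : Space d → ℝ} (hc : ContDiff ℝ ∞ c)
    (hcc : HasCompactSupport c) (hcs : tsupport c ⊆ U) {f f' g g' : Space d → ℝ}
    {Df Df' : Fin (d + 2) → Space d → ℝ} (h : H1Trace Ω σ f Df g) (h' : H1Trace Ω σ f' Df' g')
    (i : Fin (d + 2)) :
    (∫ x in Ω, (fderiv ℝ c x (basisVec i) * f x + c x * Df i x) * f' x)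
      + (∫ x in Ω, (c x * f x) * Df' i x) = ∫ x, (c x * g x) * (n x i * g' x) ∂σ := by
  have := P.finite
  have hcf := h.smul hc hcc
  obtain ⟨C, hC⟩ := continuous_bdd (P.smooth_coord i).continuous (P.compact_coord i)
  obtain ⟨C1, hC1⟩ := continuous_bdd hc.continuous hcc
  have hdc := contDiff_fderiv_apply hc (basisVec i)
  have hdcc := hasCompactSupport_fderiv_apply hcc (basisVec i)
  obtain ⟨C2, hC2⟩ := continuous_bdd hdc.continuous hdcc
  obtain ⟨φ, h1, h2, h3, h4, h5⟩ := h
  obtain ⟨ψ, k1, k2, k3, k4, k5⟩ := h'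
  have l1 := (((h3.mul_bdd hdc.continuous.aestronglyMeasurable hC2).add
    ((h4 i).mul_bdd hc.continuous.aestronglyMeasurable hC1)).integral_mul k3).add
    ((h3.mul_bdd hc.continuous.aestronglyMeasurable hC1).integral_mul (k4 i))
  have l2 := (h5.mul_bdd hc.continuous.aestronglyMeasurable hC1).integral_mul
    (k5.mul_bdd (P.smooth_coord i).continuous.aestronglyMeasurable hC)
  refine tendsto_nhds_unique l1 (l2.congr fun k => ?_)
  have hcφ := hc.mul (h1 k)
  have hcφc : HasCompactSupport (fun x => c x * φ k x) := hcc.mul_right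
  have hG := P.gauss (fun x => (c x * φ k x) * ψ k x) (hcφ.mul (k1 k)) hcφc.mul_right
    (tsupport_mul_subset' (Or.inl (tsupport_mul_subset' (Or.inl hcs)))) i
  have e1 : ∫ x, (c x * φ k x) * (n x i * ψ k x) ∂σ = ∫ x, (c x * φ k x) * ψ k x * n x i ∂σ := by
    congr 1; funext x; ring
  rw [e1, ← hG, ← integral_add]
  · congr 1
    funext x
    rw [fderiv_mul_apply' (differentiableAt_of_smooth hcφ) (differentiableAt_of_smooth (k1 k)),
      fderiv_mul_apply' (differentiableAt_of_smooth hc) (differentiableAt_of_smooth (h1 k))]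
  · exact integrable_mul_of_smooth ((hdc.continuous.mul (h1 k).continuous).add
      (hc.continuous.mul (contDiff_fderiv_apply (h1 k) _).continuous)) (k1 k).continuous
      (hdcc.mul_right.add hcc.mul_right) _
  · exact integrable_mul_of_smooth hcφ.continuous (contDiff_fderiv_apply (k1 k) _).continuous hcφc _

end IsPatch

/-! ### Quadratic bounds and the local trace inequality -/

theorem young_mul_le {ε : ℝ} (hε : 0 < ε) (c s t : ℝ) :
    c * |s| * |t| ≤ ε / 2 * s ^ 2 + c ^ 2 / (2 * ε) * t ^ 2 := by
  have h : ε / 2 * s ^ 2 + c ^ 2 / (2 * ε) * t ^ 2 - c * |s| * |t|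
      = (ε * |s| - c * |t|) ^ 2 / (2 * ε) := by
    rw [← sq_abs s, ← sq_abs t]
    field_simp
    ring
  have : 0 ≤ (ε * |s| - c * |t|) ^ 2 / (2 * ε) := by positivity
  linarith

theorem young_mul_le' {ε : ℝ} (hε : 0 < ε) (c s t : ℝ) :
    c * |s| * |t| ≤ c ^ 2 / (2 * ε) * s ^ 2 + ε / 2 * t ^ 2 := by
  have := young_mul_le hε c t s
  nlinarith

theorem half_mul_le {c : ℝ} (hc : 0 ≤ c) (s t : ℝ) :
    c * |s| * |t| ≤ c / 2 * s ^ 2 + c / 2 * t ^ 2 := by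
  have := mul_nonneg hc (sq_nonneg (|s| - |t|))
  rw [← sq_abs s, ← sq_abs t]
  nlinarith

theorem integrable_mul_mul {α : Type*} [MeasurableSpace α] {μ : Measure α} {m f g : α → ℝ}
    (hf : MemLp f 2 μ) (hg : MemLp g 2 μ) (hm : AEStronglyMeasurable m μ) {c : ℝ}
    (hmc : ∀ x, |m x| ≤ c) : Integrable (fun x => m x * f x * g x) μ := by
  have := (hf.integrable_mul hg).bdd_mul hm (Eventually.of_forall hmc)
  refine this.congr (Eventually.of_forall fun x => ?_)
  simp only [Pi.mul_apply]
  ring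

/-- The pointwise quadratic bound is a hypothesis, so that the balanced split and both ε-weighted
splits are instances of one lemma. -/
theorem abs_integral_mul_le {α : Type*} [MeasurableSpace α] {μ : Measure α} {f g : α → ℝ}
    (hf : MemLp f 2 μ) (hg : MemLp g 2 μ) {a b c : ℝ}
    (hb : ∀ s t : ℝ, c * |s| * |t| ≤ a * s ^ 2 + b * t ^ 2) {m : α → ℝ}
    (hm : AEStronglyMeasurable m μ) (hmc : ∀ x, |m x| ≤ c) :
    |∫ x, m x * f x * g x ∂μ| ≤ a * ∫ x, f x ^ 2 ∂μ + b * ∫ x, g x ^ 2 ∂μ := by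
  have h1 := integrable_mul_mul hf hg hm hmc
  have h2 : Integrable (fun x => a * f x ^ 2) μ := hf.integrable_sq.const_mul a
  have h3 : Integrable (fun x => b * g x ^ 2) μ := hg.integrable_sq.const_mul b
  calc |∫ x, m x * f x * g x ∂μ| ≤ ∫ x, |m x * f x * g x| ∂μ := abs_integral_le_integral_abs
    _ ≤ ∫ x, (a * f x ^ 2 + b * g x ^ 2) ∂μ := by
        refine integral_mono h1.abs (h2.add h3) fun x => ?_
        simp only [abs_mul]
        refine le_trans ?_ (hb (f x) (g x))
        gcongr
        exact hmc x
    _ = _ := by rw [integral_add h2 h3, integral_const_mul, integral_const_mul]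

namespace IsPatch

variable {Ω U : Set (Space d)} {σ : Measure (Space d)} {n : Space d → Space d}
variable {χ : Space d → ℝ}

/-- The trace inequality on a patch. -/
theorem trace_le (P : IsPatch Ω U σ n) (hχ : ContDiff ℝ ∞ χ) (hχc : HasCompactSupport χ)
    (hχs : tsupport χ ⊆ U) {ε : ℝ} (hε : 0 < ε) :
    ∃ C, 0 ≤ C ∧ ∀ (f g : Space d → ℝ) (Df : Fin (d + 2) → Space d → ℝ), H1Trace Ω σ f Df g →
      ∫ x, χ x * g x ^ 2 ∂σ ≤
        ε * (∑ i, ∫ x in Ω, Df i x ^ 2) + C * ∫ x in Ω, f x ^ 2 := by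
  have hc : ∀ i, ContDiff ℝ ∞ (fun x => χ x * n x i) := fun i => hχ.mul (P.smooth_coord i)
  have hcc : ∀ i, HasCompactSupport (fun x => χ x * n x i) := fun i => hχc.mul_right
  have hcs : ∀ i, tsupport (fun x => χ x * n x i) ⊆ U := fun i => tsupport_mul_subset' (Or.inl hχs)
  choose C1 hC1 using fun i => continuous_bdd (hc i).continuous (hcc i)
  choose C2 hC2 using fun i => continuous_bdd (contDiff_fderiv_apply (hc i) (basisVec i)).continuous
    (hasCompactSupport_fderiv_apply (hcc i) (basisVec i))
  have hC1' : ∀ i, 0 ≤ C1 i := fun i => (abs_nonneg _).trans (hC1 i 0)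
  have hC2' : ∀ i, 0 ≤ C2 i := fun i => (abs_nonneg _).trans (hC2 i 0)
  -- Gauss' theorem is applied to (χ n_i) f² in the direction i; summation over i restores χ g²
  -- because n has unit length. C2 comes from the derivative of χ n_i, and the two terms with a
  -- derivative of f cost C1²/(2ε) each.
  refine ⟨∑ i, (C2 i + C1 i ^ 2 / ε), Finset.sum_nonneg fun i _ => by
    have := hC2' i; positivity, fun f g Df h => ?_⟩
  have hfin := P.finite
  have hf := h.memLp
  have hterm : ∀ i, ∫ x, (χ x * n x i * g x) * (n x i * g x) ∂σ ≤
      ε * (∫ x in Ω, Df i x ^ 2) + (C2 i + C1 i ^ 2 / ε) * ∫ x in Ω, f x ^ 2 := fun i => by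
    have hD := h.memLp_deriv i
    have hG := P.gauss_h1 (hc i) (hcc i) (hcs i) h h i
    rw [← hG]
    set c := fun x => χ x * n x i with hcdef
    have m1 := (hc i).continuous.aestronglyMeasurable (μ := volume.restrict Ω)
    have m2 := (contDiff_fderiv_apply (hc i) (basisVec i)).continuous.aestronglyMeasurable
      (μ := volume.restrict Ω)
    have i1 : Integrable (fun x => fderiv ℝ c x (basisVec i) * f x * f x) (volume.restrict Ω) :=
      integrable_mul_mul hf hf m2 (hC2 i)
    have i2 : Integrable (fun x => c x * Df i x * f x) (volume.restrict Ω) :=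
      integrable_mul_mul hD hf m1 (hC1 i)
    simp_rw [add_mul]
    rw [integral_add i1 i2]
    have b1 := (abs_le.1 (abs_integral_mul_le hf hf (half_mul_le (hC2' i)) m2 (hC2 i))).2
    have b2 := (abs_le.1 (abs_integral_mul_le hD hf (young_mul_le hε (C1 i)) m1 (hC1 i))).2
    have b3 := (abs_le.1 (abs_integral_mul_le hf hD (young_mul_le' hε (C1 i)) m1 (hC1 i))).2
    have e : C1 i ^ 2 / ε = C1 i ^ 2 / (2 * ε) + C1 i ^ 2 / (2 * ε) := by field_simp; norm_num
    rw [e]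
    linarith
  have hsum : ∫ x, χ x * g x ^ 2 ∂σ = ∑ i, ∫ x, (χ x * n x i * g x) * (n x i * g x) ∂σ := by
    rw [← integral_finsetSum]
    · refine integral_congr_ae ?_
      filter_upwards [P.normal] with x hx
      have := P.sum_sq_eq_one hx.1
      calc χ x * g x ^ 2 = χ x * g x ^ 2 * ∑ i, n x i * n x i := by rw [this, mul_one]
        _ = _ := by
          rw [Finset.mul_sum]
          refine Finset.sum_congr rfl fun i _ => ?_
          ring
    · intro i _
      have h1 := h.smul (hc i) (hcc i)
      have h2 := h.smul (P.smooth_coord i) (P.compact_coord i)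
      exact h1.memLp_trace.integrable_mul h2.memLp_trace
  rw [hsum, Finset.mul_sum, Finset.sum_mul, ← Finset.sum_add_distrib]
  exact Finset.sum_le_sum fun i _ => hterm i

end IsPatch

/-! ### Trace inequality, null form and Gauss' theorem on the whole domain -/

namespace PatchCover

variable {Ω : Set (Space d)}

/-- The squared boundary norm with respect to the cover. -/
def bndSq (κ : PatchCover Ω) (g : Fin (d + 2) → Space d → ℝ) : ℝ :=
  ∑ k, ∑ i, ∫ x, κ.χ k x * g i x ^ 2 ∂(κ.σ k)

theorem h1Trace (κ : PatchCover Ω) {f g : Space d → ℝ} {Df : Fin (d + 2) → Space d → ℝ}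
    (h : H1Trace Ω (surfaceMeasure Ω) f Df g) (k : Fin κ.N) : H1Trace Ω (κ.σ k) f Df g :=
  h.mono (κ.isPatch k).le_surface.choose_spec

theorem ae_of_ae_surface (κ : PatchCover Ω) {p : Space d → Prop}
    (h : ∀ᵐ x ∂(surfaceMeasure Ω), p x) (k : Fin κ.N) : ∀ᵐ x ∂(κ.σ k), p x := by
  obtain ⟨K, hK⟩ := (κ.isPatch k).le_surface
  exact (Measure.absolutelyContinuous_of_le_smul (c := (K : ℝ≥0∞)) hK).ae_le h

/-- The trace inequality. -/
theorem bndSq_le (κ : PatchCover Ω) {ε : ℝ} (hε : 0 < ε) :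
    ∃ C, 0 ≤ C ∧ ∀ (V gV : Fin (d + 2) → Space d → ℝ) (DV : Fin (d + 2) → Fin (d + 2) → Space d → ℝ),
      (∀ i, H1Trace Ω (surfaceMeasure Ω) (V i) (DV i) (gV i)) →
      κ.bndSq gV ≤ ε * (∑ i, ∑ j, ∫ x in Ω, DV i j x ^ 2) + C * ∑ i, ∫ x in Ω, V i x ^ 2 := by
  -- Each of the N patches takes a share of ε; the added 1 covers the case of no patches.
  have hε' : 0 < ε / (κ.N + 1) := by positivity
  choose C hC0 hC using fun k => (κ.isPatch k).trace_le (κ.smooth k) (κ.compact k)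
    (κ.tsupport_subset k) hε'
  refine ⟨∑ k, C k, Finset.sum_nonneg fun k _ => hC0 k, fun V gV DV h => ?_⟩
  have h1 : κ.bndSq gV ≤ ∑ k, (ε / (κ.N + 1) * (∑ i, ∑ j, ∫ x in Ω, DV i j x ^ 2)
      + C k * ∑ i, ∫ x in Ω, V i x ^ 2) := by
    refine Finset.sum_le_sum fun k _ => ?_
    rw [Finset.mul_sum, Finset.mul_sum, ← Finset.sum_add_distrib]
    exact Finset.sum_le_sum fun i _ => hC k _ _ _ (κ.h1Trace (h i) k)
  refine h1.trans ?_
  rw [Finset.sum_add_distrib, Finset.sum_const, Finset.card_univ, Fintype.card_fin,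
    nsmul_eq_mul, ← mul_assoc, ← Finset.sum_mul]
  have h2 : 0 ≤ ∑ i, ∑ j, ∫ x in Ω, DV i j x ^ 2 := by positivity
  have h3 : (κ.N : ℝ) * (ε / (κ.N + 1)) ≤ ε := by
    rw [mul_div_assoc', div_le_iff₀ (by positivity)]
    nlinarith
  gcongr

theorem sum_fderiv_eq_zero (κ : PatchCover Ω) (hΩ : IsOpen Ω) {x : Space d} (hx : x ∈ Ω)
    (v : Space d) : ∑ k, fderiv ℝ (κ.χ k) x v = 0 := by
  have h1 : (fun y => ∑ k, κ.χ k y) =ᶠ[𝓝 x] fun _ => 1 := by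
    filter_upwards [hΩ.mem_nhds hx] with y hy using κ.sum_eq_one y hy
  have h2 := congrArg (fun L : Space d →L[ℝ] ℝ => L v) h1.fderiv_eq
  rw [fderiv_fun_sum fun k _ => differentiableAt_of_smooth (κ.smooth k), _root_.sum_apply,
    fderiv_fun_const] at h2
  simpa using h2

/-- On Ω the cut-offs sum to 1 and their derivatives to 0. Hence localised identities add up to the
global one and all derivatives of cut-offs disappear. -/
theorem integral_sum_cover (κ : PatchCover Ω) (hΩ : IsOpen Ω) {A B : Space d → ℝ}
    {f : Space d → ℝ} (i : Fin (d + 2)) (hA : MemLp A 2 (volume.restrict Ω))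
    (hB : MemLp B 2 (volume.restrict Ω)) (hf : MemLp f 2 (volume.restrict Ω)) :
    ∑ k, ∫ x in Ω, (fderiv ℝ (κ.χ k) x (basisVec i) * A x + κ.χ k x * B x) * f x =
      ∫ x in Ω, B x * f x := by
  rw [← integral_finsetSum]
  · refine setIntegral_congr_fun hΩ.measurableSet fun x hx => ?_
    rw [← Finset.sum_mul, Finset.sum_add_distrib, ← Finset.sum_mul, ← Finset.sum_mul,
      κ.sum_fderiv_eq_zero hΩ hx, κ.sum_eq_one x hx]
    ring
  · intro k _
    obtain ⟨C1, hC1⟩ := continuous_bdd (κ.smooth k).continuous (κ.compact k)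
    have h2 := contDiff_fderiv_apply (κ.smooth k) (basisVec i)
    obtain ⟨C2, hC2⟩ := continuous_bdd h2.continuous (hasCompactSupport_fderiv_apply (κ.compact k) _)
    simp_rw [add_mul]
    exact (integrable_mul_mul hA hf h2.continuous.aestronglyMeasurable hC2).add
      (integrable_mul_mul hB hf (κ.smooth k).continuous.aestronglyMeasurable hC1)

/-- The null Lagrangian of tangential fields is bounded by their boundary norms. -/
theorem abs_nullForm_le (κ : PatchCover Ω) (hΩ : IsOpen Ω) :
    ∃ C, 0 ≤ C ∧ ∀ (V gV W gW : Fin (d + 2) → Space d → ℝ)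
      (DV DW : Fin (d + 2) → Fin (d + 2) → Space d → ℝ),
      (∀ i, H1Trace Ω (surfaceMeasure Ω) (V i) (DV i) (gV i)) →
      (∀ i, H1Trace Ω (surfaceMeasure Ω) (W i) (DW i) (gW i)) →
      (∀ᵐ x ∂(surfaceMeasure Ω), ∀ ν, IsOutwardNormal Ω x ν → ∑ i, gV i x * ν i = 0) →
      (∀ᵐ x ∂(surfaceMeasure Ω), ∀ ν, IsOutwardNormal Ω x ν → ∑ i, gW i x * ν i = 0) →
      |nullForm Ω DV DW| ≤ C * (κ.bndSq gV + κ.bndSq gW) := by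
  have hdn := fun k i j => contDiff_fderiv_apply ((κ.isPatch k).smooth_coord j) (basisVec i)
  choose L hL using fun k i j => continuous_bdd (hdn k i j).continuous
    (hasCompactSupport_fderiv_apply ((κ.isPatch k).compact_coord j) (basisVec i))
  have hL0 : ∀ k i j, 0 ≤ L k i j := fun k i j => (abs_nonneg _).trans (hL k i j 0)
  set C := ∑ k, ∑ i, ∑ j, L k i j with hC
  have hC0 : 0 ≤ C := Finset.sum_nonneg fun k _ => Finset.sum_nonneg fun i _ =>
    Finset.sum_nonneg fun j _ => hL0 k i j
  have hLC : ∀ k i j, L k i j ≤ C := fun k i j =>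
    (Finset.single_le_sum (fun j _ => hL0 k i j) (Finset.mem_univ j)).trans
      ((Finset.single_le_sum (f := fun i => ∑ j, L k i j)
        (fun i _ => Finset.sum_nonneg fun j _ => hL0 k i j) (Finset.mem_univ i)).trans
      (Finset.single_le_sum (f := fun k => ∑ i, ∑ j, L k i j)
        (fun k _ => Finset.sum_nonneg fun i _ => Finset.sum_nonneg fun j _ => hL0 k i j)
        (Finset.mem_univ k)))
  -- C bounds all derivatives of the extended normals. Each product is split in halves, and in the
  -- double sum over i and j every square occurs d + 2 times.
  refine ⟨(d + 2) * (C / 2), by positivity, fun V gV W gW DV DW hV hW hVn hWn => ?_⟩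
  have h1 : nullForm Ω DV DW = ∑ k, nullForm Ω (IsPatch.derivMul (κ.χ k) V DV) DW := by
    simp only [nullForm, IsPatch.derivMul]
    symm
    rw [Finset.sum_comm]
    refine Finset.sum_congr rfl fun i _ => ?_
    rw [Finset.sum_comm]
    refine Finset.sum_congr rfl fun j _ => ?_
    rw [Finset.sum_sub_distrib,
      κ.integral_sum_cover hΩ j (hV i).memLp ((hV i).memLp_deriv j) ((hW j).memLp_deriv i),
      κ.integral_sum_cover hΩ i (hV i).memLp ((hV i).memLp_deriv i) ((hW j).memLp_deriv j)]
  have h2 : ∀ k, |nullForm Ω (IsPatch.derivMul (κ.χ k) V DV) DW| ≤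
      ∑ i, ∑ j, (C / 2 * (∫ x, κ.χ k x * gV i x ^ 2 ∂(κ.σ k))
        + C / 2 * ∫ x, κ.χ k x * gW j x ^ 2 ∂(κ.σ k)) := fun k => by
    have P := κ.isPatch k
    have hVk := fun i => κ.h1Trace (hV i) k
    have hWk := fun i => κ.h1Trace (hW i) k
    have hn : ∀ {g : Fin (d + 2) → Space d → ℝ},
        (∀ᵐ x ∂(surfaceMeasure Ω), ∀ ν, IsOutwardNormal Ω x ν → ∑ i, g i x * ν i = 0) →
        ∀ᵐ x ∂(κ.σ k), ∑ i, g i x * κ.n k x i = 0 := fun hg => by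
      filter_upwards [κ.ae_of_ae_surface hg k, P.normal] with x hx hxn using hx _ hxn.2
    rw [P.nullForm_tangential (κ.smooth k) (κ.compact k) (κ.tsupport_subset k) hVk hWk (hn hVn)
      (hn hWn), abs_neg]
    refine (Finset.abs_sum_le_sum_abs _ _).trans (Finset.sum_le_sum fun i _ => ?_)
    refine (Finset.abs_sum_le_sum_abs _ _).trans (Finset.sum_le_sum fun j _ => ?_)
    obtain ⟨C1, hC1⟩ := continuous_bdd (κ.smooth k).continuous (κ.compact k)
    have mχ := (κ.smooth k).continuous.aestronglyMeasurable (μ := κ.σ k)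
    have md := (hdn k i j).continuous.aestronglyMeasurable (μ := κ.σ k)
    have i1 : ∀ {g : Space d → ℝ}, MemLp g 2 (κ.σ k) →
        Integrable (fun x => κ.χ k x * g x ^ 2) (κ.σ k) := fun hg => by
      simpa [mul_assoc, sq] using integrable_mul_mul hg hg mχ hC1
    have iV := i1 (hVk i).memLp_trace
    have iW := i1 (hWk j).memLp_trace
    refine abs_integral_le_integral_abs.trans ?_
    rw [← integral_const_mul, ← integral_const_mul, ← integral_add (iV.const_mul _) (iW.const_mul _)]
    refine integral_mono_of_nonneg (Eventually.of_forall fun x => abs_nonneg _)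
      ((iV.const_mul _).add (iW.const_mul _)) (Eventually.of_forall fun x => ?_)
    simp only
    have hχ := κ.nonneg k x
    have e1 := (hL k i j x).trans (hLC k i j)
    rw [abs_mul, abs_mul, abs_mul, abs_of_nonneg hχ]
    calc κ.χ k x * |gV i x| * (|fderiv ℝ (fun y => κ.n k y j) x (basisVec i)| * |gW j x|)
        ≤ κ.χ k x * |gV i x| * (C * |gW j x|) := by gcongr
      _ = κ.χ k x * (C * |gV i x| * |gW j x|) := by ring
      _ ≤ κ.χ k x * (C / 2 * gV i x ^ 2 + C / 2 * gW j x ^ 2) := by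
          gcongr; exact half_mul_le hC0 _ _
      _ = _ := by ring
  calc |nullForm Ω DV DW| ≤ ∑ k, |nullForm Ω (IsPatch.derivMul (κ.χ k) V DV) DW| := by
        rw [h1]; exact Finset.abs_sum_le_sum_abs _ _
    _ ≤ ∑ k, ∑ i, ∑ j, (C / 2 * (∫ x, κ.χ k x * gV i x ^ 2 ∂(κ.σ k))
        + C / 2 * ∫ x, κ.χ k x * gW j x ^ 2 ∂(κ.σ k)) := Finset.sum_le_sum fun k _ => h2 k
    _ = _ := by
        simp only [Finset.sum_add_distrib, Finset.sum_const, Finset.card_univ, Fintype.card_fin,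
          nsmul_eq_mul, ← Finset.mul_sum, bndSq]
        push_cast
        ring

/-- Gauss' theorem on the whole domain, in terms of the cover. -/
theorem gauss_h1 (κ : PatchCover Ω) (hΩ : IsOpen Ω) {f f' g g' : Space d → ℝ}
    {Df Df' : Fin (d + 2) → Space d → ℝ} (h : H1Trace Ω (surfaceMeasure Ω) f Df g)
    (h' : H1Trace Ω (surfaceMeasure Ω) f' Df' g') (i : Fin (d + 2)) :
    (∫ x in Ω, Df i x * f' x) + (∫ x in Ω, f x * Df' i x) =
      ∑ k, ∫ x, (κ.χ k x * g x) * (κ.n k x i * g' x) ∂(κ.σ k) := by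
  simp_rw [← fun k => (κ.isPatch k).gauss_h1 (κ.smooth k) (κ.compact k) (κ.tsupport_subset k)
    (κ.h1Trace h k) (κ.h1Trace h' k) i]
  rw [Finset.sum_add_distrib, κ.integral_sum_cover hΩ i h.memLp (h.memLp_deriv i) h'.memLp]
  congr 1
  rw [← integral_finsetSum]
  · refine setIntegral_congr_fun hΩ.measurableSet fun x hx => ?_
    rw [← Finset.sum_mul, ← Finset.sum_mul, κ.sum_eq_one x hx, one_mul]
  · intro k _
    obtain ⟨C1, hC1⟩ := continuous_bdd (κ.smooth k).continuous (κ.compact k)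
    exact integrable_mul_mul h.memLp (h'.memLp_deriv i)
      (κ.smooth k).continuous.aestronglyMeasurable hC1

end PatchCover

/-! ### The vorticity condition on the boundary -/

/-- The determinant as an alternating form on `Space d`. -/
def volForm (d : ℕ) : (Space d) [⋀^Fin (d + 2)]→ₗ[ℝ] ℝ :=
  (Matrix.detRowAlternating (R := ℝ) (n := Fin (d + 2))).compLinearMap
    (WithLp.linearEquiv 2 ℝ (Fin (d + 2) → ℝ)).toLinearMap

theorem volForm_apply (m : Fin (d + 2) → Space d) :
    volForm d m = Matrix.det (Matrix.of fun r c => m r c) := rfl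

/-- An orthogonal matrix has determinant ±1. The orientation is irrelevant, since only the absolute
value of the vorticity pairing is estimated. -/
theorem abs_volForm_orthonormalBasis (b : OrthonormalBasis (Fin (d + 2)) ℝ (Space d)) :
    |volForm d b| = 1 := by
  have h := (EuclideanSpace.basisFun (Fin (d + 2)) ℝ).det_to_matrix_orthonormalBasis_real b
  have h2 : volForm d b = (EuclideanSpace.basisFun (Fin (d + 2)) ℝ).toBasis.det b := by
    rw [volForm_apply, Module.Basis.det_apply, ← Matrix.det_transpose]
    congr 1
  rw [h2]
  rcases h with h | h <;> rw [h] <;> simp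

/-- With the last d slots filled by basis vectors, only the components of x and y along the first
two basis vectors survive. An alternating bilinear form on that plane is a multiple of the 2 × 2
determinant. -/
theorem volForm_cons_cons (b : OrthonormalBasis (Fin (d + 2)) ℝ (Space d)) (x y : Space d) :
    volForm d (Fin.cons x (Fin.cons y fun k : Fin d => b k.succ.succ)) =
      volForm d b * (inner ℝ (b 0) x * inner ℝ (b 1) y - inner ℝ (b 1) x * inner ℝ (b 0) y) := by
  set v : Fin d → Space d := fun k => b k.succ.succ with hv
  let D : Space d → Space d → ℝ := fun x y => volForm d (Fin.cons x (Fin.cons y v))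
  have hD : ∀ x y, D x y = ((volForm d).curryLeft x).curryLeft y v := fun _ _ => rfl
  let Lx : Space d → Space d →ₗ[ℝ] ℝ := fun y =>
    { toFun := fun x => D x y
      map_add' := fun x z => by simp [hD]
      map_smul' := fun c x => by simp [hD] }
  let Ly : Space d → Space d →ₗ[ℝ] ℝ := fun x =>
    { toFun := fun y => D x y
      map_add' := fun x z => by simp [hD]
      map_smul' := fun c x => by simp [hD] }
  have hx : ∀ x y, D x y = ∑ c, inner ℝ (b c) x * D (b c) y := fun x y => by
    change Lx y x = ∑ c, inner ℝ (b c) x * Lx y (b c)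
    conv_lhs => rw [← b.sum_repr' x, map_sum]
    simp only [map_smul, smul_eq_mul]
  have hy : ∀ x y, D x y = ∑ c, inner ℝ (b c) y * D x (b c) := fun x y => by
    change Ly x y = ∑ c, inner ℝ (b c) y * Ly x (b c)
    conv_lhs => rw [← b.sum_repr' y, map_sum]
    simp only [map_smul, smul_eq_mul]
  have h0 : ∀ x (k : Fin d), D x (b k.succ.succ) = 0 := fun x k =>
    (volForm d).map_eq_zero_of_eq _ (i := 1) (j := k.succ.succ) (by simp [hv])
      (by simp [Fin.ext_iff])
  have h0' : ∀ y (k : Fin d), D (b k.succ.succ) y = 0 := fun x k =>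
    (volForm d).map_eq_zero_of_eq _ (i := 0) (j := k.succ.succ) (by simp [hv])
      (by simp [Fin.ext_iff])
  have h1 : ∀ x, D x x = 0 := fun x =>
    (volForm d).map_eq_zero_of_eq _ (i := 0) (j := 1) (by simp) (by simp)
  have h2 : D (b 0) (b 1) = volForm d b := by
    refine congrArg (volForm d) (funext fun k => ?_)
    exact Fin.cases rfl (fun k => Fin.cases rfl (fun k => rfl) k) k
  have h3 : D (b 1) (b 0) = - volForm d b := by
    have := h1 (b 0 + b 1)
    have e : ∀ x y z, D (x + y) z = D x z + D y z := fun x y z => by simp [hD]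
    have e' : ∀ x y z, D x (y + z) = D x y + D x z := fun x y z => by simp [hD]
    rw [e, e', e', h1, h1, h2] at this
    linarith
  change D x y = _
  rw [hx, Fin.sum_univ_succ, Fin.sum_univ_succ]
  simp only [h0', mul_zero, Finset.sum_const_zero, add_zero]
  rw [hy (b 0), hy (b (Fin.succ 0)), Fin.sum_univ_succ, Fin.sum_univ_succ, Fin.sum_univ_succ,
    Fin.sum_univ_succ]
  simp only [h0, mul_zero, Finset.sum_const_zero, add_zero, h1, Fin.succ_zero_eq_one, h2, h3]
  ring

/-- The vorticity condition controls the pairing of the vorticity with the normal and a tangent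
vector. -/
theorem abs_vorticity_pairing_le {g : Fin (d + 2) → Fin (d + 2) → ℝ} {ν w : Space d}
    (hν : ‖ν‖ = 1) (hw : inner ℝ w ν = 0) {a : (Space d) [⋀^Fin d]→L[ℝ] ℝ}
    (h : ∀ v : Fin d → Space d, (∀ k, inner ℝ (v k) ν = 0) → vorticity g v = a v) :
    |∑ i, ∑ j, ν i * (g i j - g j i) * w j| ≤ ‖a‖ * ‖w‖ := by
  rcases eq_or_ne w 0 with rfl | hw0
  · simp
  have hwn : ‖w‖ ≠ 0 := norm_ne_zero_iff.2 hw0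
  set w' : Space d := ‖w‖⁻¹ • w with hw'
  have hww : w = ‖w‖ • w' := (smul_inv_smul₀ hwn w).symm
  have hw'n : ‖w'‖ = 1 := by rw [hw', norm_smul, norm_inv, norm_norm, inv_mul_cancel₀ hwn]
  have hνw : inner ℝ ν w' = 0 := by
    rw [hw', inner_smul_right, real_inner_comm, hw, mul_zero]
  have hwν : inner ℝ w' ν = 0 := by rw [real_inner_comm, hνw]
  -- The orthonormal pair ν, w/|w| is completed to a basis. The other d basis vectors are tangent to
  -- Γ, and the vorticity form evaluated on them is, up to sign, the wanted pairing of the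
  -- antisymmetric gradient with ν and w/|w|.
  let u : Fin (d + 2) → Space d := fun i => if i = 0 then ν else w'
  have hu : Orthonormal ℝ (({0, 1} : Set (Fin (d + 2))).domRestrict u) := by
    refine ⟨fun i => ?_, fun i j hij => ?_⟩
    · rcases i with ⟨i, rfl | rfl⟩ <;> simp [u, hν, hw'n]
    · rcases i with ⟨i, rfl | rfl⟩ <;> rcases j with ⟨j, rfl | rfl⟩ <;>
        first | exact (hij rfl).elim | simp [u, hνw, hwν]
  obtain ⟨b, hb⟩ := hu.exists_orthonormalBasis_extension_of_card_eq (by simp)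
  have hb0 : b 0 = ν := by rw [hb 0 (by simp)]; simp [u]
  have hb1 : b 1 = w' := by rw [hb 1 (by simp)]; simp [u]
  set v : Fin d → Space d := fun k => b k.succ.succ with hv
  have hvν : ∀ k, inner ℝ (v k) ν = 0 := fun k => by
    rw [← hb0]
    exact b.orthonormal.2 (by simp [Fin.ext_iff])
  have hvn : ∀ k, ‖v k‖ = 1 := fun k => b.orthonormal.1 _
  have hinner : ∀ (z : Space d) i, inner ℝ z (basisVec i) = z i := fun z i => by
    simp [basisVec, EuclideanSpace.inner_single_right]
  have key : vorticity g v = volForm d b * ∑ i, ∑ j, g i j * (ν i * w' j - w' i * ν j) := by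
    rw [vorticity, Finset.mul_sum]
    refine Finset.sum_congr rfl fun i _ => ?_
    rw [Finset.mul_sum]
    refine Finset.sum_congr rfl fun j _ => ?_
    have := volForm_cons_cons b (basisVec i) (basisVec j)
    rw [hb0, hb1, hinner, hinner, hinner, hinner] at this
    rw [← volForm_apply, this]
    ring
  have hsum : ∑ i, ∑ j, ν i * (g i j - g j i) * w j =
      ‖w‖ * ∑ i, ∑ j, g i j * (ν i * w' j - w' i * ν j) := by
    have e1 : ∑ i, ∑ j, ν i * (g i j - g j i) * w j =
        ‖w‖ * (∑ i, ∑ j, g i j * (ν i * w' j)) - ‖w‖ * ∑ i, ∑ j, g j i * (w' j * ν i) := by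
      simp only [Finset.mul_sum, ← Finset.sum_sub_distrib]
      refine Finset.sum_congr rfl fun i _ => Finset.sum_congr rfl fun j _ => ?_
      have : w j = ‖w‖ * w' j := by
        conv_lhs => rw [hww]
        rfl
      rw [this]
      ring
    rw [e1, Finset.sum_comm (f := fun i j => g j i * (w' j * ν i)), ← mul_sub,
      ← Finset.sum_sub_distrib]
    simp only [← Finset.sum_sub_distrib, mul_sub]
  have hs := abs_volForm_orthonormalBasis b
  rw [hsum, abs_mul, abs_norm, mul_comm]
  refine mul_le_mul_of_nonneg_right ?_ (norm_nonneg _)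
  calc |∑ i, ∑ j, g i j * (ν i * w' j - w' i * ν j)| = |a v| := by
        rw [← h v hvν, key, abs_mul, hs, one_mul]
    _ ≤ ‖a‖ * ∏ k, ‖v k‖ := a.le_opNorm v
    _ = ‖a‖ := by simp [hvn]

/-! ### Mollification by off-centre kernels -/

open scoped Convolution

/-- The bump has centre −εe and radius εδ. Convolution at x then samples the function at points x +
εy with y within δ of e, which lie in Ω by the cone condition of a patch. -/
theorem exists_kernel (e : Space d) {δ ε : ℝ} (hδ : 0 < δ) (hε : 0 < ε) :
    ∃ ψ : Space d → ℝ, ContDiff ℝ ∞ ψ ∧ HasCompactSupport ψ ∧ (∀ x, 0 ≤ ψ x) ∧ ∫ x, ψ x = 1 ∧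
      ∀ t ∈ tsupport ψ, ∃ y ∈ Metric.closedBall e δ, t = -(ε • y) := by
  let b : ContDiffBump (-(ε • e)) := ⟨ε * δ / 2, ε * δ, by positivity, by
    have : 0 < ε * δ := by positivity
    linarith⟩
  refine ⟨b.normed volume, b.contDiff_normed, b.hasCompactSupport_normed, b.nonneg_normed,
    b.integral_normed, fun t ht => ⟨-(ε⁻¹ • t), ?_, ?_⟩⟩
  · rw [b.tsupport_normed_eq, Metric.mem_closedBall, dist_eq_norm] at ht
    rw [Metric.mem_closedBall, dist_eq_norm]
    have h1 : -(ε⁻¹ • t) - e = -(ε⁻¹ • (t - -(ε • e))) := by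
      rw [smul_sub, smul_neg, smul_smul, inv_mul_cancel₀ hε.ne', one_smul]
      abel
    rw [h1, norm_neg, norm_smul, norm_inv, Real.norm_of_nonneg hε.le]
    exact (inv_mul_le_iff₀ hε).2 ht
  · rw [smul_neg, neg_neg, smul_inv_smul₀ hε.ne']

/-- The correlation of two square integrable functions is continuous. -/
theorem continuous_correlation {q m : Space d → ℝ} (hq : MemLp q 2 volume)
    (hm : MemLp m 2 volume) : Continuous (fun h : Space d => ∫ x, m x * q (x + h)) := by
  let τ : Space d → C(Space d, Space d) := fun h => ⟨fun x => x + h, by fun_prop⟩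
  have hτ : Continuous τ := ContinuousMap.continuous_of_continuous_uncurry _ (by
    change Continuous fun z : Space d × Space d => z.2 + z.1
    fun_prop)
  have hτm : ∀ h, MeasurePreserving (τ h) volume volume := fun h =>
    measurePreserving_add_right volume h
  -- Translation acts continuously on L²; the correlation is its inner product with a fixed
  -- function.
  have h1 := (continuous_const (y := hq.toLp q)).compMeasurePreservingLp hτ hτm (by simp)
  refine ((continuous_const (y := hm.toLp m)).inner h1 (𝕜 := ℝ)).congr fun h => ?_
  rw [L2.inner_def]
  refine integral_congr_ae ?_
  filter_upwards [hm.coeFn_toLp, Lp.coeFn_compMeasurePreserving (hq.toLp q) (hτm h),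
    (hτm h).quasiMeasurePreserving.ae_eq_comp hq.coeFn_toLp] with x h1 h2 h3
  rw [h1, h2, h3]
  simp [τ, mul_comm]

/-- A dominating function is ψ(t)(m(x)² + q(x − t)²): its two parts are integrable as a product and
as the integrand of a convolution of integrable functions. -/
theorem integrable_convolution_mul {q m ψ : Space d → ℝ} (hq : MemLp q 2 volume)
    (hm : MemLp m 2 volume) (hψ : Continuous ψ) (hψc : HasCompactSupport ψ) (hψ0 : ∀ x, 0 ≤ ψ x) :
    Integrable (fun z : Space d × Space d => m z.1 * (ψ z.2 * q (z.1 - z.2)))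
      (volume.prod volume) := by
  have hψi : Integrable ψ := hψ.integrable_of_hasCompactSupport hψc
  have h1 : Integrable (fun z : Space d × Space d => ψ z.2 * q (z.1 - z.2) ^ 2)
      (volume.prod volume) :=
    hψi.convolution_integrand (ContinuousLinearMap.mul ℝ ℝ) hq.integrable_sq
  have h2 : Integrable (fun z : Space d × Space d => m z.1 ^ 2 * ψ z.2) (volume.prod volume) :=
    hm.integrable_sq.mul_prod hψi
  have h3 : AEStronglyMeasurable (fun z : Space d × Space d => ψ z.2 * q (z.1 - z.2))
      (volume.prod volume) :=
    AEStronglyMeasurable.convolution_integrand (ContinuousLinearMap.mul ℝ ℝ) hψi.1 hq.1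
  refine (h1.add h2).mono' (hm.1.comp_fst.mul h3) (Eventually.of_forall fun z => ?_)
  simp only [Pi.add_apply, Real.norm_eq_abs]
  have hz := hψ0 z.2
  rw [abs_mul, abs_mul, abs_of_nonneg hz, ← sq_abs (q _), ← sq_abs (m _)]
  have := mul_nonneg hz (sq_nonneg (|m z.1| - |q (z.1 - z.2)|))
  have := mul_nonneg hz (add_nonneg (sq_nonneg (|m z.1|)) (sq_nonneg |q (z.1 - z.2)|))
  nlinarith

/-- By Fubini, testing a mollified function is mollifying the correlation at 0. Convergence of
mollifications tested against L² functions is thereby reduced to continuity of the correlation. -/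
theorem integral_mul_convolution {q m ψ : Space d → ℝ} (hq : MemLp q 2 volume)
    (hm : MemLp m 2 volume) (hψ : Continuous ψ) (hψc : HasCompactSupport ψ) (hψ0 : ∀ x, 0 ≤ ψ x) :
    ∫ x, m x * (ψ ⋆[ContinuousLinearMap.lsmul ℝ ℝ] q) x =
      (ψ ⋆[ContinuousLinearMap.lsmul ℝ ℝ] fun h => ∫ x, m x * q (x + h)) 0 := by
  simp only [convolution_def, ContinuousLinearMap.lsmul_apply, smul_eq_mul, zero_sub,
    ← integral_const_mul]
  rw [integral_integral_swap (f := fun x t => m x * (ψ t * q (x - t)))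
    (integrable_convolution_mul hq hm hψ hψc hψ0)]
  refine integral_congr_ae (Eventually.of_forall fun t => ?_)
  simp only
  refine integral_congr_ae (Eventually.of_forall fun x => ?_)
  simp only [← sub_eq_add_neg]
  ring

/-- Weak convergence of mollifications. -/
theorem tendsto_integral_mul_convolution {q m : Space d → ℝ} (hq : MemLp q 2 volume)
    (hm : MemLp m 2 volume) {ψ : ℝ → Space d → ℝ} (e : Space d) (δ : ℝ)
    (h1 : ∀ ε, 0 < ε → Continuous (ψ ε)) (h2 : ∀ ε, 0 < ε → HasCompactSupport (ψ ε))
    (h3 : ∀ ε, 0 < ε → ∀ x, 0 ≤ ψ ε x) (h4 : ∀ ε, 0 < ε → ∫ x, ψ ε x = 1)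
    (h5 : ∀ ε, 0 < ε → ∀ t ∈ tsupport (ψ ε), ∃ y ∈ Metric.closedBall e δ, t = -(ε • y)) :
    Tendsto (fun ε => ∫ x, m x * (ψ ε ⋆[ContinuousLinearMap.lsmul ℝ ℝ] q) x) (𝓝[>] 0)
      (𝓝 (∫ x, m x * q x)) := by
  have hc := continuous_correlation hq hm
  have hpos : ∀ᶠ ε : ℝ in 𝓝[>] 0, 0 < ε := self_mem_nhdsWithin
  have hsupp : Tendsto (fun ε => Function.support (ψ ε)) (𝓝[>] 0) (𝓝 0).smallSets := by
    rw [tendsto_smallSets_iff]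
    intro s hs
    obtain ⟨r, hr, hrs⟩ := Metric.mem_nhds_iff.1 hs
    have hlim : Tendsto (fun ε : ℝ => ε * (‖e‖ + δ)) (𝓝[>] 0) (𝓝 0) := by
      refine Tendsto.mono_left ?_ nhdsWithin_le_nhds
      have : Continuous fun ε : ℝ => ε * (‖e‖ + δ) := by fun_prop
      simpa using this.tendsto 0
    filter_upwards [hpos, hlim.eventually_lt_const hr] with ε hε hlt t ht
    obtain ⟨y, hy, rfl⟩ := h5 ε hε t (subset_tsupport _ ht)
    apply hrs
    rw [mem_ball_zero_iff, norm_neg, norm_smul, Real.norm_of_nonneg hε.le]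
    have : ‖y‖ ≤ ‖e‖ + δ := by
      have := norm_sub_norm_le y e
      rw [Metric.mem_closedBall, dist_eq_norm] at hy
      linarith
    nlinarith
  have key := convolution_tendsto_right (μ := (volume : Measure (Space d))) (k := fun _ => (0 : Space d))
    (x₀ := 0) (g := fun _ h => ∫ x, m x * q (x + h)) (hpos.mono h3) (hpos.mono h4) hsupp
    (Eventually.of_forall fun _ => hc.aestronglyMeasurable) (hc.continuousAt.tendsto.comp tendsto_snd)
    tendsto_const_nhds
  simp only [add_zero] at key
  refine key.congr' ?_
  filter_upwards [hpos] with ε hε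
  exact (integral_mul_convolution hq hm (h1 ε hε) (h2 ε hε) (h3 ε hε)).symm

variable {Ω : Set (Space d)}

theorem fderiv_comp_const_sub' {ψ : Space d → ℝ} (hψ : ContDiff ℝ ∞ ψ) (x s v : Space d) :
    fderiv ℝ (fun s => ψ (x - s)) s v = - fderiv ℝ ψ (x - s) v := by
  have h1 : HasFDerivAt ψ (fderiv ℝ ψ (x - s)) (x - s) := (differentiableAt_of_smooth hψ).hasFDerivAt
  have h2 := h1.comp s ((hasFDerivAt_id s).const_sub x)
  change HasFDerivAt (fun s => ψ (x - s)) _ s at h2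
  rw [h2.fderiv]
  simp

/-- Off-centre mollification commutes with weak derivatives, as long as the kernel stays in `Ω`. -/
theorem HasWeakPartial.fderiv_convolution (hΩ : IsOpen Ω) {i : Fin (d + 2)} {p q : Space d → ℝ}
    (h : HasWeakPartial Ω i p q) (hp : IntegrableOn p Ω)
    {ψ : Space d → ℝ} (hψ : ContDiff ℝ ∞ ψ) (hψc : HasCompactSupport ψ) {x : Space d}
    (hx : ∀ t ∈ tsupport ψ, x - t ∈ Ω) :
    fderiv ℝ (ψ ⋆[ContinuousLinearMap.lsmul ℝ ℝ] Ω.indicator p) x (basisVec i) =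
      (ψ ⋆[ContinuousLinearMap.lsmul ℝ ℝ] Ω.indicator q) x := by
  have hp' : LocallyIntegrable (Ω.indicator p) volume :=
    ((integrable_indicator_iff hΩ.measurableSet).2 hp).locallyIntegrable
  have hflip : ∀ f : Space d → ℝ, ψ ⋆[ContinuousLinearMap.lsmul ℝ ℝ] f =
      f ⋆[(ContinuousLinearMap.lsmul ℝ ℝ).flip] ψ := fun _ => (convolution_flip _).symm
  rw [hflip, hflip,
    (hψc.hasFDerivAt_convolution_right _ hp' (by simpa using contDiff_infty.1 hψ 1) x).fderiv,
    convolution_precompR_apply _ hp' (hψc.fderiv ℝ) (hψ.continuous_fderiv (by simp))]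
  simp only [convolution_def, ContinuousLinearMap.flip_apply, ContinuousLinearMap.lsmul_apply,
    smul_eq_mul]
  have hφ : ContDiff ℝ ∞ (fun s => ψ (x - s)) := hψ.comp (contDiff_const.sub contDiff_id)
  have hφc : HasCompactSupport (fun s => ψ (x - s)) :=
    hψc.comp_homeomorph (Homeomorph.subLeft x)
  -- The reflected kernel is supported inside Ω and is therefore an admissible test function,
  -- although p is extended by zero across Γ.
  have hφs : tsupport (fun s => ψ (x - s)) ⊆ Ω := by
    have : tsupport (fun s => ψ (x - s)) ⊆ (fun s => x - s) ⁻¹' tsupport ψ :=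
      closure_minimal (fun s hs => subset_tsupport ψ hs)
        ((isClosed_tsupport ψ).preimage (by fun_prop))
    intro s hs
    simpa using hx _ (this hs)
  have key := h.2.2 _ hφ hφc hφs
  simp_rw [fderiv_comp_const_sub' hψ] at key
  have e : ∀ (f g : Space d → ℝ), ∫ t, f t * Ω.indicator g t = ∫ t in Ω, g t * f t := fun f g => by
    rw [← integral_indicator hΩ.measurableSet]
    refine integral_congr_ae (Eventually.of_forall fun t => ?_)
    by_cases ht : t ∈ Ω <;> simp [ht, mul_comm]
  rw [e, e]
  simp only [mul_neg, integral_neg] at key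
  linarith

theorem hasCompactSupport_convolution_indicator (hΩ : Bornology.IsBounded Ω) {ψ p : Space d → ℝ}
    (hψc : HasCompactSupport ψ) :
    HasCompactSupport (ψ ⋆[ContinuousLinearMap.lsmul ℝ ℝ] Ω.indicator p) :=
  hψc.convolution _ (HasCompactSupport.intro hΩ.isCompact_closure fun _ hx =>
    indicator_of_notMem (fun h => hx (subset_closure h)) _)

namespace IsPatch

variable {U : Set (Space d)} {σ : Measure (Space d)} {n : Space d → Space d}

/-- The weak divergence of the localisation of a tangential solenoidal field. -/
theorem integral_localized_grad (P : IsPatch Ω U σ n) {χ : Space d → ℝ} (hχ : ContDiff ℝ ∞ χ)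
    (hχc : HasCompactSupport χ) (hχs : tsupport χ ⊆ U) {W gW : Fin (d + 2) → Space d → ℝ}
    {DW : Fin (d + 2) → Fin (d + 2) → Space d → ℝ}
    (hW : ∀ i, H1Trace Ω σ (W i) (DW i) (gW i)) (hWn : ∀ᵐ x ∂σ, ∑ i, gW i x * n x i = 0)
    (hdiv : ∀ᵐ x ∂(volume.restrict Ω), ∑ i, DW i i x = 0) {φ : Space d → ℝ}
    (hφ : ContDiff ℝ ∞ φ) (hφc : HasCompactSupport φ) :
    ∑ i, ∫ x in Ω, (χ x * W i x) * fderiv ℝ φ x (basisVec i) =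
      - ∑ i, ∫ x in Ω, fderiv ℝ χ x (basisVec i) * W i x * φ x := by
  have hfin := P.finite
  have hφt : H1Trace Ω σ φ (fun i x => fderiv ℝ φ x (basisVec i)) φ := H1Trace.of_smooth hφ hφc
  have hG := fun i => P.gauss_h1 hχ hχc hχs (hW i) hφt i
  have hb : ∑ i, ∫ x, (χ x * gW i x) * (n x i * φ x) ∂σ = 0 := by
    rw [← integral_finsetSum]
    · rw [integral_eq_zero_of_ae]
      filter_upwards [hWn] with x hx
      calc ∑ i, (χ x * gW i x) * (n x i * φ x) = (∑ i, gW i x * n x i) * (χ x * φ x) := by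
            rw [Finset.sum_mul]
            exact Finset.sum_congr rfl fun i _ => by ring
        _ = 0 := by rw [hx, zero_mul]
    · intro i _
      exact ((hW i).smul hχ hχc).memLp_trace.integrable_mul
        (hφt.smul (P.smooth_coord i) (P.compact_coord i)).memLp_trace
  obtain ⟨C, hC⟩ := continuous_bdd hχ.continuous hχc
  have i2 : ∀ i, Integrable (fun x => χ x * DW i i x * φ x) (volume.restrict Ω) := fun i =>
    integrable_mul_mul ((hW i).memLp_deriv i) hφt.memLp hχ.continuous.aestronglyMeasurable hC
  have hd : ∑ i, ∫ x in Ω, χ x * DW i i x * φ x = 0 := by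
    rw [← integral_finsetSum _ fun i _ => i2 i, integral_eq_zero_of_ae]
    filter_upwards [hdiv] with x hx
    rw [← Finset.sum_mul, ← Finset.mul_sum, hx]
    simp
  have hs : ∀ i, (∫ x in Ω, (fderiv ℝ χ x (basisVec i) * W i x + χ x * DW i i x) * φ x) =
      (∫ x in Ω, fderiv ℝ χ x (basisVec i) * W i x * φ x) + ∫ x in Ω, χ x * DW i i x * φ x :=
    fun i => by
      obtain ⟨C', hC'⟩ := continuous_bdd (contDiff_fderiv_apply hχ (basisVec i)).continuous
        (hasCompactSupport_fderiv_apply hχc _)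
      rw [← integral_add _ (i2 i)]
      · simp_rw [add_mul]
      · exact integrable_mul_mul (hW i).memLp hφt.memLp
          (contDiff_fderiv_apply hχ _).continuous.aestronglyMeasurable hC'
  have := Finset.sum_congr rfl fun i (_ : i ∈ Finset.univ) => hG i
  rw [hb, Finset.sum_add_distrib] at this
  simp_rw [hs] at this
  rw [Finset.sum_add_distrib, hd, add_zero] at this
  linarith

/-- The localised orthogonality of gradients and tangential solenoidal fields. -/
theorem integral_localized_weak_grad (P : IsPatch Ω U σ n) (hΩ : IsOpen Ω)
    (hΩb : Bornology.IsBounded Ω) {χ : Space d → ℝ} (hχ : ContDiff ℝ ∞ χ)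
    (hχc : HasCompactSupport χ) (hχs : tsupport χ ⊆ U) {W gW : Fin (d + 2) → Space d → ℝ}
    {DW : Fin (d + 2) → Fin (d + 2) → Space d → ℝ}
    (hW : ∀ i, H1Trace Ω σ (W i) (DW i) (gW i)) (hWn : ∀ᵐ x ∂σ, ∑ i, gW i x * n x i = 0)
    (hdiv : ∀ᵐ x ∂(volume.restrict Ω), ∑ i, DW i i x = 0) {p : Space d → ℝ}
    {q : Fin (d + 2) → Space d → ℝ} (hp : MemLp p 2 (volume.restrict Ω))
    (hq : ∀ i, MemLp (q i) 2 (volume.restrict Ω)) (hpq : ∀ i, HasWeakPartial Ω i p (q i)) :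
    ∑ i, ∫ x in Ω, (χ x * W i x) * q i x =
      - ∑ i, ∫ x in Ω, fderiv ℝ χ x (basisVec i) * W i x * p x := by
  have hfin := P.finite
  have : IsFiniteMeasure (volume.restrict Ω) := ⟨by simpa using hΩb.measure_lt_top⟩
  -- The zero extension of p jumps across Γ, but the mollification is smooth on the whole space, and
  -- on the part of Ω in the support of χ its gradient is the mollified q. The identity for smooth
  -- functions then passes to the limit.
  obtain ⟨e, δ, hδ, hcone⟩ := P.cone
  choose! ψ h1 h2 h3 h4 h5 using fun (ε : ℝ) (hε : 0 < ε) => exists_kernel e hδ hε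
  have hpos : ∀ᶠ ε : ℝ in 𝓝[>] 0, 0 < ε := self_mem_nhdsWithin
  have ext : ∀ {f : Space d → ℝ}, MemLp f 2 (volume.restrict Ω) → MemLp (Ω.indicator f) 2 volume :=
    fun hf => (memLp_indicator_iff_restrict hΩ.measurableSet).2 hf
  have lim : ∀ {f m : Space d → ℝ}, MemLp f 2 (volume.restrict Ω) → MemLp m 2 (volume.restrict Ω) →
      Tendsto (fun ε => ∫ x in Ω, m x * (ψ ε ⋆[ContinuousLinearMap.lsmul ℝ ℝ] Ω.indicator f) x)
        (𝓝[>] 0) (𝓝 (∫ x in Ω, m x * f x)) := fun {f m} hf hm => by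
    have := tendsto_integral_mul_convolution (ext hf) (ext hm) e δ (fun ε hε => (h1 ε hε).continuous)
      h2 h3 h4 h5
    have e1 : ∀ g : Space d → ℝ, ∫ x, Ω.indicator m x * g x = ∫ x in Ω, m x * g x := fun g => by
      rw [← integral_indicator hΩ.measurableSet]
      refine integral_congr_ae (Eventually.of_forall fun t => ?_)
      by_cases ht : t ∈ Ω <;> simp [ht]
    rw [e1, setIntegral_congr_fun (g := fun x => m x * f x) hΩ.measurableSet
      fun x hx => by simp [indicator_of_mem hx]] at this
    simpa only [e1] using this
  have l1 := tendsto_finsetSum Finset.univ fun i (_ : i ∈ Finset.univ) =>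
    lim (hq i) ((hW i).smul hχ hχc).memLp
  have l2 := (tendsto_finsetSum Finset.univ fun i (_ : i ∈ Finset.univ) =>
    lim hp ((hW i).smul (contDiff_fderiv_apply hχ (basisVec i))
      (hasCompactSupport_fderiv_apply hχc _)).memLp).neg
  refine tendsto_nhds_unique_of_eventuallyEq l1 l2 ?_
  filter_upwards [hpos, hcone _ hχs hχc] with ε hε hK
  have hsm : ContDiff ℝ ∞ (ψ ε ⋆[ContinuousLinearMap.lsmul ℝ ℝ] Ω.indicator p) := by
    refine (h2 ε hε).contDiff_convolution_left _ (h1 ε hε) ?_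
    exact ((integrable_indicator_iff hΩ.measurableSet).2
      (hp.integrable (by norm_num))).locallyIntegrable
  rw [← P.integral_localized_grad hχ hχc hχs hW hWn hdiv hsm
    (hasCompactSupport_convolution_indicator hΩb (h2 ε hε))]
  refine Finset.sum_congr rfl fun i _ => setIntegral_congr_fun hΩ.measurableSet fun x hx => ?_
  by_cases hxs : x ∈ tsupport χ
  · rw [(hpq i).fderiv_convolution hΩ (hp.integrable (by norm_num)) (h1 ε hε) (h2 ε hε)]
    intro t ht
    obtain ⟨y, hy, rfl⟩ := h5 ε hε t ht
    rw [sub_neg_eq_add]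
    exact hK x ⟨hxs, subset_closure hx⟩ y hy
  · rw [image_eq_zero_of_notMem_tsupport hxs]
    ring

end IsPatch

namespace PatchCover

variable {W gW : Fin (d + 2) → Space d → ℝ} {DW : Fin (d + 2) → Fin (d + 2) → Space d → ℝ}

theorem ae_sum_normal (κ : PatchCover Ω) {g : Fin (d + 2) → Space d → ℝ}
    (hg : ∀ᵐ x ∂(surfaceMeasure Ω), ∀ ν, IsOutwardNormal Ω x ν → ∑ i, g i x * ν i = 0)
    (k : Fin κ.N) : ∀ᵐ x ∂(κ.σ k), ∑ i, g i x * κ.n k x i = 0 := by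
  filter_upwards [κ.ae_of_ae_surface hg k, (κ.isPatch k).normal] with x hx hxn using hx _ hxn.2

/-- Tangential solenoidal fields are orthogonal to gradients. -/
theorem integral_weak_grad_eq_zero (κ : PatchCover Ω) (hΩ : IsOpen Ω) (hΩb : Bornology.IsBounded Ω)
    (hW : ∀ i, H1Trace Ω (surfaceMeasure Ω) (W i) (DW i) (gW i))
    (hWn : ∀ᵐ x ∂(surfaceMeasure Ω), ∀ ν, IsOutwardNormal Ω x ν → ∑ i, gW i x * ν i = 0)
    (hdiv : ∀ᵐ x ∂(volume.restrict Ω), ∑ i, DW i i x = 0) {p : Space d → ℝ}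
    {q : Fin (d + 2) → Space d → ℝ} (hp : MemLp p 2 (volume.restrict Ω))
    (hq : ∀ i, MemLp (q i) 2 (volume.restrict Ω)) (hpq : ∀ i, HasWeakPartial Ω i p (q i)) :
    ∑ i, ∫ x in Ω, W i x * q i x = 0 := by
  have key := Finset.sum_congr rfl fun k (_ : k ∈ Finset.univ) =>
    (κ.isPatch k).integral_localized_weak_grad hΩ hΩb (κ.smooth k) (κ.compact k)
      (κ.tsupport_subset k) (fun i => κ.h1Trace (hW i) k) (κ.ae_sum_normal hWn k) hdiv hp hq hpq
  rw [Finset.sum_neg_distrib, Finset.sum_comm, Finset.sum_comm (f := fun k i =>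
    ∫ x in Ω, fderiv ℝ (κ.χ k) x (basisVec i) * W i x * p x)] at key
  -- The two sides are the special cases A = 0 and B = 0 of `integral_sum_cover`; in the second the
  -- derivatives of the cut-offs sum to zero.
  have e1 : ∀ i, ∑ k, ∫ x in Ω, (κ.χ k x * W i x) * q i x = ∫ x in Ω, W i x * q i x := fun i => by
    have := κ.integral_sum_cover hΩ i (A := fun _ => 0) (hA := MemLp.zero') (hW i).memLp (hq i)
    simpa using this
  have e2 : ∀ i, ∑ k, ∫ x in Ω, fderiv ℝ (κ.χ k) x (basisVec i) * W i x * p x = 0 := fun i => by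
    have := κ.integral_sum_cover hΩ i (B := fun _ => 0) (hB := MemLp.zero') (hA := (hW i).memLp) hp
    simpa using this
  simpa only [e1, e2, Finset.sum_const_zero, neg_zero] using key

/-- Tangential solenoidal fields are orthogonal to gradients of smooth functions. -/
theorem integral_grad_eq_zero (κ : PatchCover Ω) (hΩ : IsSmoothBoundedDomain Ω)
    (hW : ∀ i, H1Trace Ω (surfaceMeasure Ω) (W i) (DW i) (gW i))
    (hWn : ∀ᵐ x ∂(surfaceMeasure Ω), ∀ ν, IsOutwardNormal Ω x ν → ∑ i, gW i x * ν i = 0)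
    (hdiv : ∀ᵐ x ∂(volume.restrict Ω), ∑ i, DW i i x = 0) {φ : Space d → ℝ}
    (hφ : ContDiff ℝ ∞ φ) (hφc : HasCompactSupport φ) :
    ∑ i, ∫ x in Ω, W i x * fderiv ℝ φ x (basisVec i) = 0 := by
  refine κ.integral_weak_grad_eq_zero hΩ.isOpen hΩ.isBounded hW hWn hdiv
    (memLp_of_continuous hφ.continuous hφc _)
    (fun i => memLp_of_continuous (contDiff_fderiv_apply hφ _).continuous
      (hasCompactSupport_fderiv_apply hφc _) _) fun i =>
    ⟨hφ.continuous.locallyIntegrable.locallyIntegrableOn _,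
      (contDiff_fderiv_apply hφ _).continuous.locallyIntegrable.locallyIntegrableOn _,
      fun θ hθ hθc hθs => ?_⟩
  have h1 : ∀ x ∉ Ω, φ x * fderiv ℝ θ x (basisVec i) = 0 := fun x hx => by
    rw [fderiv_apply_eq_zero (fun h => hx (hθs h)), mul_zero]
  have h2 : ∀ x ∉ Ω, fderiv ℝ φ x (basisVec i) * θ x = 0 := fun x hx => by
    rw [image_eq_zero_of_notMem_tsupport (fun h => hx (hθs h)), mul_zero]
  rw [setIntegral_eq_integral_of_forall_compl_eq_zero h1,
    setIntegral_eq_integral_of_forall_compl_eq_zero h2]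
  have h3 := integral_fderiv_eq_zero (hφ.mul hθ) hφc.mul_right (basisVec i)
  simp_rw [fun x => fderiv_mul_apply' (differentiableAt_of_smooth hφ (x := x))
    (differentiableAt_of_smooth hθ) (basisVec i)] at h3
  rw [integral_add] at h3
  · linarith
  · exact ((contDiff_fderiv_apply hφ _).continuous.mul hθ.continuous).integrable_of_hasCompactSupport
      hθc.mul_left
  · exact (hφ.continuous.mul (contDiff_fderiv_apply hθ _).continuous).integrable_of_hasCompactSupport
      hφc.mul_right

end PatchCover

/-! ### The convection term -/

/-- A bounded regularisation of the identity. -/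
def regId (δ s : ℝ) : ℝ := s / (1 + δ * s ^ 2)

/-- The primitive of `regId`. -/
def regSq (δ s : ℝ) : ℝ := Real.log (1 + δ * s ^ 2) / (2 * δ)

theorem one_add_mul_sq_pos {δ : ℝ} (hδ : 0 < δ) (s : ℝ) : 0 < 1 + δ * s ^ 2 := by positivity

theorem contDiff_regSq {δ : ℝ} (hδ : 0 < δ) : ContDiff ℝ ∞ (regSq δ) := by
  unfold regSq
  refine ContDiff.div_const (ContDiff.log (by fun_prop) fun s => ?_) _
  exact (one_add_mul_sq_pos hδ s).ne'

theorem hasDerivAt_regSq {δ : ℝ} (hδ : 0 < δ) (s : ℝ) : HasDerivAt (regSq δ) (regId δ s) s := by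
  have h1 : HasDerivAt (fun s : ℝ => 1 + δ * s ^ 2) (δ * (2 * s)) s := by
    simpa using ((hasDerivAt_pow 2 s).const_mul δ).const_add 1
  have h2 := (h1.log (one_add_mul_sq_pos hδ s).ne').div_const (2 * δ)
  refine h2.congr_deriv ?_
  rw [regId]
  field_simp

theorem continuous_regId {δ : ℝ} (hδ : 0 < δ) : Continuous (regId δ) := by
  unfold regId
  exact continuous_id.div (by fun_prop) fun s => (one_add_mul_sq_pos hδ s).ne'

theorem abs_regId_le {δ : ℝ} (hδ : 0 < δ) (s : ℝ) : |regId δ s| ≤ |s| := by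
  rw [regId, abs_div, abs_of_pos (one_add_mul_sq_pos hδ s)]
  exact div_le_self (abs_nonneg _) (by nlinarith [mul_nonneg hδ.le (sq_nonneg s)])

theorem abs_regId_le' {δ : ℝ} (hδ : 0 < δ) (s : ℝ) : |regId δ s| ≤ 1 + δ⁻¹ := by
  rw [regId, abs_div, abs_of_pos (one_add_mul_sq_pos hδ s), div_le_iff₀ (one_add_mul_sq_pos hδ s)]
  have e : (1 + δ⁻¹) * (1 + δ * s ^ 2) = 1 + δ⁻¹ + δ * s ^ 2 + s ^ 2 := by
    field_simp
    ring
  rw [e]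
  have h1 : 0 < δ⁻¹ := inv_pos.2 hδ
  have h2 : 0 ≤ δ * s ^ 2 := by positivity
  have h3 := sq_nonneg (|s| - 1)
  have h4 := sq_abs s
  nlinarith

theorem tendsto_regId (s : ℝ) :
    Tendsto (fun n : ℕ => regId (1 / ((n : ℝ) + 1)) s) atTop (𝓝 s) := by
  have h : Tendsto (fun n : ℕ => 1 + 1 / ((n : ℝ) + 1) * s ^ 2) atTop (𝓝 1) := by
    simpa using (tendsto_one_div_add_atTop_nhds_zero_nat (𝕜 := ℝ)).mul_const (s ^ 2) |>.const_add 1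
  have := (tendsto_const_nhds (x := s)).div h one_ne_zero
  rwa [div_one] at this

theorem L2Lim.mul_bdd_seq {α : Type*} [MeasurableSpace α] {μ : Measure α} {φ : ℕ → α → ℝ}
    (h : L2Lim μ φ fun _ => 0) {c : ℕ → α → ℝ} (hc : ∀ k, AEStronglyMeasurable (c k) μ) {C : ℝ}
    (hC : ∀ k x, |c k x| ≤ C) : L2Lim μ (fun k x => c k x * φ k x) fun _ => 0 := by
  refine ⟨MemLp.zero', fun k => (h.memLp_seq k).of_le_mul (c := C) ((hc k).mul (h.memLp_seq k).1)
    (Eventually.of_forall fun x => ?_), ?_⟩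
  · rw [norm_mul]
    exact mul_le_mul_of_nonneg_right (hC k x) (norm_nonneg _)
  have h0 : Tendsto (fun k => ENNReal.ofReal C * eLpNorm (φ k - fun _ => 0) 2 μ) atTop (𝓝 0) := by
    simpa using ENNReal.Tendsto.const_mul h.tendsto (Or.inr ENNReal.ofReal_ne_top)
  refine tendsto_of_tendsto_of_tendsto_of_le_of_le tendsto_const_nhds h0 (fun _ => zero_le) fun k => ?_
  refine eLpNorm_le_mul_eLpNorm_of_ae_le_mul (Eventually.of_forall fun x => ?_) 2
  simp only [Pi.sub_apply, sub_zero]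
  rw [norm_mul]
  exact mul_le_mul_of_nonneg_right (hC k x) (norm_nonneg _)

theorem L2Lim.comp {α : Type*} [MeasurableSpace α] {μ : Measure α} {φ : ℕ → α → ℝ} {f : α → ℝ}
    (h : L2Lim μ φ f) {r : ℕ → ℕ} (hr : Tendsto r atTop atTop) :
    L2Lim μ (fun k => φ (r k)) f :=
  ⟨h.memLp, fun k => h.memLp_seq (r k), h.tendsto.comp hr⟩

theorem L2Lim.exists_seq_ae {α : Type*} [MeasurableSpace α] {μ : Measure α} {φ : ℕ → α → ℝ}
    {f : α → ℝ} (h : L2Lim μ φ f) : ∃ r : ℕ → ℕ, Tendsto r atTop atTop ∧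
      ∀ᵐ x ∂μ, Tendsto (fun k => φ (r k) x) atTop (𝓝 (f x)) := by
  obtain ⟨r, hr, hae⟩ := (tendstoInMeasure_of_tendsto_eLpNorm (by norm_num)
    (fun k => (h.memLp_seq k).1) h.memLp.1 h.tendsto).exists_seq_tendsto_ae
  exact ⟨r, hr.tendsto_atTop, hae⟩

/-- Convergence of `v ζ_k ∂φ_k` when `ζ_k` is bounded and converges almost everywhere. -/
theorem L2Lim.tendsto_integral_mul_mul {α : Type*} [MeasurableSpace α] {μ : Measure α}
    {φ : ℕ → α → ℝ} {f v : α → ℝ} (h : L2Lim μ φ f) (hv : MemLp v 2 μ) {c : ℕ → α → ℝ} {c₀ : α → ℝ}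
    (hc : ∀ k, AEStronglyMeasurable (c k) μ) {C : ℝ} (hC : ∀ k x, |c k x| ≤ C)
    (hlim : ∀ᵐ x ∂μ, Tendsto (fun k => c k x) atTop (𝓝 (c₀ x))) :
    Tendsto (fun k => ∫ x, c k x * φ k x * v x ∂μ) atTop (𝓝 (∫ x, c₀ x * f x * v x ∂μ)) := by
  have h1 : L2Lim μ (fun k x => φ k x - f x) fun _ => 0 :=
    (h.sub (L2Lim.const h.memLp)).congr (fun _ => ae_eq_rfl) (by simp)
  have h2 := (h1.mul_bdd_seq hc hC).integral_mul (L2Lim.const hv)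
  have h3 : Tendsto (fun k => ∫ x, c k x * f x * v x ∂μ) atTop (𝓝 (∫ x, c₀ x * f x * v x ∂μ)) := by
    refine tendsto_integral_of_dominated_convergence (fun x => C * |f x * v x|)
      (fun k => ((hc k).mul h.memLp.1).mul hv.1) ((h.memLp.integrable_mul hv).abs.const_mul C)
      (fun k => Eventually.of_forall fun x => ?_) ?_
    · rw [mul_assoc, norm_mul]
      exact mul_le_mul_of_nonneg_right (hC k x) (norm_nonneg _)
    · filter_upwards [hlim] with x hx
      exact (hx.mul_const _).mul_const _
  have h4 := h2.add h3
  simp only [zero_mul, integral_zero, zero_add] at h4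
  refine h4.congr fun k => ?_
  rw [← integral_add]
  · refine integral_congr_ae (Eventually.of_forall fun x => ?_)
    simp only
    ring
  · exact ((h1.mul_bdd_seq hc hC).memLp_seq k).integrable_mul hv
  · exact integrable_mul_mul h.memLp hv (hc k) (hC k)

namespace PatchCover

variable {Ω : Set (Space d)}
variable {W gW : Fin (d + 2) → Space d → ℝ} {DW : Fin (d + 2) → Fin (d + 2) → Space d → ℝ}

/-- `regId δ f` times the gradient of f is the gradient of `regSq δ f`, to which W is orthogonal.
The regularisation is needed because W, f and the gradient of f are each only in L², so their
product need not be integrable. In the limit of smooth approximants, boundedness of `regId` and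
convergence almost everywhere along a subsequence suffice. -/
theorem integral_convection_regId (κ : PatchCover Ω) (hΩ : IsSmoothBoundedDomain Ω)
    (hW : ∀ i, H1Trace Ω (surfaceMeasure Ω) (W i) (DW i) (gW i))
    (hWn : ∀ᵐ x ∂(surfaceMeasure Ω), ∀ ν, IsOutwardNormal Ω x ν → ∑ i, gW i x * ν i = 0)
    (hdiv : ∀ᵐ x ∂(volume.restrict Ω), ∑ i, DW i i x = 0) {f g : Space d → ℝ}
    {Df : Fin (d + 2) → Space d → ℝ} (h : H1Trace Ω (surfaceMeasure Ω) f Df g) {δ : ℝ}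
    (hδ : 0 < δ) :
    ∑ i, ∫ x in Ω, regId δ (f x) * Df i x * W i x = 0 := by
  obtain ⟨φ, h1, h2, h3, h4, -⟩ := h
  obtain ⟨r, hr, hae⟩ := h3.exists_seq_ae
  have hsm : ∀ k, ContDiff ℝ ∞ (fun x => regSq δ (φ k x)) := fun k => (contDiff_regSq hδ).comp (h1 k)
  have hcs : ∀ k, HasCompactSupport (fun x => regSq δ (φ k x)) := fun k =>
    (h2 k).comp_left (g := regSq δ) (by simp [regSq])
  have hder : ∀ k x i, fderiv ℝ (fun x => regSq δ (φ k x)) x (basisVec i) =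
      regId δ (φ k x) * fderiv ℝ (φ k) x (basisVec i) := fun k x i => by
    have := (hasDerivAt_regSq hδ (φ k x)).comp_hasFDerivAt x (differentiableAt_of_smooth (h1 k)).hasFDerivAt
    change HasFDerivAt (fun x => regSq δ (φ k x)) _ x at this
    rw [this.fderiv]
    simp
  have lim := tendsto_finsetSum Finset.univ fun i (_ : i ∈ Finset.univ) =>
    ((h4 i).comp hr).tendsto_integral_mul_mul (hW i).memLp
      (c := fun k x => regId δ (φ (r k) x)) (c₀ := fun x => regId δ (f x)) (C := 1 + δ⁻¹)
      (fun k => ((continuous_regId hδ).comp (h1 _).continuous).aestronglyMeasurable)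
      (fun k x => abs_regId_le' hδ _)
      (hae.mono fun x hx => ((continuous_regId hδ).tendsto _).comp hx)
  refine tendsto_nhds_unique lim (tendsto_const_nhds.congr fun k => ?_)
  rw [← κ.integral_grad_eq_zero hΩ hW hWn hdiv (hsm (r k)) (hcs (r k))]
  simp_rw [hder]
  refine Finset.sum_congr rfl fun i _ => integral_congr_ae (Eventually.of_forall fun x => ?_)
  simp only
  ring

/-- The convection term is orthogonal to the convected field. -/
theorem integral_convection_eq_zero (κ : PatchCover Ω) (hΩ : IsSmoothBoundedDomain Ω)
    (hW : ∀ i, H1Trace Ω (surfaceMeasure Ω) (W i) (DW i) (gW i))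
    (hWn : ∀ᵐ x ∂(surfaceMeasure Ω), ∀ ν, IsOutwardNormal Ω x ν → ∑ i, gW i x * ν i = 0)
    (hdiv : ∀ᵐ x ∂(volume.restrict Ω), ∑ i, DW i i x = 0) {f g : Space d → ℝ}
    {Df : Fin (d + 2) → Space d → ℝ} (h : H1Trace Ω (surfaceMeasure Ω) f Df g)
    (hc : MemLp (fun x => ∑ i, W i x * Df i x) 2 (volume.restrict Ω)) :
    ∫ x in Ω, (∑ i, W i x * Df i x) * f x = 0 := by
  have hf := h.memLp
  have hδ : ∀ n : ℕ, (0 : ℝ) < 1 / ((n : ℝ) + 1) := fun n => by positivity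
  -- Since |regId| is at most |f|, the truncation is removed by dominated convergence; the square
  -- integrability of W·∇f makes the majorant integrable.
  have lim : Tendsto (fun n : ℕ => ∫ x in Ω, (∑ i, W i x * Df i x) * regId (1 / ((n : ℝ) + 1)) (f x))
      atTop (𝓝 (∫ x in Ω, (∑ i, W i x * Df i x) * f x)) := by
    refine tendsto_integral_of_dominated_convergence (fun x => |(∑ i, W i x * Df i x) * f x|)
      (fun n => hc.1.mul ((continuous_regId (hδ n)).comp_aestronglyMeasurable hf.1))
      (hc.integrable_mul hf).abs (fun n => Eventually.of_forall fun x => ?_)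
      (Eventually.of_forall fun x => (tendsto_regId (f x)).const_mul _)
    rw [norm_mul, abs_mul]
    exact mul_le_mul_of_nonneg_left (abs_regId_le (hδ n) _) (norm_nonneg _)
  refine tendsto_nhds_unique lim (tendsto_const_nhds.congr fun n => ?_)
  rw [← κ.integral_convection_regId hΩ hW hWn hdiv h (hδ n), ← integral_finsetSum]
  · refine integral_congr_ae (Eventually.of_forall fun x => ?_)
    simp only
    rw [Finset.sum_mul]
    exact Finset.sum_congr rfl fun i _ => by ring
  · intro i _
    have := (((h.memLp_deriv i).integrable_mul (hW i).memLp)).bdd_mul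
      ((continuous_regId (hδ n)).comp_aestronglyMeasurable hf.1)
      (Eventually.of_forall fun x => abs_regId_le' (hδ n) (f x))
    refine this.congr (Eventually.of_forall fun x => ?_)
    simp only [Pi.mul_apply]
    ring

end PatchCover

/-! ### The static estimate for the viscous term -/

theorem integrable_mul_of_memLp {α : Type*} [MeasurableSpace α] {μ : Measure α} {f g : α → ℝ}
    (hf : MemLp f 2 μ) (hg : MemLp g 2 μ) : Integrable (fun x => f x * g x) μ :=
  hf.integrable_mul hg

/-- The squared `L²` norm of a field. -/
def l2Sq (Ω : Set (Space d)) (u : Space d → Space d) : ℝ := ∑ i, ∫ x in Ω, u x i ^ 2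

/-- The squared `L²` norm of a matrix field. -/
def gradSq (Ω : Set (Space d)) (G : Space d → Fin (d + 2) → Fin (d + 2) → ℝ) : ℝ :=
  ∑ i, ∑ j, ∫ x in Ω, G x i j ^ 2

theorem l2Sq_nonneg (Ω : Set (Space d)) (u : Space d → Space d) : 0 ≤ l2Sq Ω u :=
  Finset.sum_nonneg fun _ _ => integral_nonneg fun _ => sq_nonneg _

theorem gradSq_nonneg (Ω : Set (Space d)) (G : Space d → Fin (d + 2) → Fin (d + 2) → ℝ) :
    0 ≤ gradSq Ω G :=
  Finset.sum_nonneg fun _ _ => Finset.sum_nonneg fun _ _ => integral_nonneg fun _ => sq_nonneg _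

/-- `u` is a solenoidal field of class `H¹` with gradient `G` and tangential trace `g`. -/
structure Solenoidal (Ω : Set (Space d)) (u : Space d → Space d)
    (G : Space d → Fin (d + 2) → Fin (d + 2) → ℝ) (g : Space d → Space d) : Prop where
  h1 : ∀ j, H1Trace Ω (surfaceMeasure Ω) (fun x => u x j) (fun i x => G x i j) (fun x => g x j)
  normal : ∀ᵐ x ∂(surfaceMeasure Ω), ∀ ν, IsOutwardNormal Ω x ν → ∑ i, g x i * ν i = 0
  div : ∀ᵐ x ∂(volume.restrict Ω), ∑ i, G x i i = 0

namespace Solenoidal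

variable {Ω : Set (Space d)} {u v g g' : Space d → Space d}
  {G G' : Space d → Fin (d + 2) → Fin (d + 2) → ℝ}

theorem sub (h : Solenoidal Ω u G g) (h' : Solenoidal Ω v G' g') :
    Solenoidal Ω (u - v) (fun x i j => G x i j - G' x i j) (g - g') := by
  refine ⟨fun j => (h.h1 j).sub (h'.h1 j), ?_, ?_⟩
  · filter_upwards [h.normal, h'.normal] with x h1 h2 ν hν
    simp only [Pi.sub_apply, PiLp.sub_apply, sub_mul, Finset.sum_sub_distrib, h1 ν hν, h2 ν hν,
      sub_zero]
  · filter_upwards [h.div, h'.div] with x h1 h2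
    rw [Finset.sum_sub_distrib, h1, h2, sub_zero]

theorem memLp (h : Solenoidal Ω u G g) (j : Fin (d + 2)) :
    MemLp (fun x => u x j) 2 (volume.restrict Ω) := (h.h1 j).memLp

theorem memLp_grad (h : Solenoidal Ω u G g) (i j : Fin (d + 2)) :
    MemLp (fun x => G x i j) 2 (volume.restrict Ω) := (h.h1 j).memLp_deriv i

/-- The null form of two solenoidal fields. -/
theorem nullForm_eq (h : Solenoidal Ω u G g) (h' : Solenoidal Ω v G' g') :
    nullForm Ω (fun i j x => G x j i) (fun i j x => G' x j i) =
      ∑ i, ∑ j, ∫ x in Ω, G x j i * G' x i j := by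
  simp only [nullForm, Finset.sum_sub_distrib]
  have : ∑ i, ∑ j, ∫ x in Ω, G x i i * G' x j j = 0 := by
    refine Finset.sum_eq_zero fun i _ => ?_
    rw [← integral_finsetSum _ fun j _ => integrable_mul_of_memLp (h.memLp_grad i i) (h'.memLp_grad j j)]
    rw [integral_eq_zero_of_ae]
    filter_upwards [h'.div] with x hx
    rw [← Finset.mul_sum, hx, mul_zero]
    rfl
  rw [this, sub_zero]

end Solenoidal

/-- The divergence of the transposed gradient of a solenoidal field vanishes. -/
theorem HasWeakHessian.sum_eq_zero {Ω : Set (Space d)} (hΩ : IsOpen Ω)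
    (hΩb : Bornology.IsBounded Ω) {u : Space d → Space d}
    {G : Space d → Fin (d + 2) → Fin (d + 2) → ℝ}
    {H : Space d → Fin (d + 2) → Fin (d + 2) → Fin (d + 2) → ℝ} (hG : HasWeakGradient Ω u G)
    (hH : HasWeakHessian Ω G H) (hG2 : ∀ i j, MemLp (fun x => G x i j) 2 (volume.restrict Ω))
    (hH2 : ∀ k i j, MemLp (fun x => H x k i j) 2 (volume.restrict Ω))
    (hdiv : ∀ᵐ x ∂(volume.restrict Ω), ∑ i, G x i i = 0) (k : Fin (d + 2)) :
    ∀ᵐ x ∂(volume.restrict Ω), ∑ i, H x i k i = 0 := by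
  have : IsFiniteMeasure (volume.restrict Ω) := ⟨by simpa using hΩb.measure_lt_top⟩
  have h0 : LocallyIntegrableOn (fun _ : Space d => (0 : ℝ)) Ω volume :=
    (integrable_zero _ _ _).integrableOn.locallyIntegrableOn
  have hS : IntegrableOn (fun x => ∑ i, H x i k i) Ω :=
    integrable_finsetSum _ fun i _ => (hH2 i k i).integrable (by norm_num)
  have hmul : ∀ {f φ : Space d → ℝ}, MemLp f 2 (volume.restrict Ω) → ContDiff ℝ ∞ φ →
      HasCompactSupport φ → Integrable (fun x => f x * φ x) (volume.restrict Ω) :=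
    fun hf hφ hφc => hf.integrable_mul (memLp_of_continuous hφ.continuous hφc _)
  -- The sum is exhibited as a weak derivative of the zero function, so uniqueness of weak
  -- derivatives makes it vanish.
  refine HasWeakPartial.ae_eq (i := k) (f := fun _ => 0) (g' := fun _ => 0) hΩ
    ⟨h0, hS.locallyIntegrableOn, fun φ hφ hφc hφs => ?_⟩ ⟨h0, h0, by simp⟩
  -- Both derivatives are moved to the test function, exchanged there, and one is moved back, which
  -- leaves the divergence tested with ∂_k φ.
  have e1 : ∀ i, ∫ x in Ω, H x i k i * φ x =
      - ∫ x in Ω, G x i i * fderiv ℝ φ x (basisVec k) := fun i => by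
    have a1 := (hH i k i).2.2 φ hφ hφc hφs
    have a2 := (hG k i).2.2 _ (contDiff_fderiv_apply hφ (basisVec i))
      (hasCompactSupport_fderiv_apply hφc _) (tsupport_fderiv_apply_subset.trans hφs)
    have a3 := (hG i i).2.2 _ (contDiff_fderiv_apply hφ (basisVec k))
      (hasCompactSupport_fderiv_apply hφc _) (tsupport_fderiv_apply_subset.trans hφs)
    simp_rw [fun x => fderiv_fderiv_comm hφ x (basisVec i) (basisVec k)] at a2
    linarith
  have e2 : ∫ x in Ω, (∑ i, H x i k i) * φ x = 0 := by
    simp_rw [Finset.sum_mul]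
    rw [integral_finsetSum _ fun i _ => hmul (hH2 i k i) hφ hφc]
    simp_rw [e1]
    rw [Finset.sum_neg_distrib, ← integral_finsetSum _ fun i _ => hmul (hG2 i i)
      (contDiff_fderiv_apply hφ _) (hasCompactSupport_fderiv_apply hφc _), integral_eq_zero_of_ae,
      neg_zero]
    filter_upwards [hdiv] with x hx
    rw [← Finset.sum_mul, hx, zero_mul]
    rfl
  rw [e2]
  simp

namespace PatchCover

variable {Ω : Set (Space d)} {u v w g g' gw : Space d → Space d}
  {G G' Gw : Space d → Fin (d + 2) → Fin (d + 2) → ℝ}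
  {H : Space d → Fin (d + 2) → Fin (d + 2) → Fin (d + 2) → ℝ}
  {gG : Space d → Fin (d + 2) → Fin (d + 2) → ℝ}

/-- The vorticity boundary term. -/
def bndVort (κ : PatchCover Ω) (gG : Space d → Fin (d + 2) → Fin (d + 2) → ℝ)
    (gw : Space d → Space d) : ℝ :=
  ∑ i, ∑ j, ∑ k, ∫ x, (κ.χ k x * (gG x i j - gG x j i)) * (κ.n k x i * gw x j) ∂(κ.σ k)

/-- Green's formula for the Laplacian in terms of the vorticity. -/
theorem integral_laplacian (κ : PatchCover Ω) (hΩ : IsOpen Ω) (hv : Solenoidal Ω v G g)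
    (hw : Solenoidal Ω w Gw gw)
    (hG : ∀ i j, H1Trace Ω (surfaceMeasure Ω) (fun x => G x i j) (fun k x => H x k i j)
      (fun x => gG x i j))
    (hH : ∀ j, ∀ᵐ x ∂(volume.restrict Ω), ∑ i, H x i j i = 0) :
    ∫ x in Ω, ∑ j, (∑ i, H x i i j) * w x j =
      - (∑ i, ∑ j, ∫ x in Ω, G x i j * Gw x i j)
        + nullForm Ω (fun i j x => G x j i) (fun i j x => Gw x j i) + κ.bndVort gG gw := by
  have hG2 := hv.memLp_grad
  have hH2 : ∀ k i j, MemLp (fun x => H x k i j) 2 (volume.restrict Ω) := fun k i j =>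
    (hG i j).memLp_deriv k
  have hgauss := fun i j => κ.gauss_h1 hΩ ((hG i j).sub (hG j i)) (hw.h1 j) i
  -- The subtracted terms sum to the derivatives of the divergence and vanish. They turn the
  -- Laplacian into the divergence of the antisymmetric gradient, so that Gauss' theorem produces
  -- the vorticity on Γ.
  have e1 : ∫ x in Ω, ∑ j, (∑ i, H x i i j) * w x j =
      ∑ i, ∑ j, ∫ x in Ω, (H x i i j - H x i j i) * w x j := by
    rw [Finset.sum_comm]
    have hi : ∀ i j, Integrable (fun x => (H x i i j - H x i j i) * w x j) (volume.restrict Ω) :=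
      fun i j => ((hH2 i i j).sub (hH2 i j i)).integrable_mul (hw.memLp j)
    simp_rw [← fun j => integral_finsetSum Finset.univ fun i (_ : i ∈ Finset.univ) => hi i j]
    rw [← integral_finsetSum _ fun j _ => integrable_finsetSum _ fun i _ => hi i j]
    refine integral_congr_ae ?_
    filter_upwards [ae_all_iff.2 hH] with x hx
    refine Finset.sum_congr rfl fun j _ => ?_
    rw [← Finset.sum_mul, Finset.sum_sub_distrib, hx j, sub_zero]
  have e2 : ∀ i j, ∫ x in Ω, (G x i j - G x j i) * Gw x i j =
      (∫ x in Ω, G x i j * Gw x i j) - ∫ x in Ω, G x j i * Gw x i j := fun i j => by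
    rw [← integral_sub (integrable_mul_of_memLp (hG2 i j) (hw.memLp_grad i j))
      (integrable_mul_of_memLp (hG2 j i) (hw.memLp_grad i j))]
    simp only [sub_mul]
  rw [e1, hv.nullForm_eq hw, bndVort, ← Finset.sum_neg_distrib, ← Finset.sum_add_distrib,
    ← Finset.sum_add_distrib]
  refine Finset.sum_congr rfl fun i _ => ?_
  rw [← Finset.sum_neg_distrib, ← Finset.sum_add_distrib, ← Finset.sum_add_distrib]
  refine Finset.sum_congr rfl fun j _ => ?_
  have := hgauss i j
  rw [e2] at this
  linarith

/-- Pointwise the integrand is χ times the pairing of the vorticity with the normal and the tangent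
vector w, hence at most χ|a||w| ≤ χ(|a|² + |w|²). The constant collects the factors by which the
patch measures are dominated by the surface measure. -/
theorem bndVort_le (κ : PatchCover Ω) :
    ∃ C, 0 ≤ C ∧ ∀ (w gw : Space d → Space d) (Gw gG : Space d → Fin (d + 2) → Fin (d + 2) → ℝ)
      (G : Space d → Fin (d + 2) → Fin (d + 2) → ℝ)
      (H : Space d → Fin (d + 2) → Fin (d + 2) → Fin (d + 2) → ℝ)
      (a : Space d → (Space d) [⋀^Fin d]→L[ℝ] ℝ), Solenoidal Ω w Gw gw →
      (∀ i j, H1Trace Ω (surfaceMeasure Ω) (fun x => G x i j) (fun k x => H x k i j)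
        (fun x => gG x i j)) →
      Integrable (fun x => ‖a x‖ ^ 2) (surfaceMeasure Ω) →
      (∀ᵐ x ∂(surfaceMeasure Ω), ∀ ν, IsOutwardNormal Ω x ν →
        ∀ v : Fin d → Space d, (∀ k, inner ℝ (v k) ν = 0) → vorticity (gG x) v = a x v) →
      κ.bndVort gG gw ≤ C * (∫ x, ‖a x‖ ^ 2 ∂(surfaceMeasure Ω)) + κ.bndSq fun i x => gw x i := by
  choose K hK using fun k => (κ.isPatch k).le_surface
  refine ⟨∑ k, (K k : ℝ), by positivity, fun w gw Gw gG G H a hw hG ha hvort => ?_⟩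
  have hKa : ∀ k, Integrable (fun x => ‖a x‖ ^ 2) (κ.σ k) := fun k =>
    (ha.smul_measure (c := (K k : ℝ≥0∞)) ENNReal.coe_ne_top).mono_measure (hK k)
  have hterm : ∀ k, ∑ i, ∑ j, ∫ x, (κ.χ k x * (gG x i j - gG x j i)) * (κ.n k x i * gw x j) ∂(κ.σ k)
      ≤ (K k : ℝ) * (∫ x, ‖a x‖ ^ 2 ∂(surfaceMeasure Ω))
        + ∑ i, ∫ x, κ.χ k x * gw x i ^ 2 ∂(κ.σ k) := fun k => by
    have P := κ.isPatch k
    have hfin := P.finite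
    have hwk := fun j => κ.h1Trace (hw.h1 j) k
    have hi : ∀ i j, Integrable (fun x => (κ.χ k x * (gG x i j - gG x j i)) * (κ.n k x i * gw x j))
        (κ.σ k) := fun i j =>
      (((κ.h1Trace (hG i j) k).sub (κ.h1Trace (hG j i) k)).smul (κ.smooth k)
        (κ.compact k)).memLp_trace.integrable_mul
        ((hwk j).smul (P.smooth_coord i) (P.compact_coord i)).memLp_trace
    obtain ⟨C1, hC1⟩ := continuous_bdd (κ.smooth k).continuous (κ.compact k)
    have mχ := (κ.smooth k).continuous.aestronglyMeasurable (μ := κ.σ k)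
    have i1 : ∀ i, Integrable (fun x => κ.χ k x * gw x i ^ 2) (κ.σ k) := fun i => by
      simpa [mul_assoc, sq] using integrable_mul_mul (hwk i).memLp_trace (hwk i).memLp_trace mχ hC1
    have i2 : Integrable (fun x => κ.χ k x * ‖a x‖ ^ 2) (κ.σ k) :=
      (hKa k).bdd_mul mχ (Eventually.of_forall hC1)
    have hle : ∫ x, κ.χ k x * ‖a x‖ ^ 2 ∂(κ.σ k) ≤ (K k : ℝ) * ∫ x, ‖a x‖ ^ 2 ∂(surfaceMeasure Ω) := by
      calc ∫ x, κ.χ k x * ‖a x‖ ^ 2 ∂(κ.σ k) ≤ ∫ x, ‖a x‖ ^ 2 ∂(κ.σ k) :=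
            integral_mono i2 (hKa k) fun x =>
              mul_le_of_le_one_left (sq_nonneg _) (κ.le_one k x)
        _ ≤ ∫ x, ‖a x‖ ^ 2 ∂((K k : ℝ≥0∞) • surfaceMeasure Ω) :=
            integral_mono_measure (hK k) (Eventually.of_forall fun x => sq_nonneg _)
              (ha.smul_measure ENNReal.coe_ne_top)
        _ = _ := by rw [integral_smul_measure]; simp
    simp_rw [← fun i => integral_finsetSum Finset.univ fun j (_ : j ∈ Finset.univ) => hi i j]
    rw [← integral_finsetSum _ fun i _ => integrable_finsetSum _ fun j _ => hi i j]
    have i3 : Integrable (fun x => κ.χ k x * ‖a x‖ ^ 2 + ∑ i, κ.χ k x * gw x i ^ 2) (κ.σ k) :=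
      i2.add (integrable_finsetSum _ fun i _ => i1 i)
    refine (integral_mono_ae (integrable_finsetSum _ fun i _ => integrable_finsetSum _ fun j _ =>
      hi i j) i3 ?_).trans ?_
    · filter_upwards [κ.ae_of_ae_surface hw.normal k, κ.ae_of_ae_surface hvort k, P.normal]
        with x h1 h2 h3
      have hin : inner ℝ (gw x) (κ.n k x) = 0 := by
        rw [← h1 _ h3.2, PiLp.inner_apply]
        exact Finset.sum_congr rfl fun i _ => by simp [mul_comm]
      have := (abs_le.1 (abs_vorticity_pairing_le (P.norm_one x h3.1) hin (h2 _ h3.2))).2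
      have hχ := κ.nonneg k x
      have hnorm : ‖gw x‖ ^ 2 = ∑ i, gw x i ^ 2 := by
        rw [EuclideanSpace.norm_sq_eq]
        simp
      calc ∑ i, ∑ j, (κ.χ k x * (gG x i j - gG x j i)) * (κ.n k x i * gw x j)
          = κ.χ k x * ∑ i, ∑ j, κ.n k x i * (gG x i j - gG x j i) * gw x j := by
            simp only [Finset.mul_sum]
            exact Finset.sum_congr rfl fun i _ => Finset.sum_congr rfl fun j _ => by ring
        _ ≤ κ.χ k x * (‖a x‖ ^ 2 + ‖gw x‖ ^ 2) := by
            refine mul_le_mul_of_nonneg_left (this.trans ?_) hχ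
            nlinarith [sq_nonneg (‖a x‖ - ‖gw x‖), sq_nonneg ‖a x‖, sq_nonneg ‖gw x‖]
        _ = _ := by rw [hnorm, mul_add, Finset.mul_sum]
    · rw [integral_add i2 (integrable_finsetSum _ fun i _ => i1 i),
        integral_finsetSum _ fun i _ => i1 i]
      linarith
  have hcomm : κ.bndVort gG gw = ∑ k, ∑ i, ∑ j,
      ∫ x, (κ.χ k x * (gG x i j - gG x j i)) * (κ.n k x i * gw x j) ∂(κ.σ k) :=
    (Finset.sum_congr rfl fun i _ => Finset.sum_comm).trans Finset.sum_comm
  rw [hcomm, bndSq, Finset.sum_mul, ← Finset.sum_add_distrib]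
  exact Finset.sum_le_sum fun k _ => hterm k

end PatchCover

theorem Solenoidal.bndSq_le {Ω : Set (Space d)} (κ : PatchCover Ω) {ε : ℝ} (hε : 0 < ε) :
    ∃ C, 0 ≤ C ∧ ∀ (u g : Space d → Space d) (G : Space d → Fin (d + 2) → Fin (d + 2) → ℝ),
      Solenoidal Ω u G g → κ.bndSq (fun i x => g x i) ≤ ε * gradSq Ω G + C * l2Sq Ω u := by
  obtain ⟨C, hC0, hC⟩ := κ.bndSq_le hε
  refine ⟨C, hC0, fun u g G h => ?_⟩
  have := hC (fun i x => u x i) (fun i x => g x i) (fun i j x => G x j i) h.h1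
  rwa [Finset.sum_comm] at this

namespace PatchCover

variable {Ω : Set (Space d)}

/-- The boundary norm of v is traded for those of v − u, which the dissipation absorbs, and of u,
which the bound on the Euler solution controls. The pointwise inequality is (g − 2g')² ≥ 0. -/
theorem bndSq_add_le (κ : PatchCover Ω) {g g' : Fin (d + 2) → Space d → ℝ}
    (hg : ∀ i, MemLp (g i) 2 (surfaceMeasure Ω)) (hg' : ∀ i, MemLp (g' i) 2 (surfaceMeasure Ω)) :
    κ.bndSq g ≤ 2 * κ.bndSq (fun i x => g i x - g' i x) + 2 * κ.bndSq g' := by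
  simp only [bndSq, Finset.mul_sum, ← Finset.sum_add_distrib]
  refine Finset.sum_le_sum fun k _ => Finset.sum_le_sum fun i _ => ?_
  obtain ⟨C1, hC1⟩ := continuous_bdd (κ.smooth k).continuous (κ.compact k)
  obtain ⟨K, hK⟩ := (κ.isPatch k).le_surface
  have mχ := (κ.smooth k).continuous.aestronglyMeasurable (μ := κ.σ k)
  have i1 : ∀ {f : Space d → ℝ}, MemLp f 2 (surfaceMeasure Ω) →
      Integrable (fun x => κ.χ k x * f x ^ 2) (κ.σ k) := fun hf => by
    have hf' := hf.of_measure_le_smul (c := (K : ℝ≥0∞)) ENNReal.coe_ne_top hK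
    simpa [mul_assoc, sq] using integrable_mul_mul hf' hf' mχ hC1
  have i2 : Integrable (fun x => 2 * (κ.χ k x * (g i x - g' i x) ^ 2)) (κ.σ k) :=
    (i1 ((hg i).sub (hg' i))).const_mul 2
  have i3 : Integrable (fun x => 2 * (κ.χ k x * g' i x ^ 2)) (κ.σ k) := (i1 (hg' i)).const_mul 2
  rw [← integral_const_mul, ← integral_const_mul, ← integral_add i2 i3]
  refine integral_mono (i1 (hg i)) (i2.add i3) fun x => ?_
  simp only
  nlinarith [mul_nonneg (κ.nonneg k x) (sq_nonneg (g i x - 2 * g' i x))]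

/-- The viscous term in the energy balance of the difference of two fields. -/
theorem laplacian_le (κ : PatchCover Ω) (hΩ : IsSmoothBoundedDomain Ω) :
    ∃ C, 0 ≤ C ∧ ∀ (u v g g' : Space d → Space d)
      (G G' gG : Space d → Fin (d + 2) → Fin (d + 2) → ℝ)
      (H : Space d → Fin (d + 2) → Fin (d + 2) → Fin (d + 2) → ℝ)
      (a : Space d → (Space d) [⋀^Fin d]→L[ℝ] ℝ), Solenoidal Ω v G g → Solenoidal Ω u G' g' →
      (∀ i j, H1Trace Ω (surfaceMeasure Ω) (fun x => G x i j) (fun k x => H x k i j)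
        (fun x => gG x i j)) →
      (∀ j, ∀ᵐ x ∂(volume.restrict Ω), ∑ i, H x i j i = 0) →
      Integrable (fun x => ‖a x‖ ^ 2) (surfaceMeasure Ω) →
      (∀ᵐ x ∂(surfaceMeasure Ω), ∀ ν, IsOutwardNormal Ω x ν →
        ∀ v : Fin d → Space d, (∀ k, inner ℝ (v k) ν = 0) → vorticity (gG x) v = a x v) →
      ∫ x in Ω, ∑ j, (∑ i, H x i i j) * (v - u) x j ≤
        - (1 / 2) * gradSq Ω (fun x i j => G x i j - G' x i j)
          + C * (l2Sq Ω (v - u) + (l2Sq Ω u + gradSq Ω G')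
            + ∫ x, ‖a x‖ ^ 2 ∂(surfaceMeasure Ω)) := by
  obtain ⟨C1, hC1, h1⟩ := κ.abs_nullForm_le hΩ.isOpen
  obtain ⟨C2, hC2, h2⟩ := κ.bndVort_le
  -- The boundary norm of w occurs with total coefficient 3 C1 + 1: twice C1 through the trace of v
  -- and once through that of w in the null form, and 1 from the vorticity term. This ε makes it
  -- cost a quarter of the dissipation.
  have hε : 0 < 1 / (4 * (3 * C1 + 1)) := by positivity
  obtain ⟨C3, hC3, h3⟩ := Solenoidal.bndSq_le κ hε
  refine ⟨(3 * C1 + 1) * C3 + 1 + C2 + (3 * C1 + 1), by positivity,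
    fun u v g g' G G' gG H a hv hu hG hH ha hvort => ?_⟩
  have hw := hv.sub hu
  set Gw : Space d → Fin (d + 2) → Fin (d + 2) → ℝ := fun x i j => G x i j - G' x i j with hGw
  have b1 := (abs_le.1 (h1 _ _ _ _ _ _ hv.h1 hw.h1 hv.normal hw.normal)).2
  have b2 := h2 _ _ _ _ _ _ a hw hG ha hvort
  have b3 := h3 _ _ _ hw
  have b4 := h3 _ _ _ hu
  have b5 := κ.bndSq_add_le (fun i => (hv.h1 i).memLp_trace) (fun i => (hu.h1 i).memLp_trace)
  -- With ∇v = ∇w + ∇u, the cross term is absorbed by completing the square in ∇w + 2∇u. Of the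
  -- coefficient 3/4, one quarter pays for the boundary terms and 1/2 remains.
  have b6 : - (∑ i, ∑ j, ∫ x in Ω, G x i j * Gw x i j) ≤ - (3 / 4) * gradSq Ω Gw + gradSq Ω G' := by
    simp only [gradSq, Finset.mul_sum, ← Finset.sum_neg_distrib, ← Finset.sum_add_distrib]
    refine Finset.sum_le_sum fun i _ => Finset.sum_le_sum fun j _ => ?_
    have iw := (hw.memLp_grad i j).integrable_sq
    have iu := (hu.memLp_grad i j).integrable_sq
    rw [← integral_neg, ← integral_const_mul, ← integral_add (iw.const_mul _) iu]
    refine integral_mono (integrable_mul_of_memLp (hv.memLp_grad i j) (hw.memLp_grad i j)).neg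
      ((iw.const_mul _).add iu) fun x => ?_
    simp only [hGw]
    nlinarith [sq_nonneg ((G x i j - G' x i j) + 2 * G' x i j)]
  rw [κ.integral_laplacian hΩ.isOpen hv hw hG hH]
  have n1 := l2Sq_nonneg Ω (v - u)
  have n2 := l2Sq_nonneg Ω u
  have n3 := gradSq_nonneg Ω Gw
  have n4 := gradSq_nonneg Ω G'
  have n5 : 0 ≤ ∫ x, ‖a x‖ ^ 2 ∂(surfaceMeasure Ω) := integral_nonneg fun _ => sq_nonneg _
  set X := κ.bndSq fun i x => (g - g') x i with hX
  set Y := κ.bndSq fun i x => g' x i with hY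
  have b5' : κ.bndSq (fun i x => g x i) ≤ 2 * X + 2 * Y := b5
  set E := l2Sq Ω (v - u)
  set D := gradSq Ω Gw
  set D' := gradSq Ω G'
  set E' := l2Sq Ω u
  set A := ∫ x, ‖a x‖ ^ 2 ∂(surfaceMeasure Ω)
  set N := 3 * C1 + 1 with hN
  have hN1 : 1 ≤ N := by rw [hN]; linarith
  have c1 : C1 * (κ.bndSq (fun i x => g x i) + X) ≤ C1 * (3 * X + 2 * Y) :=
    mul_le_mul_of_nonneg_left (by linarith) hC1
  have c3 : N * X ≤ 1 / 4 * D + N * C3 * E := by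
    calc N * X ≤ N * (1 / (4 * N) * D + C3 * E) := mul_le_mul_of_nonneg_left b3 (by linarith)
      _ = _ := by field_simp
  have hY0 : 0 ≤ Y := Finset.sum_nonneg fun k _ => Finset.sum_nonneg fun i _ =>
    integral_nonneg fun x => mul_nonneg (κ.nonneg k x) (sq_nonneg _)
  have c4 : 2 * C1 * Y ≤ 1 / 4 * D' + N * C3 * E' := by
    calc 2 * C1 * Y ≤ N * Y := mul_le_mul_of_nonneg_right (by rw [hN]; linarith) hY0
      _ ≤ N * (1 / (4 * N) * D' + C3 * E') := mul_le_mul_of_nonneg_left b4 (by linarith)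
      _ = _ := by field_simp
  have p1 : 0 ≤ N * C3 := by positivity
  have p2 : 0 ≤ C2 * E := by positivity
  have p3 : 0 ≤ C2 * E' := by positivity
  have p4 : 0 ≤ C2 * D' := by positivity
  have q1 : 0 ≤ N * C3 * D' := by positivity
  have q2 : 0 ≤ N * C3 * A := by positivity
  have r1 : 0 ≤ N * E := by positivity
  have r2 : 0 ≤ N * E' := by positivity
  have r3 : D' ≤ N * D' := le_mul_of_one_le_left n4 hN1
  have r4 : 0 ≤ N * A := by positivity
  nlinarith

end PatchCover

theorem integral_add_sub_sub_add {α : Type*} [MeasurableSpace α] {μ : Measure α}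
    {f₁ f₂ f₃ f₄ f₅ : α → ℝ} (h₁ : Integrable f₁ μ) (h₂ : Integrable f₂ μ) (h₃ : Integrable f₃ μ)
    (h₄ : Integrable f₄ μ) (h₅ : Integrable f₅ μ) :
    ∫ x, (f₁ x + f₂ x - f₃ x - f₄ x + f₅ x) ∂μ =
      (∫ x, f₁ x ∂μ) + (∫ x, f₂ x ∂μ) - (∫ x, f₃ x ∂μ) - (∫ x, f₄ x ∂μ) + ∫ x, f₅ x ∂μ := by
  have h := integral_add (((h₁.add h₂).sub h₃).sub h₄) h₅
  rw [integral_sub' ((h₁.add h₂).sub h₃) h₄, integral_sub' (h₁.add h₂) h₃,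
    integral_add' h₁ h₂] at h
  exact h

/-! ### The energy inequality at a fixed time -/

namespace PatchCover

variable {Ω : Set (Space d)}

theorem sum_grad_mul_le {M : ℝ} (A : Fin (d + 2) → Fin (d + 2) → ℝ) (hA : ∀ i j, |A i j| ≤ M)
    (w : Fin (d + 2) → ℝ) :
    - ∑ j, (∑ i, w i * A i j) * w j ≤ (d + 2) * M * ∑ i, w i ^ 2 := by
  have h : ∀ i j, - (w i * A i j * w j) ≤ M / 2 * w i ^ 2 + M / 2 * w j ^ 2 := fun i j => by
    have hM : 0 ≤ M := (abs_nonneg _).trans (hA i j)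
    have h1 : - (w i * A i j * w j) ≤ |A i j| * (|w i| * |w j|) := by
      refine (neg_le_abs _).trans (le_of_eq ?_)
      rw [abs_mul, abs_mul]
      ring
    have h2 : |A i j| * (|w i| * |w j|) ≤ M * |w i| * |w j| := by
      rw [mul_assoc]
      exact mul_le_mul_of_nonneg_right (hA i j) (by positivity)
    exact (h1.trans h2).trans (half_mul_le hM _ _)
  calc - ∑ j, (∑ i, w i * A i j) * w j = ∑ j, ∑ i, - (w i * A i j * w j) := by
        rw [← Finset.sum_neg_distrib]
        refine Finset.sum_congr rfl fun j _ => ?_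
        rw [Finset.sum_mul, ← Finset.sum_neg_distrib]
    _ ≤ ∑ j, ∑ i, (M / 2 * w i ^ 2 + M / 2 * w j ^ 2) :=
        Finset.sum_le_sum fun j _ => Finset.sum_le_sum fun i _ => h i j
    _ = _ := by
        simp only [Finset.sum_add_distrib, Finset.sum_const, Finset.card_univ, Fintype.card_fin,
          nsmul_eq_mul, ← Finset.mul_sum]
        push_cast
        ring

/-- The energy inequality at a fixed time. -/
theorem energy_le (κ : PatchCover Ω) (hΩ : IsSmoothBoundedDomain Ω) :
    ∃ C, 0 ≤ C ∧ ∀ (μ M : ℝ) (u v g g' ut vt q q' : Space d → Space d) (p p' : Space d → ℝ)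
      (G G' gG : Space d → Fin (d + 2) → Fin (d + 2) → ℝ)
      (H : Space d → Fin (d + 2) → Fin (d + 2) → Fin (d + 2) → ℝ)
      (a : Space d → (Space d) [⋀^Fin d]→L[ℝ] ℝ), 0 ≤ μ →
      Solenoidal Ω v G g → Solenoidal Ω u G' g' →
      (∀ i j, H1Trace Ω (surfaceMeasure Ω) (fun x => G x i j) (fun k x => H x k i j)
        (fun x => gG x i j)) →
      (∀ j, ∀ᵐ x ∂(volume.restrict Ω), ∑ i, H x i j i = 0) →
      Integrable (fun x => ‖a x‖ ^ 2) (surfaceMeasure Ω) →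
      (∀ᵐ x ∂(surfaceMeasure Ω), ∀ ν, IsOutwardNormal Ω x ν →
        ∀ v : Fin d → Space d, (∀ k, inner ℝ (v k) ν = 0) → vorticity (gG x) v = a x v) →
      (∀ j, MemLp (fun x => vt x j) 2 (volume.restrict Ω)) →
      (∀ j, MemLp (fun x => ut x j) 2 (volume.restrict Ω)) →
      MemLp p 2 (volume.restrict Ω) → MemLp p' 2 (volume.restrict Ω) →
      (∀ j, MemLp (fun x => q x j) 2 (volume.restrict Ω)) →
      (∀ j, MemLp (fun x => q' x j) 2 (volume.restrict Ω)) →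
      (∀ i, HasWeakPartial Ω i p (fun x => q x i)) →
      (∀ i, HasWeakPartial Ω i p' (fun x => q' x i)) →
      (∀ᵐ x ∂(volume.restrict Ω), ∀ i j, |G' x i j| ≤ M) →
      (∀ᵐ x ∂(volume.restrict Ω), ∀ j,
        vt x j + ∑ i, v x i * G x i j + q x j = μ * ∑ i, H x i i j) →
      (∀ᵐ x ∂(volume.restrict Ω), ∀ j, ut x j + ∑ i, u x i * G' x i j + q' x j = 0) →
      ∫ x in Ω, ∑ j, (vt x j - ut x j) * (v - u) x j ≤
        - (μ / 2) * gradSq Ω (fun x i j => G x i j - G' x i j)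
          + (d + 2) * M * l2Sq Ω (v - u)
          + μ * (C * (l2Sq Ω (v - u) + (l2Sq Ω u + gradSq Ω G')
            + ∫ x, ‖a x‖ ^ 2 ∂(surfaceMeasure Ω))) := by
  obtain ⟨C, hC, hlap⟩ := κ.laplacian_le hΩ
  refine ⟨C, hC, fun μ M u v g g' ut vt q q' p p' G G' gG H a hμ hv hu hG hH ha hvort hvt hut hp hp'
    hq hq' hpq hpq' hM hmom hmom' => ?_⟩
  have hw := hv.sub hu
  have hL := hlap u v g g' G G' gG H a hv hu hG hH ha hvort
  set w := v - u with hwdef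
  set Gw : Space d → Fin (d + 2) → Fin (d + 2) → ℝ := fun x i j => G x i j - G' x i j with hGw
  have hwx : ∀ x i, w x i = v x i - u x i := fun x i => rfl
  have hH2 : ∀ k i j, MemLp (fun x => H x k i j) 2 (volume.restrict Ω) := fun k i j =>
    (hG i j).memLp_deriv k
  have hmulG' : ∀ {f : Space d → ℝ} (i j : Fin (d + 2)), MemLp f 2 (volume.restrict Ω) →
      MemLp (fun x => f x * G' x i j) 2 (volume.restrict Ω) := fun {f} i j hf =>
    hf.of_le_mul (c := M) (hf.1.mul (hu.memLp_grad i j).1) (by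
      filter_upwards [hM] with x hx
      rw [norm_mul, mul_comm]
      exact mul_le_mul_of_nonneg_right (hx i j) (norm_nonneg _))
  have hΔ : ∀ j, MemLp (fun x => ∑ i, H x i i j) 2 (volume.restrict Ω) := fun j =>
    memLp_finsetSum _ fun i _ => hH2 i i j
  have hb : ∀ j, MemLp (fun x => ∑ i, w x i * G' x i j) 2 (volume.restrict Ω) := fun j =>
    memLp_finsetSum _ fun i _ => hmulG' i j (hw.memLp i)
  have hvG' : ∀ j, MemLp (fun x => ∑ i, v x i * G' x i j) 2 (volume.restrict Ω) := fun j =>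
    memLp_finsetSum _ fun i _ => hmulG' i j (hv.memLp i)
  -- In high dimension H² does not give v·∇w ∈ L². It is read off from the momentum equation, where
  -- every other term is square integrable; v·∇u is so because ∇u is bounded.
  have hc : ∀ j, MemLp (fun x => ∑ i, v x i * Gw x i j) 2 (volume.restrict Ω) := fun j => by
    refine (((((hΔ j).const_mul μ).sub (hvt j)).sub (hq j)).sub (hvG' j)).ae_eq ?_
    filter_upwards [hmom] with x hx
    simp only [Pi.sub_apply, hGw, mul_sub, Finset.sum_sub_distrib]
    linarith [hx j]
  have hconv : ∀ j, ∫ x in Ω, (∑ i, v x i * Gw x i j) * w x j = 0 := fun j =>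
    κ.integral_convection_eq_zero hΩ hv.h1 hv.normal hv.div (hw.h1 j) (hc j)
  have hpr := κ.integral_weak_grad_eq_zero hΩ.isOpen hΩ.isBounded hw.h1 hw.normal hw.div hp hq hpq
  have hpr' := κ.integral_weak_grad_eq_zero hΩ.isOpen hΩ.isBounded hw.h1 hw.normal hw.div hp' hq' hpq'
  have ic := fun j => integrable_mul_of_memLp (hc j) (hw.memLp j)
  have ib := fun j => integrable_mul_of_memLp (hb j) (hw.memLp j)
  have iΔ := fun j => integrable_mul_of_memLp (hΔ j) (hw.memLp j)
  have iq := fun j => integrable_mul_of_memLp (hw.memLp j) (hq j)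
  have iq' := fun j => integrable_mul_of_memLp (hw.memLp j) (hq' j)
  have isum : ∀ {f : Fin (d + 2) → Space d → ℝ}, (∀ j, Integrable (f j) (volume.restrict Ω)) →
      Integrable (fun x => ∑ j, f j x) (volume.restrict Ω) := fun hf =>
    integrable_finsetSum _ fun j _ => hf j
  rw [← integral_finsetSum _ fun j _ => iq j] at hpr
  rw [← integral_finsetSum _ fun j _ => iq' j] at hpr'
  have hconv' : ∫ x in Ω, ∑ j, (∑ i, v x i * Gw x i j) * w x j = 0 := by
    rw [integral_finsetSum _ fun j _ => ic j]
    exact Finset.sum_eq_zero fun j _ => hconv j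
  have hstretch : ∫ x in Ω, - ∑ j, (∑ i, w x i * G' x i j) * w x j ≤ (d + 2) * M * l2Sq Ω w := by
    have i2 := isum fun j => (hw.memLp j).integrable_sq
    rw [l2Sq, ← integral_finsetSum _ fun j _ => (hw.memLp j).integrable_sq, ← integral_const_mul]
    refine integral_mono_ae (isum ib).neg (i2.const_mul _) ?_
    filter_upwards [hM] with x hx
    exact sum_grad_mul_le _ hx _
  -- The nonlinearity is split as v·∇v − u·∇u = v·∇w + w·∇u, so that the derivative in the
  -- stretching term falls on the Euler solution.
  have hsplit : ∫ x in Ω, ∑ j, (vt x j - ut x j) * w x j =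
      μ * (∫ x in Ω, ∑ j, (∑ i, H x i i j) * w x j)
      + (∫ x in Ω, - ∑ j, (∑ i, w x i * G' x i j) * w x j)
      - (∫ x in Ω, ∑ j, (∑ i, v x i * Gw x i j) * w x j)
      - (∫ x in Ω, ∑ j, w x j * q x j) + ∫ x in Ω, ∑ j, w x j * q' x j := by
    rw [← integral_const_mul]
    refine Eq.trans ?_ (integral_add_sub_sub_add ((isum iΔ).const_mul μ) (isum ib).neg
      (isum ic) (isum iq) (isum iq'))
    refine integral_congr_ae ?_
    filter_upwards [hmom, hmom'] with x h1 h2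
    rw [Finset.mul_sum, ← Finset.sum_neg_distrib, ← Finset.sum_add_distrib,
      ← Finset.sum_sub_distrib, ← Finset.sum_sub_distrib, ← Finset.sum_add_distrib]
    refine Finset.sum_congr rfl fun j _ => ?_
    have e1 : ∑ i, v x i * Gw x i j = ∑ i, v x i * G x i j - ∑ i, v x i * G' x i j := by
      simp only [hGw, mul_sub, Finset.sum_sub_distrib]
    have e2 : ∑ i, w x i * G' x i j = ∑ i, v x i * G' x i j - ∑ i, u x i * G' x i j := by
      simp only [hwx, sub_mul, Finset.sum_sub_distrib]
    rw [e1, e2]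
    have h1j := h1 j
    have h2j := h2 j
    linear_combination (w x j) * h1j - (w x j) * h2j
  rw [hsplit, hconv', hpr, hpr']
  have := mul_le_mul_of_nonneg_left hL hμ
  linarith

end PatchCover

/-! ### Absolutely continuous functions of time -/

/-- The product rule for the absolutely continuous primitive of f, multiplied by itself. -/
theorem sq_intervalIntegral {f : ℝ → ℝ} {t : ℝ} (hf : IntervalIntegrable f volume 0 t) :
    (∫ s in (0 : ℝ)..t, f s) ^ 2 = 2 * ∫ s in (0 : ℝ)..t, f s * ∫ r in (0 : ℝ)..s, f r := by
  have hac := hf.absolutelyContinuousOnInterval_intervalIntegral (c := 0) (by simp)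
  have h := hac.integral_deriv_mul_eq_sub hac
  have h2 : ∫ s in (0 : ℝ)..t, (deriv (fun x => ∫ r in (0 : ℝ)..x, f r) s * (∫ r in (0 : ℝ)..s, f r)
      + (∫ r in (0 : ℝ)..s, f r) * deriv (fun x => ∫ r in (0 : ℝ)..x, f r) s)
      = ∫ s in (0 : ℝ)..t, 2 * (f s * ∫ r in (0 : ℝ)..s, f r) := by
    apply intervalIntegral.integral_congr_ae
    filter_upwards [hf.ae_hasDerivAt_integral] with x hx hxt
    rw [(hx (uIoc_subset_uIcc hxt) 0 (by simp)).deriv]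
    ring
  rw [h2, intervalIntegral.integral_const_mul] at h
  rw [h]
  simp [sq]

/-- Gronwall's inequality with dissipation, in integrated form. -/
theorem gronwall_dissipation {T K μ : ℝ} (hT : 0 ≤ T) (hK : 0 ≤ K) (hμ : 0 < μ) {E D α f : ℝ → ℝ}
    (hf : IntervalIntegrable f volume 0 T) (hD : IntervalIntegrable D volume 0 T)
    (hα : IntervalIntegrable α volume 0 T) (hE : ∀ t ∈ Icc 0 T, E t = 2 * ∫ s in (0 : ℝ)..t, f s)
    (hE0 : ∀ t ∈ Icc 0 T, 0 ≤ E t) (hD0 : ∀ t, 0 ≤ D t) (hα0 : ∀ t, 0 ≤ α t)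
    (h : ∀ᵐ t ∂(volume.restrict (Icc 0 T)), f t ≤ - (μ / 2) * D t + K * E t + μ * α t) :
    (∀ t ∈ Icc 0 T, E t ≤ 2 * Real.exp (2 * K * T) * (∫ s in (0 : ℝ)..T, α s) * μ) ∧
      ∫ s in (0 : ℝ)..T, D s ≤
        (2 + 4 * K * T * Real.exp (2 * K * T)) * ∫ s in (0 : ℝ)..T, α s := by
  set B := ∫ s in (0 : ℝ)..T, α s with hB
  have hB0 : 0 ≤ B := intervalIntegral.integral_nonneg hT fun t _ => hα0 t
  have h' : ∀ᵐ t, t ∈ Icc 0 T → f t ≤ - (μ / 2) * D t + K * E t + μ * α t :=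
    (ae_restrict_iff' measurableSet_Icc).1 h
  have sub : ∀ {t}, t ∈ Icc 0 T → uIcc 0 t ⊆ uIcc 0 T := fun ht => by
    rw [uIcc_of_le ht.1, uIcc_of_le hT]
    exact Icc_subset_Icc_right ht.2
  have key : ∀ t ∈ Icc 0 T, E t ≤ 2 * Real.exp (2 * K * T) * B * μ := fun t ht => by
    have hft := hf.mono_set (sub ht)
    have hαt := hα.mono_set (sub ht)
    -- The inequality holds only almost everywhere, so the product of E with the factor exp(−2Kt) is
    -- differentiated as a product of absolutely continuous functions. The dissipation is dropped
    -- here, and the exponential multiplying α is bounded by 1.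
    have hac := (hft.absolutelyContinuousOnInterval_intervalIntegral (c := 0) (by simp)).const_mul 2
    have hexp : ContDiff ℝ 1 fun s : ℝ => Real.exp (-(2 * K * s)) := by fun_prop
    have hac' := hexp.contDiffOn.absolutelyContinuousOnInterval (a := 0) (b := t)
    have hp := hac'.integral_deriv_mul_eq_sub hac
    have hle : ∫ s in (0 : ℝ)..t, (deriv (fun s : ℝ => Real.exp (-(2 * K * s))) s
        * (2 * ∫ r in (0 : ℝ)..s, f r) + Real.exp (-(2 * K * s))
        * deriv (fun x => 2 * ∫ r in (0 : ℝ)..x, f r) s) ≤ ∫ s in (0 : ℝ)..t, 2 * μ * α s := by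
      refine intervalIntegral.integral_mono_ae_restrict ht.1
        ((hac'.intervalIntegrable_deriv.mul_continuousOn hac.continuousOn).add
        (hac.intervalIntegrable_deriv.continuousOn_mul hac'.continuousOn)) (hαt.const_mul _) ?_
      rw [EventuallyLE, ae_restrict_iff' measurableSet_Icc]
      filter_upwards [h', hft.ae_hasDerivAt_integral] with s hs hds hst
      have hsT : s ∈ Icc 0 T := ⟨hst.1, hst.2.trans ht.2⟩
      have d1 := ((hds (by rwa [uIcc_of_le ht.1]) 0 (by simp)).const_mul 2).deriv
      have d2 : HasDerivAt (fun s : ℝ => Real.exp (-(2 * K * s)))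
          (Real.exp (-(2 * K * s)) * (-(2 * K))) s := by
        have := (((hasDerivAt_id s).const_mul (2 * K)).neg).exp
        simpa using this
      rw [d1, d2.deriv, ← hE s hsT]
      have e1 : Real.exp (-(2 * K * s)) ≤ 1 := Real.exp_le_one_iff.2 (by
        have := mul_nonneg hK hst.1
        linarith)
      have e0 := Real.exp_pos (-(2 * K * s))
      have hs' := hs hsT
      have hdiff : f s - K * E s ≤ μ * α s := by
        have := mul_nonneg hμ.le (hD0 s)
        linarith
      calc Real.exp (-(2 * K * s)) * (-(2 * K)) * E s + Real.exp (-(2 * K * s)) * (2 * f s)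
          = Real.exp (-(2 * K * s)) * (2 * (f s - K * E s)) := by ring
        _ ≤ Real.exp (-(2 * K * s)) * (2 * (μ * α s)) := by gcongr
        _ ≤ 1 * (2 * (μ * α s)) := by
            have := mul_nonneg hμ.le (hα0 s)
            gcongr
        _ = _ := by ring
    rw [hp, ← hE t ht, intervalIntegral.integral_same, intervalIntegral.integral_const_mul] at hle
    have hαB : ∫ s in (0 : ℝ)..t, α s ≤ B :=
      intervalIntegral.integral_mono_interval le_rfl ht.1 ht.2 (Eventually.of_forall hα0) hα
    have hle' : Real.exp (-(2 * K * t)) * E t ≤ 2 * μ * B := by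
      have := mul_le_mul_of_nonneg_left hαB (by positivity : 0 ≤ 2 * μ)
      linarith
    calc E t = Real.exp (2 * K * t) * (Real.exp (-(2 * K * t)) * E t) := by
          rw [← mul_assoc, ← Real.exp_add]
          simp
      _ ≤ Real.exp (2 * K * T) * (2 * μ * B) := by
          refine mul_le_mul (Real.exp_le_exp.2 ?_) hle'
            (mul_nonneg (Real.exp_pos _).le (hE0 t ht)) (Real.exp_pos _).le
          exact mul_le_mul_of_nonneg_left ht.2 (by positivity)
      _ = _ := by ring
  refine ⟨key, ?_⟩
  set N := 2 * Real.exp (2 * K * T) * B * μ with hN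
  -- The inequality is integrated once more with the dissipation kept. N bounds E and contains the
  -- factor μ, and 2∫f = E(T) ≥ 0; division by μ/2 thus gives a bound free of μ.
  have hint : ∫ s in (0 : ℝ)..T, (μ / 2) * D s ≤ ∫ s in (0 : ℝ)..T, (K * N + μ * α s - f s) := by
    refine intervalIntegral.integral_mono_ae_restrict hT (hD.const_mul _)
      ((intervalIntegrable_const.add (hα.const_mul _)).sub hf) ?_
    filter_upwards [h, ae_restrict_mem measurableSet_Icc] with s hs hsT
    have := mul_le_mul_of_nonneg_left (key s hsT) hK
    linarith
  rw [intervalIntegral.integral_sub (intervalIntegrable_const.add (hα.const_mul _)) hf,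
    intervalIntegral.integral_add intervalIntegrable_const (hα.const_mul _),
    intervalIntegral.integral_const_mul, intervalIntegral.integral_const_mul μ,
    intervalIntegral.integral_const] at hint
  have hET := hE0 T ⟨hT, le_rfl⟩
  rw [hE T ⟨hT, le_rfl⟩] at hET
  simp only [smul_eq_mul, sub_zero] at hint
  rw [← mul_le_mul_iff_right₀ (half_pos hμ)]
  rw [hN] at hint
  linarith

/-- The Cauchy–Schwarz inequality against a constant, obtained from ∫ (L f − m)² ≥ 0 with L the
total mass and m the integral of f. -/
theorem sq_integral_le {α : Type*} [MeasurableSpace α] {ν : Measure α} [IsFiniteMeasure ν]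
    {f : α → ℝ} (hf : MemLp f 2 ν) : (∫ x, f x ∂ν) ^ 2 ≤ ν.real univ * ∫ x, f x ^ 2 ∂ν := by
  set L := ν.real univ with hL
  set m := ∫ x, f x ∂ν with hm
  have hi := hf.integrable (by norm_num)
  have hi2 := hf.integrable_sq
  rcases eq_or_lt_of_le (measureReal_nonneg : 0 ≤ ν.real univ) with h0 | h0
  · have : ν = 0 := by
      rw [eq_comm, measureReal_eq_zero_iff] at h0
      exact Measure.measure_univ_eq_zero.1 h0
    simp [hm, this]
  · have h1 : 0 ≤ ∫ x, (L * f x - m) ^ 2 ∂ν := integral_nonneg fun _ => sq_nonneg _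
    have h2 : ∫ x, (L * f x - m) ^ 2 ∂ν =
        L ^ 2 * (∫ x, f x ^ 2 ∂ν) - 2 * L * m * (∫ x, f x ∂ν) + L * m ^ 2 := by
      have e : ∀ x, (L * f x - m) ^ 2 = L ^ 2 * f x ^ 2 - 2 * L * m * f x + m ^ 2 := fun x => by ring
      simp_rw [e]
      have i1 : Integrable (fun x => L ^ 2 * f x ^ 2 - 2 * L * m * f x) ν :=
        (hi2.const_mul _).sub (hi.const_mul _)
      rw [integral_add i1 (integrable_const _),
        integral_sub (hi2.const_mul _) (hi.const_mul _), integral_const_mul, integral_const_mul,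
        integral_const, smul_eq_mul]
    rw [h2, ← hm] at h1
    have h3 : 0 ≤ L * (L * (∫ x, f x ^ 2 ∂ν) - m ^ 2) := by nlinarith
    have := nonneg_of_mul_nonneg_right h3 h0
    linarith

theorem ae_ae_swap {α β : Type*} [MeasurableSpace α] [MeasurableSpace β] {μ : Measure α}
    {ν : Measure β} [SFinite μ] [SFinite ν] {p : α × β → Prop} (h : ∀ᵐ z ∂(μ.prod ν), p z) :
    ∀ᵐ y ∂ν, ∀ᵐ x ∂μ, p (x, y) :=
  Measure.ae_ae_of_ae_prod ((Measure.measurePreserving_swap (μ := ν) (ν := μ)).quasiMeasurePreserving.ae h)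

/-- The energy identity for functions that are absolutely continuous in time. -/
theorem energy_identity {X : Type*} [MeasurableSpace X] {lam : Measure X} [IsFiniteMeasure lam]
    {T : ℝ} (hT : 0 ≤ T) {h : ℝ × X → ℝ} (hh : MemLp h 2 ((volume.restrict (Icc 0 T)).prod lam))
    {w : ℝ → X → ℝ}
    (hw : ∀ t ∈ Icc 0 T, ∀ᵐ x ∂lam, w t x = ∫ s in (0 : ℝ)..t, h (s, x)) :
    IntervalIntegrable (fun s => ∫ x, h (s, x) * w s x ∂lam) volume 0 T ∧
      ∀ t ∈ Icc 0 T, MemLp (w t) 2 lam ∧ ∫ x, w t x ^ 2 ∂lam =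
        2 * ∫ s in (0 : ℝ)..t, ∫ x, h (s, x) * w s x ∂lam := by
  set ν := volume.restrict (Icc 0 T) with hν
  obtain ⟨k, hkm, hhk⟩ := hh.1
  have hk := hh.ae_eq hhk
  have hk2 := hk.integrable_sq
  -- The function w is determined for each time only up to a null set that depends on the time, and
  -- joint measurability is not given. W is a jointly measurable version, which Fubini requires.
  let W : ℝ × X → ℝ := fun z => ∫ r, (if r ≤ z.1 then k (r, z.2) else 0) ∂ν
  have hWm : StronglyMeasurable W := by
    refine StronglyMeasurable.integral_prod_right'
      (f := fun y : (ℝ × X) × ℝ => if y.2 ≤ y.1.1 then k (y.2, y.1.2) else 0) ?_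
    exact StronglyMeasurable.ite (measurableSet_le measurable_snd measurable_fst.fst)
      (hkm.comp_measurable (measurable_snd.prodMk measurable_fst.snd)) stronglyMeasurable_const
  have hslice : ∀ᵐ x ∂lam, MemLp (fun r => k (r, x)) 2 ν := by
    filter_upwards [hk2.prod_left_ae] with x hx
    exact (memLp_two_iff_integrable_sq
      (hkm.comp_measurable (measurable_id.prodMk measurable_const)).aestronglyMeasurable).2 hx
  have hWeq : ∀ s ∈ Icc 0 T, ∀ x, W (s, x) = ∫ r in (0 : ℝ)..s, k (r, x) := fun s hs x => by
    have e : ∀ r, (if r ≤ s then k (r, x) else 0) = (Iic s).indicator (fun r => k (r, x)) r :=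
      fun r => by simp [indicator]
    simp only [W, e]
    rw [integral_indicator measurableSet_Iic, hν, Measure.restrict_restrict measurableSet_Iic,
      intervalIntegral.integral_of_le hs.1, ← integral_Icc_eq_integral_Ioc]
    congr 2
    ext r
    simp only [mem_inter_iff, mem_Iic, mem_Icc]
    exact ⟨fun h => ⟨h.2.1, h.1⟩, fun h => ⟨h.2, h.1, h.2.trans hs.2⟩⟩
  have hdom : Integrable (fun x => ν.real univ * ∫ r, k (r, x) ^ 2 ∂ν) lam :=
    hk2.integral_prod_right.const_mul _
  -- The exceptional set does not depend on s, so the same integrable majorant gives square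
  -- integrability of W on the product and on every time slice.
  have hWle : ∀ᵐ x ∂lam, ∀ s, ‖W (s, x) ^ 2‖ ≤ ν.real univ * ∫ r, k (r, x) ^ 2 ∂ν := by
    filter_upwards [hslice] with x hx s
    rw [Real.norm_of_nonneg (sq_nonneg _)]
    have hind : MemLp (fun r => if r ≤ s then k (r, x) else 0) 2 ν := by
      have := hx.indicator (measurableSet_Iic (a := s))
      refine this.ae_eq (Eventually.of_forall fun r => ?_)
      simp [indicator]
    refine (sq_integral_le hind).trans ?_
    refine mul_le_mul_of_nonneg_left ?_ measureReal_nonneg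
    refine integral_mono hind.integrable_sq hx.integrable_sq fun r => ?_
    simp only
    split_ifs
    · exact le_rfl
    · rw [zero_pow two_ne_zero]
      exact sq_nonneg _
  have hW2 : MemLp W 2 (ν.prod lam) := by
    rw [memLp_two_iff_integrable_sq hWm.aestronglyMeasurable]
    refine (hdom.comp_snd ν).mono' (hWm.pow 2).aestronglyMeasurable ?_
    filter_upwards [(Measure.quasiMeasurePreserving_snd (μ := ν) (ν := lam)).ae hWle] with z hz
    exact hz z.1
  have hWs : ∀ s, MemLp (fun x => W (s, x)) 2 lam := fun s => by
    have hm := hWm.comp_measurable (measurable_const.prodMk measurable_id : Measurable fun x => (s, x))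
    refine (memLp_two_iff_integrable_sq hm.aestronglyMeasurable).2 ?_
    exact hdom.mono' (hm.pow 2).aestronglyMeasurable (hWle.mono fun x hx => hx s)
  have hkW : Integrable (fun z => k z * W z) (ν.prod lam) := hk.integrable_mul hW2
  have hwW : ∀ t ∈ Icc 0 T, ∀ᵐ x ∂lam, w t x = W (t, x) := fun t ht => by
    filter_upwards [hw t ht, ae_ae_swap hhk] with x h1 h2
    rw [h1, hWeq t ht]
    apply intervalIntegral.integral_congr_ae
    rw [hν, ae_restrict_iff' measurableSet_Icc] at h2
    filter_upwards [h2] with r hr hrt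
    rw [uIoc_of_le ht.1] at hrt
    exact hr ⟨hrt.1.le, hrt.2.trans ht.2⟩
  have hinner : ∀ᵐ s ∂ν, ∫ x, h (s, x) * w s x ∂lam = ∫ x, k (s, x) * W (s, x) ∂lam := by
    filter_upwards [Measure.ae_ae_of_ae_prod hhk, ae_restrict_mem measurableSet_Icc] with s h1 hs
    refine integral_congr_ae ?_
    filter_upwards [h1, hwW s hs] with x h2 h3
    rw [h2, h3]
  have hInt : IntervalIntegrable (fun s => ∫ x, h (s, x) * w s x ∂lam) volume 0 T := by
    rw [intervalIntegrable_iff_integrableOn_Icc_of_le hT]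
    exact hkW.integral_prod_left.congr (hinner.mono fun s hs => hs.symm)
  refine ⟨hInt, fun t ht => ⟨(hWs t).ae_eq ((hwW t ht).mono fun x hx => hx.symm), ?_⟩⟩
  have hsub : Ioc 0 t ⊆ Icc 0 T := fun s hs => ⟨hs.1.le, hs.2.trans ht.2⟩
  have hkWt : Integrable (fun z => k z * W z) ((volume.restrict (Ioc 0 t)).prod lam) := by
    have := hkW.integrableOn (s := Ioc 0 t ×ˢ univ)
    rwa [IntegrableOn, ← Measure.prod_restrict, Measure.restrict_univ, hν,
      Measure.restrict_restrict_of_subset hsub] at this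
  -- For almost every x this is the scalar formula for the square of a primitive; only afterwards
  -- are the integrals in x and s exchanged.
  calc ∫ x, w t x ^ 2 ∂lam = ∫ x, (2 * ∫ s in Ioc 0 t, k (s, x) * W (s, x)) ∂lam := by
        refine integral_congr_ae ?_
        filter_upwards [hwW t ht, hslice] with x h1 h2
        have hi : IntervalIntegrable (fun r => k (r, x)) volume 0 t := by
          rw [intervalIntegrable_iff_integrableOn_Ioc_of_le ht.1]
          exact IntegrableOn.mono_set (h2.integrable (by norm_num)) hsub
        rw [h1, hWeq t ht, sq_intervalIntegral hi, intervalIntegral.integral_of_le ht.1]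
        congr 1
        refine setIntegral_congr_fun measurableSet_Ioc fun s hs => ?_
        rw [hWeq s (hsub hs)]
    _ = 2 * ∫ s in Ioc 0 t, ∫ x, k (s, x) * W (s, x) ∂lam := by
        rw [integral_const_mul,
          integral_integral_swap (f := fun s x => k (s, x) * W (s, x)) hkWt]
    _ = _ := by
        rw [intervalIntegral.integral_of_le ht.1]
        congr 1
        refine integral_congr_ae ?_
        filter_upwards [ae_restrict_of_ae_restrict_of_subset hsub hinner] with s hs using hs.symm

/-! ### Slices in time -/

theorem memLp_slice {X E : Type*} [MeasurableSpace X] [NormedAddCommGroup E] {lam : Measure X}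
    [SFinite lam] {ν : Measure ℝ} [SFinite ν] {F : ℝ × X → E} (hF : MemLp F 2 (ν.prod lam)) :
    ∀ᵐ t ∂ν, MemLp (fun x => F (t, x)) 2 lam := by
  have h2 := (memLp_two_iff_integrable_sq_norm hF.1).1 hF
  filter_upwards [hF.1.prodMk_left, h2.prod_right_ae] with t h3 h4
  exact (memLp_two_iff_integrable_sq_norm h3).2 h4

theorem memLp_slice_swap {X E : Type*} [MeasurableSpace X] [NormedAddCommGroup E] {lam : Measure X}
    [SFinite lam] {ν : Measure ℝ} [SFinite ν] {F : ℝ × X → E} (hF : MemLp F 2 (ν.prod lam)) :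
    ∀ᵐ x ∂lam, MemLp (fun t => F (t, x)) 2 ν := by
  have h2 := (memLp_two_iff_integrable_sq_norm hF.1).1 hF
  filter_upwards [hF.1.prod_swap.prodMk_left, h2.prod_left_ae] with t h3 h4
  exact (memLp_two_iff_integrable_sq_norm h3).2 h4

theorem prod_restrict_Icc_mono {X : Type*} [MeasurableSpace X] (lam : Measure X) [SFinite lam]
    {T T' : ℝ} (h : T ≤ T') : (volume.restrict (Icc 0 T)).prod lam ≤
      (volume.restrict (Icc 0 T')).prod lam := by
  have e : ∀ T : ℝ, (volume.restrict (Icc 0 T)).prod lam =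
      (volume.prod lam).restrict (Icc 0 T ×ˢ univ) := fun T => by
    rw [← Measure.prod_restrict, Measure.restrict_univ]
  rw [e, e]
  exact Measure.restrict_mono (prod_mono (Icc_subset_Icc_right h) le_rfl) le_rfl

/-- The maximum with 0 appears because A may be negative, in which case `ENNReal.ofReal A` is 0. -/
theorem integral_norm_sq_le {X E : Type*} [MeasurableSpace X] [NormedAddCommGroup E]
    {μ : Measure X} {F : X → E} (hF : MemLp F 2 μ) {A : ℝ} (h : eLpNorm F 2 μ ≤ ENNReal.ofReal A) :
    ∫ x, ‖F x‖ ^ 2 ∂μ ≤ max A 0 ^ 2 := by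
  rw [hF.eLpNorm_eq_integral_rpow_norm (by norm_num) (by norm_num)] at h
  have h0 : 0 ≤ ∫ x, ‖F x‖ ^ 2 ∂μ := integral_nonneg fun _ => sq_nonneg _
  have e : ∫ x, ‖F x‖ ^ (2 : ℝ≥0∞).toReal ∂μ = ∫ x, ‖F x‖ ^ 2 ∂μ := by simp
  rw [e, ENNReal.toReal_ofNat, ← one_div, ← Real.sqrt_eq_rpow] at h
  have h1 : √(∫ x, ‖F x‖ ^ 2 ∂μ) ≤ max A 0 := by
    by_contra hc
    have := max_lt_iff.1 (not_le.1 hc)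
    exact absurd h (not_le.2 ((ENNReal.ofReal_lt_ofReal_iff this.2).2 this.1))
  calc ∫ x, ‖F x‖ ^ 2 ∂μ = √(∫ x, ‖F x‖ ^ 2 ∂μ) ^ 2 := (Real.sq_sqrt h0).symm
    _ ≤ _ := pow_le_pow_left₀ (Real.sqrt_nonneg _) h1 2

theorem enorm_sq_eq_ofReal (r : ℝ) : ‖r‖ₑ ^ 2 = ENNReal.ofReal (r ^ 2) := by
  rw [← ofReal_norm, ← ENNReal.ofReal_pow (norm_nonneg _), Real.norm_eq_abs, sq_abs]

theorem sum_enorm_sq (w : Fin (d + 2) → ℝ) :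
    ∑ i, ‖w i‖ₑ ^ 2 = ENNReal.ofReal (∑ i, w i ^ 2) := by
  rw [ENNReal.ofReal_sum_of_nonneg fun i _ => sq_nonneg _]
  simp_rw [enorm_sq_eq_ofReal]

theorem sum_sum_enorm_sq (A : Fin (d + 2) → Fin (d + 2) → ℝ) :
    ∑ i, ∑ j, ‖A i j‖ₑ ^ 2 = ENNReal.ofReal (∑ i, ∑ j, A i j ^ 2) := by
  rw [ENNReal.ofReal_sum_of_nonneg fun i _ => Finset.sum_nonneg fun j _ => sq_nonneg _]
  simp_rw [sum_enorm_sq]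

section Norms

variable {Ω : Set (Space d)} {u : Space d → Space d}
  {G G' : Space d → Fin (d + 2) → Fin (d + 2) → ℝ}

theorem integrable_sum_sq (hu : ∀ j, MemLp (fun x => u x j) 2 (volume.restrict Ω)) :
    Integrable (fun x => ∑ j, u x j ^ 2) (volume.restrict Ω) :=
  integrable_finsetSum _ fun j _ => (hu j).integrable_sq

theorem integrable_sum_sum_sq (hG : ∀ i j, MemLp (fun x => G x i j) 2 (volume.restrict Ω)) :
    Integrable (fun x => ∑ i, ∑ j, G x i j ^ 2) (volume.restrict Ω) :=
  integrable_finsetSum _ fun i _ => integrable_finsetSum _ fun j _ => (hG i j).integrable_sq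

theorem l2Sq_eq (hu : ∀ j, MemLp (fun x => u x j) 2 (volume.restrict Ω)) :
    l2Sq Ω u = ∫ x in Ω, ∑ j, u x j ^ 2 := by
  rw [l2Sq, integral_finsetSum _ fun j _ => (hu j).integrable_sq]

theorem gradSq_eq (hG : ∀ i j, MemLp (fun x => G x i j) 2 (volume.restrict Ω)) :
    gradSq Ω G = ∫ x in Ω, ∑ i, ∑ j, G x i j ^ 2 := by
  rw [gradSq, integral_finsetSum _ fun i _ => integrable_finsetSum _ fun j _ =>
    (hG i j).integrable_sq]
  exact Finset.sum_congr rfl fun i _ => (integral_finsetSum _ fun j _ => (hG i j).integrable_sq).symm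

theorem lintegral_gradSq (hG : ∀ i j, MemLp (fun x => G x i j) 2 (volume.restrict Ω)) :
    ∫⁻ x in Ω, ∑ i, ∑ j, ‖G x i j‖ₑ ^ 2 = ENNReal.ofReal (gradSq Ω G) := by
  rw [gradSq_eq hG, ofReal_integral_eq_lintegral_ofReal (integrable_sum_sum_sq hG)
    (Eventually.of_forall fun x => Finset.sum_nonneg fun i _ => Finset.sum_nonneg fun j _ =>
      sq_nonneg _)]
  simp_rw [sum_sum_enorm_sq]

theorem eLpNorm_sq_eq (hu : ∀ j, MemLp (fun x => u x j) 2 (volume.restrict Ω)) :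
    eLpNorm u 2 (volume.restrict Ω) ^ 2 = ENNReal.ofReal (l2Sq Ω u) := by
  rw [l2Sq_eq hu, ofReal_integral_eq_lintegral_ofReal (integrable_sum_sq hu)
    (Eventually.of_forall fun x => Finset.sum_nonneg fun i _ => sq_nonneg _),
    eLpNorm_eq_lintegral_rpow_enorm_toReal (by norm_num) (by norm_num), ← ENNReal.rpow_natCast,
    ← ENNReal.rpow_mul]
  simp only [ENNReal.toReal_ofNat, Nat.cast_ofNat, one_div, inv_mul_cancel₀ (two_ne_zero' ℝ),
    ENNReal.rpow_one]
  refine lintegral_congr fun x => ?_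
  have : (2 : ℝ) = ((2 : ℕ) : ℝ) := by norm_num
  rw [this, ENNReal.rpow_natCast, ← ofReal_norm, ← ENNReal.ofReal_pow (norm_nonneg _),
    EuclideanSpace.norm_sq_eq]
  simp

theorem HasWeakGradient.ae_eq (hΩ : IsOpen Ω) (h : HasWeakGradient Ω u G)
    (h' : HasWeakGradient Ω u G') : G =ᵐ[volume.restrict Ω] G' := by
  have : ∀ i j, (fun x => G x i j) =ᵐ[volume.restrict Ω] fun x => G' x i j := fun i j =>
    (h i j).ae_eq hΩ (h' i j)
  filter_upwards [ae_all_iff.2 fun i => ae_all_iff.2 fun j => this i j] with x hx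
  funext i j
  exact hx i j

/-- The norm is an infimum over weak gradients; by uniqueness each competitor agrees almost
everywhere with G, so the bound holds for the given gradient. -/
theorem l2Sq_add_gradSq_le (hΩ : IsOpen Ω) (h : HasWeakGradient Ω u G)
    (hu : ∀ j, MemLp (fun x => u x j) 2 (volume.restrict Ω))
    (hG : ∀ i j, MemLp (fun x => G x i j) 2 (volume.restrict Ω)) {M : ℝ}
    (hM : h2NormSq Ω u ≤ ENNReal.ofReal M ^ 2) : l2Sq Ω u + gradSq Ω G ≤ max M 0 ^ 2 := by
  have h1 : ENNReal.ofReal (l2Sq Ω u + gradSq Ω G) ≤ h2NormSq Ω u := by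
    refine le_iInf fun G' => le_iInf fun H' => le_iInf fun hG' => le_iInf fun _ => ?_
    have hi : Integrable (fun x => ∑ j, u x j ^ 2 + ∑ i, ∑ j, G x i j ^ 2) (volume.restrict Ω) :=
      (integrable_sum_sq hu).add (integrable_sum_sum_sq hG)
    rw [l2Sq_eq hu, gradSq_eq hG, ← integral_add (integrable_sum_sq hu) (integrable_sum_sum_sq hG),
      ofReal_integral_eq_lintegral_ofReal hi
      (Eventually.of_forall fun x => add_nonneg (Finset.sum_nonneg fun i _ => sq_nonneg _)
        (Finset.sum_nonneg fun i _ => Finset.sum_nonneg fun j _ => sq_nonneg _))]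
    refine lintegral_mono_ae ?_
    filter_upwards [h.ae_eq hΩ hG'] with x hx
    rw [← hx, ENNReal.ofReal_add (Finset.sum_nonneg fun i _ => sq_nonneg _)
      (Finset.sum_nonneg fun i _ => Finset.sum_nonneg fun j _ => sq_nonneg _), ← sum_enorm_sq,
      ← sum_sum_enorm_sq]
    exact le_self_add
  have h2 := h1.trans hM
  have e : ENNReal.ofReal M = ENNReal.ofReal (max M 0) := by simp
  rw [e, ← ENNReal.ofReal_pow (le_max_right _ _)] at h2
  exact (ENNReal.ofReal_le_ofReal_iff (by positivity)).1 h2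

/-- Again uniqueness of the weak gradient removes the infimum in the norm; the entries are bounded
by the supremum norm of the matrix. -/
theorem abs_grad_le (hΩ : IsOpen Ω) (h : HasWeakGradient Ω u G) {M : ℝ}
    (hM : w1InftyNorm Ω u ≤ ENNReal.ofReal M) :
    ∀ᵐ x ∂(volume.restrict Ω), ∀ i j, |G x i j| ≤ max M 0 := by
  have h1 : eLpNorm G ⊤ (volume.restrict Ω) ≤ w1InftyNorm Ω u := by
    refine le_iInf fun G' => le_iInf fun hG' => ?_
    rw [eLpNorm_congr_ae (h.ae_eq hΩ hG')]
    exact le_max_right _ _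
  have h2 := h1.trans hM
  rw [eLpNorm_exponent_top] at h2
  filter_upwards [enorm_ae_le_eLpNormEssSup G (volume.restrict Ω)] with x hx i j
  have h3 := hx.trans h2
  have e : ENNReal.ofReal M = ENNReal.ofReal (max M 0) := by simp
  rw [e, ← ofReal_norm, ENNReal.ofReal_le_ofReal_iff (le_max_right _ _)] at h3
  exact ((norm_le_pi_norm (G x i) j).trans (norm_le_pi_norm (G x) i)).trans h3

theorem HasWeakPartial.sub {i : Fin (d + 2)} {f f' g g' : Space d → ℝ}
    (h : HasWeakPartial Ω i f g) (h' : HasWeakPartial Ω i f' g')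
    (hf : MemLp f 2 (volume.restrict Ω)) (hf' : MemLp f' 2 (volume.restrict Ω))
    (hg : MemLp g 2 (volume.restrict Ω)) (hg' : MemLp g' 2 (volume.restrict Ω)) :
    HasWeakPartial Ω i (fun x => f x - f' x) (fun x => g x - g' x) := by
  refine ⟨h.1.sub h'.1, h.2.1.sub h'.2.1, fun φ hφ hφc hφs => ?_⟩
  have m1 : MemLp φ 2 (volume.restrict Ω) := memLp_of_continuous hφ.continuous hφc _
  have m2 : MemLp (fun x => fderiv ℝ φ x (basisVec i)) 2 (volume.restrict Ω) :=
    memLp_of_continuous (contDiff_fderiv_apply hφ _).continuous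
      (hasCompactSupport_fderiv_apply hφc _) _
  simp_rw [sub_mul]
  rw [integral_sub (integrable_mul_of_memLp hf m2) (integrable_mul_of_memLp hf' m2),
    integral_sub (integrable_mul_of_memLp hg m1) (integrable_mul_of_memLp hg' m1),
    h.2.2 φ hφ hφc hφs, h'.2.2 φ hφ hφc hφs]
  ring

end Norms

/-! ### Strong solutions -/

theorem memLp_coord {X : Type*} [MeasurableSpace X] {μ : Measure X} {u : X → Space d}
    (h : MemLp u 2 μ) (j : Fin (d + 2)) : MemLp (fun x => u x j) 2 μ :=
  h.continuousLinearMap_comp (EuclideanSpace.proj j : Space d →L[ℝ] ℝ)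

theorem memLp_apply {X ι : Type*} [Fintype ι] {E : Type*} [NormedAddCommGroup E] [NormedSpace ℝ E]
    [MeasurableSpace X] {μ : Measure X} {G : X → ι → E} (h : MemLp G 2 μ) (i : ι) :
    MemLp (fun x => G x i) 2 μ :=
  h.continuousLinearMap_comp (ContinuousLinearMap.proj i : (ι → E) →L[ℝ] E)

namespace IsStrongSolution

variable {Ω : Set (Space d)} {μ T T' : ℝ} {u₀ : Space d → Space d} {u ut q : ℝ → Space d → Space d}
  {p : ℝ → Space d → ℝ} {G : ℝ → Space d → Fin (d + 2) → Fin (d + 2) → ℝ}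
  {H : ℝ → Space d → Fin (d + 2) → Fin (d + 2) → Fin (d + 2) → ℝ}

theorem mono (h : IsStrongSolution Ω μ T' u₀ u p ut G H q) (hT : T ≤ T') :
    IsStrongSolution Ω μ T u₀ u p ut G H q := by
  have h1 : spaceTime Ω T ≤ spaceTime Ω T' := prod_restrict_Icc_mono _ hT
  have h2 : volume.restrict (Icc 0 T) ≤ volume.restrict (Icc 0 T') :=
    Measure.restrict_mono (Icc_subset_Icc_right hT) le_rfl
  exact ⟨h.memLp_u.mono_measure h1, h.memLp_ut.mono_measure h1, h.memLp_grad.mono_measure h1,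
    h.memLp_hess.mono_measure h1, h.memLp_p.mono_measure h1, h.memLp_gradp.mono_measure h1,
    fun t ht => h.time_deriv t ⟨ht.1, ht.2.trans hT⟩, ae_mono h2 h.grad, ae_mono h2 h.hess,
    ae_mono h2 h.gradp, ae_mono h1 h.momentum, ae_mono h1 h.incompressible, ae_mono h2 h.kinematic⟩

theorem solenoidal (h : IsStrongSolution Ω μ T u₀ u p ut G H q) (hΩ : IsSmoothBoundedDomain Ω) :
    ∀ᵐ t ∂(volume.restrict (Icc 0 T)), ∃ g, Solenoidal Ω (u t) (G t) g := by
  filter_upwards [h.kinematic, h.grad, Measure.ae_ae_of_ae_prod h.incompressible] with t h1 h2 h3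
  obtain ⟨g, hg, hn⟩ := h1
  refine ⟨g, fun j => (hg j).h1Trace hΩ fun i => h2 i j, ?_, h3⟩
  filter_upwards [hn] with x hx ν hν
  rw [← hx ν hν, PiLp.inner_apply]
  exact Finset.sum_congr rfl fun i _ => by simp [mul_comm]

/-- The velocity is the integral of its time derivative, componentwise. -/
theorem time_deriv_coord (h : IsStrongSolution Ω μ T u₀ u p ut G H q) :
    ∀ t ∈ Icc 0 T, ∀ᵐ x ∂(volume.restrict Ω), ∀ j,
      IntervalIntegrable (fun s => ut s x j) volume 0 t ∧
        u t x j = u₀ x j + ∫ s in (0 : ℝ)..t, ut s x j := fun t ht => by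
  filter_upwards [h.time_deriv t ht, memLp_slice_swap h.memLp_ut] with x h1 h2 j
  have hi : IntervalIntegrable (fun s => ut s x) volume 0 t := by
    rw [intervalIntegrable_iff_integrableOn_Icc_of_le ht.1]
    exact IntegrableOn.mono_set (h2.integrable (by norm_num)) (Icc_subset_Icc_right ht.2)
  have hi' := ContinuousLinearMap.intervalIntegral_comp_comm
    (EuclideanSpace.proj j : Space d →L[ℝ] ℝ) hi
  refine ⟨?_, ?_⟩
  · rw [intervalIntegrable_iff] at hi ⊢
    exact (EuclideanSpace.proj j : Space d →L[ℝ] ℝ).integrable_comp hi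
  · rw [h1]
    exact congrArg (u₀ x j + ·) hi'.symm

end IsStrongSolution

/-! ### Integration of the energy inequality in time -/

/-- The energy estimate for the difference of a Navier–Stokes and an Euler solution. -/
theorem exists_energy_estimate {Ω : Set (Space d)} (hΩ : IsSmoothBoundedDomain Ω)
    (μ₀ T A M : ℝ) (hT : 0 ≤ T) :
    ∃ C : ℝ, 0 < C ∧ ∀ (μ : ℝ) (a : ℝ → Space d → (Space d) [⋀^Fin d]→L[ℝ] ℝ)
      (u₀ : Space d → Space d) (v u vt ut q q' : ℝ → Space d → Space d) (p p' : ℝ → Space d → ℝ)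
      (G G' : ℝ → Space d → Fin (d + 2) → Fin (d + 2) → ℝ)
      (H H' : ℝ → Space d → Fin (d + 2) → Fin (d + 2) → Fin (d + 2) → ℝ),
      μ ∈ Ioc 0 μ₀ → IsStrongSolution Ω μ T u₀ v p vt G H q →
      IsStrongSolution Ω 0 T u₀ u p' ut G' H' q' →
      MemLp (fun z : ℝ × Space d => a z.1 z.2) 2
        ((volume.restrict (Icc 0 T)).prod (surfaceMeasure Ω)) →
      (∀ᵐ t ∂(volume.restrict (Icc 0 T)), VorticityCondition Ω (G t) (a t)) →
      boundaryNorm Ω T a ≤ ENNReal.ofReal A → NormLE Ω T M u →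
      (∀ t ∈ Icc 0 T, eLpNorm (v t - u t) 2 (volume.restrict Ω) ^ 2 ≤ ENNReal.ofReal (C * μ)) ∧
        ∫⁻ t in Icc 0 T, gradNormSq Ω (v t - u t) ≤ ENNReal.ofReal C := by
  obtain ⟨κ⟩ := nonempty_patchCover hΩ
  obtain ⟨C, hC, hen⟩ := κ.energy_le hΩ
  have hσ := isFiniteMeasure_surfaceMeasure hΩ
  have hvol : IsFiniteMeasure (volume.restrict Ω) := ⟨by simpa using hΩ.isBounded.measure_lt_top⟩
  set M' := max M 0 with hM'
  set A' := max A 0 with hA'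
  have hM0 : 0 ≤ M' := le_max_right _ _
  -- The Gronwall rate: the stretching term, and the part of the viscous estimate proportional to
  -- ‖w‖², where μ is bounded by μ₀ to make the rate independent of μ.
  set K := (d + 2) * M' + max μ₀ 0 * C with hK
  have hK0 : 0 ≤ K := by positivity
  set B := C * (T * M' ^ 2 + A' ^ 2) with hB
  have hB0 : 0 ≤ B := by positivity
  set C₁ := 2 * Real.exp (2 * K * T) with hC₁
  set C₂ := 2 + 4 * K * T * Real.exp (2 * K * T) with hC₂
  have hC₁0 : 0 ≤ C₁ := by positivity
  have hC₂0 : 0 ≤ C₂ := by positivity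
  -- B bounds the time integral of the forcing density α, and C₁, C₂ are the factors from
  -- `gronwall_dissipation`. The summand 1 only makes the constant positive.
  refine ⟨C₁ * B + C₂ * B + 1, by positivity,
    fun μ a u₀ v u vt ut q q' p p' G G' H H' hμ hv hu ha hvort haA huM => ?_⟩
  set ν := volume.restrict (Icc 0 T) with hν
  let h : Fin (d + 2) → ℝ × Space d → ℝ := fun j z => vt z.1 z.2 j - ut z.1 z.2 j
  have hh : ∀ j, MemLp (h j) 2 (ν.prod (volume.restrict Ω)) := fun j =>
    (memLp_coord hv.memLp_ut j).sub (memLp_coord hu.memLp_ut j)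
  -- The common initial velocity cancels, so the energy of the difference starts at zero; without
  -- this the estimate would not be of order μ.
  have hw : ∀ j, ∀ t ∈ Icc 0 T, ∀ᵐ x ∂(volume.restrict Ω),
      (fun t x => (v t - u t) x j) t x = ∫ s in (0 : ℝ)..t, h j (s, x) := fun j t ht => by
    filter_upwards [hv.time_deriv_coord t ht, hu.time_deriv_coord t ht] with x h1 h2
    simp only [h, Pi.sub_apply, PiLp.sub_apply]
    rw [intervalIntegral.integral_sub (h1 j).1 (h2 j).1, (h1 j).2, (h2 j).2]
    ring
  have hid := fun j => energy_identity hT (hh j) (hw j)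
  let f : ℝ → ℝ := fun s => ∑ j, ∫ x in Ω, h j (s, x) * (v s - u s) x j
  let D : ℝ → ℝ := fun s => gradSq Ω fun x i j => G s x i j - G' s x i j
  -- This is the part of the viscous estimate that does not involve the difference. It enters the
  -- inequality with the factor μ.
  let α : ℝ → ℝ := fun s => C * (M' ^ 2 + ∫ x, ‖a s x‖ ^ 2 ∂(surfaceMeasure Ω))
  have hfint : IntervalIntegrable f volume 0 T := by
    have := IntervalIntegrable.sum Finset.univ fun j (_ : j ∈ Finset.univ) => (hid j).1
    refine this.congr fun s _ => ?_
    simp [f]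
  have hE : ∀ t ∈ Icc 0 T, l2Sq Ω (v t - u t) = 2 * ∫ s in (0 : ℝ)..t, f s := fun t ht => by
    rw [intervalIntegral.integral_finsetSum, Finset.mul_sum]
    · exact Finset.sum_congr rfl fun j _ => ((hid j).2 t ht).2
    · intro j _
      refine (hid j).1.mono_set ?_
      rw [uIcc_of_le ht.1, uIcc_of_le hT]
      exact Icc_subset_Icc_right ht.2
  have hgradp : ∀ i j, MemLp (fun z : ℝ × Space d => G z.1 z.2 i j - G' z.1 z.2 i j) 2
      (ν.prod (volume.restrict Ω)) := fun i j =>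
    (memLp_apply (memLp_apply hv.memLp_grad i) j).sub (memLp_apply (memLp_apply hu.memLp_grad i) j)
  have hDν : Integrable D ν := integrable_finsetSum _ fun i _ => integrable_finsetSum _ fun j _ =>
    (hgradp i j).integrable_sq.integral_prod_left
  have hD : IntervalIntegrable D volume 0 T := by
    rwa [intervalIntegrable_iff_integrableOn_Icc_of_le hT]
  have ha2 : Integrable (fun z : ℝ × Space d => ‖a z.1 z.2‖ ^ 2) (ν.prod (surfaceMeasure Ω)) :=
    (memLp_two_iff_integrable_sq_norm ha.1).1 ha
  have haν : Integrable (fun s => ∫ x, ‖a s x‖ ^ 2 ∂(surfaceMeasure Ω)) ν := ha2.integral_prod_left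
  have hαν : Integrable α ν := ((integrable_const _).add haν).const_mul C
  have hα : IntervalIntegrable α volume 0 T := by
    rwa [intervalIntegrable_iff_integrableOn_Icc_of_le hT]
  have hαB : ∫ s in (0 : ℝ)..T, α s ≤ B := by
    rw [intervalIntegral.integral_of_le hT, ← integral_Icc_eq_integral_Ioc, integral_const_mul,
      integral_add (integrable_const _) haν, integral_const]
    refine mul_le_mul_of_nonneg_left ?_ hC
    have e1 : ν.real univ = T := by simp [hν, hT]
    have e2 := integral_norm_sq_le ha haA
    rw [integral_prod _ ha2] at e2
    rw [e1, smul_eq_mul]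
    linarith
  have hslices : ∀ᵐ t ∂ν, (∀ j, MemLp (fun x => v t x j) 2 (volume.restrict Ω)) ∧
      (∀ j, MemLp (fun x => u t x j) 2 (volume.restrict Ω)) ∧
      (∀ i j, MemLp (fun x => G t x i j) 2 (volume.restrict Ω)) ∧
      (∀ i j, MemLp (fun x => G' t x i j) 2 (volume.restrict Ω)) := by
    filter_upwards [memLp_slice hv.memLp_u, memLp_slice hu.memLp_u, memLp_slice hv.memLp_grad,
      memLp_slice hu.memLp_grad] with t h1 h2 h3 h4
    exact ⟨memLp_coord h1, memLp_coord h2, fun i => memLp_apply (memLp_apply h3 i),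
      fun i => memLp_apply (memLp_apply h4 i)⟩
  have hineq : ∀ᵐ t ∂ν, f t ≤ - (μ / 2) * D t + K * l2Sq Ω (v t - u t) + μ * α t := by
    filter_upwards [hslices, hv.solenoidal hΩ, hu.solenoidal hΩ, hvort, huM, hv.grad, hu.grad,
      hv.hess, memLp_slice hv.memLp_ut, memLp_slice hu.memLp_ut, memLp_slice hv.memLp_p,
      memLp_slice hu.memLp_p, memLp_slice hv.memLp_gradp, memLp_slice hu.memLp_gradp, hv.gradp,
      hu.gradp, Measure.ae_ae_of_ae_prod hv.momentum, Measure.ae_ae_of_ae_prod hu.momentum,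
      ha2.prod_right_ae, memLp_slice hv.memLp_hess] with t hsl ⟨g, hg⟩ ⟨g', hg'⟩ ⟨gG, hgG, hvo⟩ hNM hGv
      hGu hHv hvt hut hp hp' hq hq' hpq hpq' hmom hmom' hat hHm
    have hGt : ∀ i j, H1Trace Ω (surfaceMeasure Ω) (fun x => G t x i j) (fun k x => H t x k i j)
        (fun x => gG x i j) := fun i j => (hgG i j).h1Trace hΩ fun k => hHv k i j
    have hsym := fun j => hHv.sum_eq_zero hΩ.isOpen hΩ.isBounded hGv hsl.2.2.1
      (fun k i j => memLp_apply (memLp_apply (memLp_apply hHm k) i) j) hg.div j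
    have key := hen μ M' (u t) (v t) g g' (ut t) (vt t) (q t) (q' t) (p t) (p' t) (G t) (G' t) gG
      (H t) (a t) hμ.1.le hg hg' hGt hsym hat hvo (memLp_coord hvt) (memLp_coord hut) hp hp'
      (memLp_coord hq) (memLp_coord hq') hpq hpq'
      (abs_grad_le hΩ.isOpen hGu hNM.2) hmom (hmom'.mono fun x hx j => by simpa using hx j)
    have hft : f t = ∫ x in Ω, ∑ j, (vt t x j - ut t x j) * (v t - u t) x j := by
      rw [integral_finsetSum]
      intro j _
      exact integrable_mul_of_memLp ((memLp_coord hvt j).sub (memLp_coord hut j))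
        ((hsl.1 j).sub (hsl.2.1 j))
    have hS := l2Sq_add_gradSq_le hΩ.isOpen hGu hsl.2.1 hsl.2.2.2 hNM.1
    rw [hft]
    refine key.trans ?_
    have hE0 := l2Sq_nonneg Ω (v t - u t)
    have e1 : μ * (C * (l2Sq Ω (v t - u t) + (l2Sq Ω (u t) + gradSq Ω (G' t))
        + ∫ x, ‖a t x‖ ^ 2 ∂(surfaceMeasure Ω))) ≤ μ * C * l2Sq Ω (v t - u t) + μ * α t := by
      have : μ * (C * (l2Sq Ω (u t) + gradSq Ω (G' t))) ≤ μ * (C * M' ^ 2) :=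
        mul_le_mul_of_nonneg_left (mul_le_mul_of_nonneg_left hS hC) hμ.1.le
      simp only [α]
      linarith
    have e2 : μ * C * l2Sq Ω (v t - u t) ≤ max μ₀ 0 * C * l2Sq Ω (v t - u t) := by
      gcongr
      exact hμ.2.trans (le_max_left _ _)
    rw [hK, add_mul]
    linarith
  have hgron := gronwall_dissipation (E := fun t => l2Sq Ω (v t - u t)) hT hK0 hμ.1 hfint hD hα hE
    (fun t _ => l2Sq_nonneg _ _) (fun t => gradSq_nonneg _ _)
    (fun t => mul_nonneg hC (add_nonneg (sq_nonneg _) (integral_nonneg fun _ => sq_nonneg _))) hineq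
  refine ⟨fun t ht => ?_, ?_⟩
  · rw [eLpNorm_sq_eq fun j => ((hid j).2 t ht).1]
    refine ENNReal.ofReal_le_ofReal ((hgron.1 t ht).trans ?_)
    refine mul_le_mul_of_nonneg_right ?_ hμ.1.le
    have h1 := mul_le_mul_of_nonneg_left hαB hC₁0
    have h2 : 0 ≤ C₂ * B := by positivity
    linarith
  · calc ∫⁻ t in Icc 0 T, gradNormSq Ω (v t - u t) ≤ ∫⁻ t in Icc 0 T, ENNReal.ofReal (D t) := by
          refine lintegral_mono_ae ?_
          filter_upwards [hslices, hv.grad, hu.grad] with t hsl h1 h2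
          have hgr : HasWeakGradient Ω (v t - u t) fun x i j => G t x i j - G' t x i j := fun i j =>
            (h1 i j).sub (h2 i j) (hsl.1 j) (hsl.2.1 j) (hsl.2.2.1 i j) (hsl.2.2.2 i j)
          exact (iInf₂_le _ hgr).trans (lintegral_gradSq
            (G := fun x i j => G t x i j - G' t x i j)
            fun i j => (hsl.2.2.1 i j).sub (hsl.2.2.2 i j)).le
      _ = ENNReal.ofReal (∫ t in Icc 0 T, D t) :=
          (ofReal_integral_eq_lintegral_ofReal hDν (Eventually.of_forall fun t =>
            gradSq_nonneg _ _)).symm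
      _ ≤ _ := by
          refine ENNReal.ofReal_le_ofReal ?_
          have h0 := hgron.2
          rw [intervalIntegral.integral_of_le hT, ← integral_Icc_eq_integral_Ioc] at h0
          have h1 := mul_le_mul_of_nonneg_left hαB hC₂0
          have h2 : 0 ≤ C₁ * B := by positivity
          linarith

end InviscidLimit

end

theorem mainTheorem2 (d : ℕ) (hd : 1 ≤ d) (Ω : Set (Space d)) (hΩ : IsSmoothBoundedDomain Ω)
    (μ₀ T A M : ℝ) (hμ₀ : 0 < μ₀) (hT : 0 ≤ T) :
    ∃ C : ℝ, 0 < C ∧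
      ∀ (Tstar : ℝ) (_ : 0 < Tstar) (_ : T ≤ Tstar)
        (a : ℝ → Space d → (Space d) [⋀^Fin d]→L[ℝ] ℝ) (_ : IsBoundaryField Ω Tstar a)
        (u₀ : Space d → Space d) (uμ : ℝ → ℝ → Space d → Space d) (u : ℝ → Space d → Space d)
        (_ : ∀ μ ∈ Ioc 0 μ₀, IsStrongNavierStokesSolution Ω μ Tstar a u₀ (uμ μ))
        (_ : IsStrongEulerSolution Ω Tstar u₀ u)
        (_ : boundaryNorm Ω T a ≤ ENNReal.ofReal A) (_ : NormLE Ω T M u),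
        (∀ μ ∈ Ioc 0 μ₀,
          (⨆ t ∈ Icc 0 T, eLpNorm (uμ μ t - u t) 2 (volume.restrict Ω) ^ 2)
              ≤ ENNReal.ofReal (C * μ) ∧
          (∫⁻ t in Icc 0 T, gradNormSq Ω (uμ μ t - u t)) ≤ ENNReal.ofReal C) ∧
        Tendsto (fun μ => ⨆ t ∈ Icc 0 T, eLpNorm (uμ μ t - u t) 2 (volume.restrict Ω))
          (𝓝[>] 0) (𝓝 0) := by
  obtain ⟨C, hC, h⟩ := exists_energy_estimate hΩ μ₀ T A M hT
  refine ⟨C, hC, fun Tstar _ hTT a ha u₀ uμ u hNS hE hA hM => ?_⟩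
  obtain ⟨⟨p', ut, G', H', q', hu⟩, -⟩ := hE
  have hTle : volume.restrict (Icc 0 T) ≤ volume.restrict (Icc 0 Tstar) :=
    Measure.restrict_mono (Icc_subset_Icc_right hTT) le_rfl
  have hσ := isFiniteMeasure_surfaceMeasure hΩ
  have key : ∀ μ ∈ Ioc 0 μ₀,
      (∀ t ∈ Icc 0 T, eLpNorm (uμ μ t - u t) 2 (volume.restrict Ω) ^ 2 ≤ ENNReal.ofReal (C * μ)) ∧
        ∫⁻ t in Icc 0 T, gradNormSq Ω (uμ μ t - u t) ≤ ENNReal.ofReal C := fun μ hμ => by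
    obtain ⟨p, vt, G, H, q, hv, hvort⟩ := hNS μ hμ
    exact h μ a u₀ (uμ μ) u vt ut q q' p p' G G' H H' hμ (hv.mono hTT) (hu.mono hTT)
      (ha.memLp.mono_measure (prod_restrict_Icc_mono _ hTT)) (ae_mono hTle hvort) hA hM
  refine ⟨fun μ hμ => ⟨iSup₂_le (key μ hμ).1, (key μ hμ).2⟩, ?_⟩
  -- The bound on the squared norm gives the rate √(Cμ) for the norm itself, uniformly in time.
  have hlim : Tendsto (fun μ : ℝ => ENNReal.ofReal √(C * μ)) (𝓝[>] 0) (𝓝 0) := by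
    have hc : Continuous fun μ : ℝ => ENNReal.ofReal √(C * μ) :=
      ENNReal.continuous_ofReal.comp (by fun_prop)
    simpa using (hc.tendsto 0).mono_left nhdsWithin_le_nhds
  refine tendsto_of_tendsto_of_tendsto_of_le_of_le' tendsto_const_nhds hlim
    (Eventually.of_forall fun _ => zero_le) ?_
  filter_upwards [Ioc_mem_nhdsGT hμ₀] with μ hμ
  refine iSup₂_le fun t ht => ?_
  by_contra hlt
  have h1 := ENNReal.pow_lt_pow_left two_ne_zero (not_le.1 hlt)
  rw [← ENNReal.ofReal_pow (Real.sqrt_nonneg _),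
    Real.sq_sqrt (mul_nonneg hC.le hμ.1.le)] at h1
  exact absurd ((key μ hμ).1 t ht) (not_le.2 h1)
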